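/- **Local well-posedness of the Chen–Lee equation on the circle.** Let $\beta\ge 0$, $\eta>0$ and $s>-1/2$. Consider, for complex-valued $2\pi$-periodic $u$, the Cauchy problem $$u_t+uu_x+\beta\mathcal H u_{xx}+\eta(\mathcal H u_x-u_{xx})=0,\qquad u(0)=\phi ,$$ where $\mathcal H$ is the Fourier multiplier with symbol $i\,\mathrm{sgn}(k)$. For periodic distributions $f$ (continuous linear functionals on $C^\infty(\mathbb T)$) let $\hat f(k)=\frac1{2\pi}\langle f,e^{-ikx}\rangle$, $\|f\|_{H^r}=(2\pi)^{1/2}\|(1+k^2)^{r/2}\hat f(k)\|_{\ell^2(\mathbb Z)}$, $H^r=\{f:\|f\|_{H^r}<\infty\}$ and $H^\infty=\bigcap_{r\in\mathbb R}H^r$ with the projective limit topology. Let $S(t)$, $t\ge0$, be the Fourier multiplier with symbol $\exp\big(i\beta k|k|t-\eta(k^2-|k|)t\big)$. A solution on $[0,T]$ with initial datum $\phi\in H^s$ is a function $$u\in C([0,T];H^s)\cap C((0,T);H^\infty)$$ such that, for all $t\in[0,T]$, $$u(t)=S(t)\phi-\int_0^tS(t-t')\,[u(t')u_x(t')]\,dt',$$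 the integral being that of a distribution-valued function (it converges absolutely against every test function in $C^\infty(\mathbb T)$). For $s<0$ and $0<T\le 1$ let $X_T^s$ be the space of all $u\in C([0,T];H^s)$ with $$\|u\|_{X_T^s}=\sup_{0<t\le T}\big(\|u(t)\|_{H^s}+t^{|s|/2}\|u(t)\|_{L^2}\big)<\infty ,$$ and put $\mathfrak X_T^s=X_T^s$ if $s<0$, $\mathfrak X_T^s=C([0,T];H^s)$ if $s\ge0$. Then there is a function $R\mapsto T(R)\in(0,1]$, depending only on $\beta,\eta,s$, such that for every $\phi_0\in H^s$, with $T=T(\|\phi_0\|_{H^s})$: 1. there is exactly one solution on $[0,T]$ with initial datum $\phi_0$; 2. there is an open ball $B\subset H^s$ centred at $\phi_0$ such that for every $\phi\in B$ there is exactly one solution $u^\phi$ on $[0,T]$ with initial datum $\phi$, and the flow map $\phi\mapsto u^\phi$ is smooth ($C^\infty$ in the sense of Fréchet, over $\mathbb C$) from $B$ to $C([0,T];H^s)\cap C((0,T];H^\infty)\cap\mathfrak X_T^s$. Here smoothness into $C((0,T];H^\infty)$, the projective limit of the Banach spaces $C([\tau,T];H^r)$ with $0<\tau<T$ and $r\in\mathbb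 R$, means smoothness into each of these spaces. -/

import Mathlib

open Set MeasureTheory
open scoped ContDiff ENNReal Real

noncomputable section

namespace ChenLee

/-! ### Smooth periodic functions and periodic distributions -/

/-- The space `C^∞(𝕋)` of smooth `2π`-periodic functions `ℝ → ℂ`. -/
def SmoothPer : Submodule ℂ (ℝ → ℂ) where
  carrier := {f | ContDiff ℝ ∞ f ∧ Function.Periodic f (2 * π)}
  add_mem' := fun hf hg => ⟨hf.1.add hg.1, hf.2.add hg.2⟩
  zero_mem' := ⟨contDiff_const, fun _ => rfl⟩
  smul_mem' := fun c f hf => ⟨contDiff_const.smul hf.1, fun x => by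
    simp only [Pi.smul_apply]; rw [hf.2 x]⟩

/-- The periodic distributions: the linear functionals on `C^∞(𝕋)` that are continuous for the
topology given by the seminorms `sup |f^(j)|`. -/
def PerDist : Submodule ℂ (SmoothPer →ₗ[ℂ] ℂ) where
  carrier := {L | ∃ (N : ℕ) (C : ℝ), ∀ (f : SmoothPer) (M : ℝ),
    (∀ j ≤ N, ∀ x : ℝ, ‖iteratedDeriv j f.1 x‖ ≤ M) → ‖L f‖ ≤ C * M}
  add_mem' := by
    rintro L₁ L₂ ⟨N₁, C₁, h₁⟩ ⟨N₂, C₂, h₂⟩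
    refine ⟨max N₁ N₂, C₁ + C₂, fun f M hM => ?_⟩
    have a := h₁ f M fun j hj => hM j (hj.trans (le_max_left _ _))
    have b := h₂ f M fun j hj => hM j (hj.trans (le_max_right _ _))
    calc ‖(L₁ + L₂) f‖ ≤ ‖L₁ f‖ + ‖L₂ f‖ := norm_add_le _ _
      _ ≤ (C₁ + C₂) * M := by linarith
  zero_mem' := ⟨0, 0, fun f M _ => by simp⟩
  smul_mem' := by
    rintro c L ⟨N, C, h⟩
    refine ⟨N, ‖c‖ * C, fun f M hM => ?_⟩
    rw [LinearMap.smul_apply, norm_smul, mul_assoc]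
    exact mul_le_mul_of_nonneg_left (h f M hM) (norm_nonneg c)

/-- The action of a periodic distribution on a test function. -/
def pair (f : PerDist) (ψ : SmoothPer) : ℂ := f.1 ψ

/-- The derivative of a smooth periodic function. -/
def derivPer (f : SmoothPer) : SmoothPer :=
  ⟨deriv f.1, (contDiff_infty_iff_deriv.1 f.2.1).2, fun x => by
    rw [← deriv_comp_add_const, funext f.2.2]⟩

/-- The pointwise product of smooth periodic functions. -/
def mulPer (f g : SmoothPer) : SmoothPer :=
  ⟨fun x => f.1 x * g.1 x, f.2.1.mul g.2.1, f.2.2.mul g.2.2⟩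

/-- The exponential `x ↦ exp (i k x)`. -/
def expPer (k : ℤ) : SmoothPer :=
  ⟨fun x => Complex.exp (Complex.I * k * x), by
    refine Complex.contDiff_exp.comp (contDiff_const.mul Complex.ofRealCLM.contDiff), fun x => by
    rw [Complex.exp_eq_exp_iff_exists_int]
    exact ⟨k, by push_cast; ring⟩⟩

/-- The Fourier coefficients of a smooth periodic function. -/
def coeffPer (ψ : SmoothPer) (k : ℤ) : ℂ :=
  (2 * π : ℂ)⁻¹ * ∫ x in (-π)..π, Complex.exp (-(Complex.I * k * x)) * ψ.1 x

/-- The Fourier coefficients `(2π)⁻¹ ⟨f, exp (-ikx)⟩` of a periodic distribution. -/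
def coeff (f : PerDist) (k : ℤ) : ℂ := (2 * π : ℂ)⁻¹ * pair f (expPer (-k))

/-! ### Basic facts on Fourier coefficients -/

lemma continuous_per (f : SmoothPer) : Continuous f.1 := f.2.1.continuous

lemma hasDerivAt_per (f : SmoothPer) (x : ℝ) : HasDerivAt f.1 ((derivPer f).1 x) x :=
  ((f.2.1.differentiable (by simp)) x).hasDerivAt

lemma hasDerivAt_exp (a : ℂ) (x : ℝ) :
    HasDerivAt (fun y : ℝ => Complex.exp (a * y)) (a * Complex.exp (a * x)) x := by
  have h : HasDerivAt (fun y : ℝ => a * (y : ℂ)) (a * 1) x :=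
    (Complex.ofRealCLM.hasDerivAt (x := x)).const_mul a
  have := h.cexp
  rwa [mul_one, mul_comm] at this

lemma coeffPer_deriv (ψ : SmoothPer) (k : ℤ) :
    coeffPer (derivPer ψ) k = Complex.I * k * coeffPer ψ k := by
  have hE : ∀ x : ℝ, HasDerivAt (fun y : ℝ => Complex.exp (-(Complex.I * k * y)))
      (-(Complex.I * k) * Complex.exp (-(Complex.I * k * x))) x := by
    intro x
    simpa only [neg_mul] using hasDerivAt_exp (-(Complex.I * k)) x
  have c1 : Continuous fun x : ℝ => Complex.exp (-(Complex.I * k * x)) := by fun_prop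
  have h := intervalIntegral.integral_mul_deriv_eq_deriv_mul (a := -π) (b := π)
    (fun x _ => hE x) (fun x _ => hasDerivAt_per ψ x)
    ((continuous_const.mul c1).intervalIntegrable _ _)
    ((continuous_per (derivPer ψ)).intervalIntegrable _ _)
  have hp : Complex.exp (-(Complex.I * k * (π : ℝ))) * ψ.1 π
      = Complex.exp (-(Complex.I * k * (-π : ℝ))) * ψ.1 (-π) := by
    have e1 : ψ.1 π = ψ.1 (-π) := by
      rw [← ψ.2.2 (-π), show -π + 2 * π = π by ring]
    have e2 : Complex.exp (-(Complex.I * k * (π : ℝ)))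
        = Complex.exp (-(Complex.I * k * (-π : ℝ))) := by
      rw [Complex.exp_eq_exp_iff_exists_int]
      exact ⟨-k, by push_cast; ring⟩
    rw [e1, e2]
  unfold coeffPer
  rw [h, hp, sub_self, zero_sub]
  simp only [mul_assoc, neg_mul, intervalIntegral.integral_neg, neg_neg,
    intervalIntegral.integral_const_mul]
  ring

lemma coeffPer_iterate (ψ : SmoothPer) (k : ℤ) (j : ℕ) :
    coeffPer (derivPer^[j] ψ) k = (Complex.I * k) ^ j * coeffPer ψ k := by
  induction j with
  | zero => simp
  | succ j ih => rw [Function.iterate_succ_apply', coeffPer_deriv, ih]; ring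

lemma iterate_derivPer (ψ : SmoothPer) (j : ℕ) :
    (derivPer^[j] ψ).1 = iteratedDeriv j ψ.1 := by
  induction j with
  | zero => simp
  | succ j ih => rw [Function.iterate_succ_apply', iteratedDeriv_succ, ← ih]; rfl

lemma norm_coeffPer_le (ψ : SmoothPer) (k : ℤ) {M : ℝ} (hM : ∀ x, ‖ψ.1 x‖ ≤ M) :
    ‖coeffPer ψ k‖ ≤ M := by
  have h : ‖∫ x in (-π)..π, Complex.exp (-(Complex.I * k * x)) * ψ.1 x‖ ≤ M * |π - -π| := by
    refine intervalIntegral.norm_integral_le_of_norm_le_const fun x _ => ?_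
    have : -(Complex.I * k * x) = ((-(k * x) : ℝ) : ℂ) * Complex.I := by push_cast; ring
    rw [norm_mul, this, Complex.norm_exp_ofReal_mul_I, one_mul]
    exact hM x
  have hpi := Real.pi_pos
  unfold coeffPer
  rw [norm_mul, norm_inv]
  have e : ‖(2 * π : ℂ)‖ = 2 * π := by
    rw [norm_mul, Complex.norm_real, Real.norm_of_nonneg hpi.le]; simp
  rw [e, inv_mul_le_iff₀ (by positivity)]
  calc _ ≤ _ := h
    _ = _ := by rw [sub_neg_eq_add, abs_of_pos (by positivity)]; ring

lemma coeffPer_decay (ψ : SmoothPer) (m : ℕ) {M : ℝ}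
    (hM : ∀ j ≤ m, ∀ x, ‖iteratedDeriv j ψ.1 x‖ ≤ M) (k : ℤ) :
    (1 + |(k : ℝ)|) ^ m * ‖coeffPer ψ k‖ ≤ 2 ^ m * (2 * M) := by
  have h : ∀ j ≤ m, |(k : ℝ)| ^ j * ‖coeffPer ψ k‖ ≤ M := by
    intro j hj
    have := norm_coeffPer_le (derivPer^[j] ψ) k (M := M) (by
      rw [iterate_derivPer]; exact hM j hj)
    rwa [coeffPer_iterate, norm_mul, norm_pow, norm_mul, Complex.norm_I, one_mul,
      Complex.norm_intCast] at this
  have h0 := h 0 (Nat.zero_le _)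
  have hm := h m le_rfl
  have hk := abs_nonneg (k : ℝ)
  have key : (1 + |(k : ℝ)|) ^ m ≤ 2 ^ m * (1 + |(k : ℝ)| ^ m) := by
    rcases le_total |(k : ℝ)| 1 with h1 | h1
    · calc (1 + |(k : ℝ)|) ^ m ≤ 2 ^ m := pow_le_pow_left₀ (by positivity) (by linarith) m
        _ ≤ _ := le_mul_of_one_le_right (by positivity) (by
          have := pow_nonneg hk m; linarith)
    · calc (1 + |(k : ℝ)|) ^ m ≤ (2 * |(k : ℝ)|) ^ m :=
            pow_le_pow_left₀ (by positivity) (by linarith) m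
        _ = 2 ^ m * |(k : ℝ)| ^ m := mul_pow _ _ _
        _ ≤ _ := mul_le_mul_of_nonneg_left (by linarith) (by positivity)
  calc (1 + |(k : ℝ)|) ^ m * ‖coeffPer ψ k‖
      ≤ 2 ^ m * (1 + |(k : ℝ)| ^ m) * ‖coeffPer ψ k‖ :=
        mul_le_mul_of_nonneg_right key (norm_nonneg _)
    _ = 2 ^ m * (|(k : ℝ)| ^ 0 * ‖coeffPer ψ k‖ + |(k : ℝ)| ^ m * ‖coeffPer ψ k‖) := by ring
    _ ≤ 2 ^ m * (2 * M) := mul_le_mul_of_nonneg_left (by linarith) (by positivity)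

lemma exists_bound_per (ψ : SmoothPer) : ∃ M, ∀ x, ‖ψ.1 x‖ ≤ M := by
  obtain ⟨M, hM⟩ := (isCompact_Icc (a := (0 : ℝ)) (b := 2 * π)).exists_bound_of_continuousOn
    (continuous_per ψ).continuousOn
  refine ⟨M, fun x => ?_⟩
  obtain ⟨y, hy, e⟩ := ψ.2.2.exists_mem_Ico₀ Real.two_pi_pos x
  rw [e]
  exact hM y ⟨hy.1, hy.2.le⟩

lemma exists_bound_iteratedDeriv (ψ : SmoothPer) (m : ℕ) :
    ∃ M, ∀ j ≤ m, ∀ x, ‖iteratedDeriv j ψ.1 x‖ ≤ M := by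
  have h : ∀ j, ∃ M, ∀ x, ‖iteratedDeriv j ψ.1 x‖ ≤ M := fun j => by
    rw [← iterate_derivPer]; exact exists_bound_per _
  choose M hM using h
  refine ⟨∑ i ∈ Finset.range (m + 1), M i, fun j hj x => (hM j x).trans ?_⟩
  exact Finset.single_le_sum (fun i _ => (norm_nonneg _).trans (hM i 0))
    (Finset.mem_range.2 (Nat.lt_succ_of_le hj))

lemma summable_weight : Summable fun k : ℤ => ((1 + |(k : ℝ)|) ^ 2)⁻¹ := by
  have h : Summable fun k : ℤ => 1 / (k : ℝ) ^ 2 := Real.summable_one_div_int_pow.2 one_lt_two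
  have h2 := (hasSum_ite_eq (0 : ℤ) (1 : ℝ)).summable.add h
  refine Summable.of_nonneg_of_le (fun k => by positivity) (fun k => ?_) h2
  by_cases hk : k = 0
  · simp [hk]
  · have : 0 < |(k : ℝ)| := abs_pos.2 (by exact_mod_cast hk)
    simp only [hk, if_false, zero_add, one_div]
    rw [← sq_abs (k : ℝ)]
    exact inv_anti₀ (by positivity) (pow_le_pow_left₀ this.le (by linarith) 2)

lemma summable_decay (ψ : SmoothPer) (m : ℕ) :
    Summable fun k : ℤ => (1 + |(k : ℝ)|) ^ m * ‖coeffPer ψ k‖ := by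
  obtain ⟨M, hM⟩ := exists_bound_iteratedDeriv ψ (m + 2)
  refine Summable.of_nonneg_of_le (fun k => by positivity) (fun k => ?_)
    (summable_weight.mul_left (2 ^ (m + 2) * (2 * M)))
  have h := coeffPer_decay ψ (m + 2) hM k
  have hp : 0 < (1 + |(k : ℝ)|) ^ 2 := by positivity
  rw [← div_eq_mul_inv, le_div_iff₀ hp]
  calc _ = (1 + |(k : ℝ)|) ^ (m + 2) * ‖coeffPer ψ k‖ := by ring
    _ ≤ _ := h

/-- A smooth periodic function is the sum of its Fourier series. -/
lemma hasSum_coeffPer (ψ : SmoothPer) (x : ℝ) :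
    HasSum (fun k : ℤ => coeffPer ψ k * (expPer k).1 x) (ψ.1 x) := by
  have : Fact (0 < 2 * π) := ⟨Real.two_pi_pos⟩
  let F : C(AddCircle (2 * π), ℂ) :=
    ⟨ψ.2.2.lift, continuous_coinduced_dom.2 (continuous_per ψ)⟩
  have hF : ∀ y : ℝ, F (y : AddCircle (2 * π)) = ψ.1 y := fun y => ψ.2.2.lift_coe y
  have hc : ∀ k, fourierCoeff F k = coeffPer ψ k := by
    intro k
    rw [fourierCoeff_eq_intervalIntegral F k (-π)]
    have e : -π + 2 * π = π := by ring
    rw [e]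
    unfold coeffPer
    rw [Complex.real_smul]
    congr 1
    · push_cast; simp
    · refine intervalIntegral.integral_congr fun y _ => ?_
      simp only [hF, smul_eq_mul]
      rw [fourier_coe_apply]
      congr 2
      have : (π : ℂ) ≠ 0 := by exact_mod_cast Real.pi_ne_zero
      push_cast
      field_simp
  have hs : Summable (fourierCoeff F) := by
    refine Summable.of_norm ?_
    simpa [hc] using summable_decay ψ 0
  have h := has_pointwise_sum_fourier_series_of_summable hs (x : AddCircle (2 * π))
  rw [hF] at h
  convert h using 2 with k
  rw [hc, smul_eq_mul, fourier_coe_apply]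
  congr 1
  have : (π : ℂ) ≠ 0 := by exact_mod_cast Real.pi_ne_zero
  simp only [expPer]
  congr 1
  push_cast
  field_simp

lemma iteratedDeriv_expPer (k : ℤ) (j : ℕ) (x : ℝ) :
    iteratedDeriv j (expPer k).1 x = (Complex.I * k) ^ j * (expPer k).1 x := by
  induction j generalizing x with
  | zero => simp
  | succ j ih =>
    rw [iteratedDeriv_succ, funext ih]
    have := (hasDerivAt_exp (Complex.I * k) x).const_mul ((Complex.I * k) ^ j)
    rw [show (fun x => (Complex.I * (k : ℂ)) ^ j * (expPer k).1 x)
      = fun y : ℝ => (Complex.I * (k : ℂ)) ^ j * Complex.exp (Complex.I * k * y) from rfl,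
      this.deriv]
    simp only [expPer]
    ring

lemma norm_expPer (k : ℤ) (x : ℝ) : ‖(expPer k).1 x‖ = 1 := by
  have : Complex.I * k * x = ((k * x : ℝ) : ℂ) * Complex.I := by push_cast; ring
  simp only [expPer]
  rw [this, Complex.norm_exp_ofReal_mul_I]

/-- The trigonometric partial sums of `ψ` converge to `ψ` with all derivatives. -/
lemma partialSum_bound (ψ : SmoothPer) (N : ℕ) (s : Finset ℤ) (j : ℕ) (hj : j ≤ N) (x : ℝ) :
    ‖iteratedDeriv j (ψ - ∑ k ∈ s, coeffPer ψ k • expPer k).1 x‖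
      ≤ ∑' k : {k // k ∉ s}, (1 + |((k : ℤ) : ℝ)|) ^ N * ‖coeffPer ψ k‖ := by
  have e1 : iteratedDeriv j (ψ - ∑ k ∈ s, coeffPer ψ k • expPer k).1 x
      = (derivPer^[j] ψ).1 x
        - ∑ k ∈ s, coeffPer (derivPer^[j] ψ) k * (expPer k).1 x := by
    have a : (ψ - ∑ k ∈ s, coeffPer ψ k • expPer k).1
        = ψ.1 - fun y => ∑ k ∈ s, (coeffPer ψ k • (expPer k).1) y := by
      funext y
      simp
    have hd : ∀ k ∈ s, ContDiffAt ℝ (j : ℕ∞) (coeffPer ψ k • (expPer k).1) x := fun k _ =>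
      ((contDiff_const (c := coeffPer ψ k)).smul
        ((expPer k).2.1.of_le (by exact_mod_cast le_top))).contDiffAt
    rw [a, iteratedDeriv_sub (ψ.2.1.of_le (by exact_mod_cast le_top)).contDiffAt
      (ContDiffAt.sum hd), iteratedDeriv_fun_sum hd, iterate_derivPer]
    congr 1
    refine Finset.sum_congr rfl fun k _ => ?_
    have hc : iteratedDeriv j (coeffPer ψ k • (expPer k).1) x
        = coeffPer ψ k * iteratedDeriv j (expPer k).1 x :=
      iteratedDeriv_const_mul_field (coeffPer ψ k) (expPer k).1
    rw [hc, iteratedDeriv_expPer, coeffPer_iterate]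
    ring
  have hs := hasSum_coeffPer (derivPer^[j] ψ) x
  have h2 := hs.summable.sum_add_tsum_compl (s := s)
  rw [hs.tsum_eq] at h2
  rw [e1, ← h2, add_sub_cancel_left]
  have hS : Summable fun k : {k // k ∉ s} => (1 + |((k : ℤ) : ℝ)|) ^ N * ‖coeffPer ψ k‖ :=
    (summable_decay ψ N).subtype _
  refine tsum_of_norm_bounded hS.hasSum fun k => ?_
  rw [norm_mul, norm_expPer, mul_one, coeffPer_iterate, norm_mul, norm_pow, norm_mul,
    Complex.norm_I, one_mul, Complex.norm_intCast]
  refine mul_le_mul_of_nonneg_right ?_ (norm_nonneg _)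
  have hk := abs_nonneg ((k : ℤ) : ℝ)
  calc |((k : ℤ) : ℝ)| ^ j ≤ (1 + |((k : ℤ) : ℝ)|) ^ j :=
        pow_le_pow_left₀ hk (by linarith) j
    _ ≤ _ := pow_le_pow_right₀ (by linarith) hj

/-- A periodic distribution is determined by its Fourier coefficients. -/
lemma ext_coeff {f : PerDist} (h : ∀ k, coeff f k = 0) : f = 0 := by
  obtain ⟨N, C, hC⟩ := f.2
  have he : ∀ k, f.1 (expPer k) = 0 := by
    intro k
    have := h (-k)
    unfold coeff pair at this
    rw [neg_neg, mul_eq_zero] at this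
    refine this.resolve_left (inv_ne_zero ?_)
    exact_mod_cast Real.two_pi_pos.ne'
  refine Subtype.ext (LinearMap.ext fun ψ => ?_)
  have hb : ∀ s : Finset ℤ, ‖f.1 ψ‖
      ≤ C * ∑' k : {k // k ∉ s}, (1 + |((k : ℤ) : ℝ)|) ^ N * ‖coeffPer ψ k‖ := by
    intro s
    have := hC (ψ - ∑ k ∈ s, coeffPer ψ k • expPer k) _ (partialSum_bound ψ N s)
    simpa [he] using this
  have ht := (tendsto_tsum_compl_atTop_zero
    fun k : ℤ => (1 + |(k : ℝ)|) ^ N * ‖coeffPer ψ k‖).const_mul C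
  rw [mul_zero] at ht
  have := ge_of_tendsto' ht hb
  simpa using this

/-! ### Distributions with given Fourier coefficients, distributions given by functions -/

lemma coeffPer_add (ψ χ : SmoothPer) (k : ℤ) :
    coeffPer (ψ + χ) k = coeffPer ψ k + coeffPer χ k := by
  have c : ∀ θ : SmoothPer, IntervalIntegrable
      (fun x : ℝ => Complex.exp (-(Complex.I * k * x)) * θ.1 x) volume (-π) π := fun θ =>
    (Continuous.mul (by fun_prop) (continuous_per θ)).intervalIntegrable _ _
  unfold coeffPer
  rw [← mul_add, ← intervalIntegral.integral_add (c ψ) (c χ)]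
  simp [mul_add]

lemma coeffPer_smul (c : ℂ) (ψ : SmoothPer) (k : ℤ) :
    coeffPer (c • ψ) k = c * coeffPer ψ k := by
  unfold coeffPer
  simp only [Submodule.coe_smul, Pi.smul_apply, smul_eq_mul, mul_left_comm _ c,
    intervalIntegral.integral_const_mul]

lemma series_bound {a : ℤ → ℂ} {N : ℕ} {C : ℝ}
    (h : ∀ k : ℤ, ‖a k‖ ≤ C * (1 + |(k : ℝ)|) ^ N) (ψ : SmoothPer) {M : ℝ}
    (hM : ∀ j ≤ N + 2, ∀ x, ‖iteratedDeriv j ψ.1 x‖ ≤ M) (k : ℤ) :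
    ‖a k * coeffPer ψ (-k)‖ ≤ C * (2 ^ (N + 2) * (2 * M)) * ((1 + |(k : ℝ)|) ^ 2)⁻¹ := by
  have hC : 0 ≤ C := by
    have := (norm_nonneg _).trans (h 0)
    simpa using this
  have hd := coeffPer_decay ψ (N + 2) hM (-k)
  rw [Int.cast_neg, abs_neg] at hd
  rw [norm_mul, ← div_eq_mul_inv, le_div_iff₀ (by positivity)]
  calc ‖a k‖ * ‖coeffPer ψ (-k)‖ * (1 + |(k : ℝ)|) ^ 2
      ≤ C * (1 + |(k : ℝ)|) ^ N * ‖coeffPer ψ (-k)‖ * (1 + |(k : ℝ)|) ^ 2 := by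
        gcongr
        exact h k
    _ = C * ((1 + |(k : ℝ)|) ^ (N + 2) * ‖coeffPer ψ (-k)‖) := by ring
    _ ≤ _ := mul_le_mul_of_nonneg_left hd hC

lemma series_summable {a : ℤ → ℂ}
    (h : ∃ (N : ℕ) (C : ℝ), ∀ k : ℤ, ‖a k‖ ≤ C * (1 + |(k : ℝ)|) ^ N) (ψ : SmoothPer) :
    Summable fun k : ℤ => a k * coeffPer ψ (-k) := by
  obtain ⟨N, C, hC⟩ := h
  obtain ⟨M, hM⟩ := exists_bound_iteratedDeriv ψ (N + 2)
  exact Summable.of_norm_bounded (summable_weight.mul_left _) (series_bound hC ψ hM)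

/-- `ofCoeff a` is the periodic distribution with Fourier coefficients `a`, for sequences `a` of at
most polynomial growth (the only sequences that are Fourier coefficients of a distribution). -/
def ofCoeff (a : ℤ → ℂ) : PerDist :=
  open Classical in
  if h : ∃ (N : ℕ) (C : ℝ), ∀ k : ℤ, ‖a k‖ ≤ C * (1 + |(k : ℝ)|) ^ N then
    ⟨{ toFun := fun ψ => 2 * π * ∑' k : ℤ, a k * coeffPer ψ (-k)
       map_add' := fun ψ χ => by
        rw [← mul_add, ← (series_summable h ψ).tsum_add (series_summable h χ)]
        simp only [coeffPer_add, mul_add]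
       map_smul' := fun c ψ => by
        simp only [coeffPer_smul, mul_left_comm _ c, tsum_mul_left, RingHom.id_apply,
          smul_eq_mul] }, by
      obtain ⟨N, C, hC⟩ := h
      refine ⟨N + 2, 2 * π * (C * 2 ^ (N + 2) * 2 * ∑' k : ℤ, ((1 + |(k : ℝ)|) ^ 2)⁻¹),
        fun ψ M hM => ?_⟩
      have hb := tsum_of_norm_bounded (summable_weight.mul_left _).hasSum
        (series_bound hC ψ hM)
      rw [tsum_mul_left] at hb
      have e : ‖(2 * π : ℂ)‖ = 2 * π := by
        rw [norm_mul, Complex.norm_real, Real.norm_of_nonneg Real.pi_pos.le]; simp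
      simp only [LinearMap.coe_mk, AddHom.coe_mk]
      rw [norm_mul, e]
      calc _ ≤ 2 * π * _ := mul_le_mul_of_nonneg_left hb Real.two_pi_pos.le
        _ = _ := by ring⟩
  else 0

lemma coeffPer_expPer (j k : ℤ) : coeffPer (expPer j) k = if k = j then 1 else 0 := by
  have hpi : (π : ℂ) ≠ 0 := by exact_mod_cast Real.pi_ne_zero
  have e : ∀ x : ℝ, Complex.exp (-(Complex.I * k * x)) * (expPer j).1 x
      = Complex.exp (Complex.I * (j - k) * x) := fun x => by
    simp only [expPer]
    rw [← Complex.exp_add]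
    congr 1
    ring
  unfold coeffPer
  simp only [e]
  split_ifs with h
  · subst h
    simp only [sub_self, mul_zero, zero_mul, Complex.exp_zero, intervalIntegral.integral_const,
      sub_neg_eq_add, Complex.real_smul, mul_one]
    push_cast
    field_simp
    ring
  · have hc : Complex.I * ((j : ℂ) - k) ≠ 0 :=
      mul_ne_zero Complex.I_ne_zero (sub_ne_zero.2 (by exact_mod_cast (Ne.symm h)))
    rw [integral_exp_mul_complex hc]
    have : Complex.exp (Complex.I * (j - k) * (π : ℝ))
        = Complex.exp (Complex.I * (j - k) * ((-π : ℝ) : ℂ)) := by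
      rw [Complex.exp_eq_exp_iff_exists_int]
      exact ⟨j - k, by push_cast; ring⟩
    rw [this]
    simp

lemma coeff_ofCoeff {a : ℤ → ℂ}
    (h : ∃ (N : ℕ) (C : ℝ), ∀ k : ℤ, ‖a k‖ ≤ C * (1 + |(k : ℝ)|) ^ N) (k : ℤ) :
    coeff (ofCoeff a) k = a k := by
  have hpi : (π : ℂ) ≠ 0 := by exact_mod_cast Real.pi_ne_zero
  unfold coeff pair ofCoeff
  rw [dif_pos h]
  simp only [LinearMap.coe_mk, AddHom.coe_mk, coeffPer_expPer, neg_inj, mul_ite, mul_one,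
    mul_zero, tsum_ite_eq]
  field_simp

lemma coeff_growth (f : PerDist) :
    ∃ (N : ℕ) (C : ℝ), ∀ k : ℤ, ‖coeff f k‖ ≤ C * (1 + |(k : ℝ)|) ^ N := by
  obtain ⟨N, C, hC⟩ := f.2
  refine ⟨N, ‖(2 * π : ℂ)⁻¹‖ * C, fun k => ?_⟩
  unfold coeff pair
  rw [norm_mul, mul_assoc]
  refine mul_le_mul_of_nonneg_left (hC _ _ fun j hj x => ?_) (norm_nonneg _)
  rw [iteratedDeriv_expPer, norm_mul, norm_expPer, mul_one, norm_pow, norm_mul, Complex.norm_I,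
    one_mul, Complex.norm_intCast, Int.cast_neg, abs_neg]
  have hk := abs_nonneg (k : ℝ)
  calc |(k : ℝ)| ^ j ≤ (1 + |(k : ℝ)|) ^ j := pow_le_pow_left₀ hk (by linarith) j
    _ ≤ _ := pow_le_pow_right₀ (by linarith) hj

/-- The distribution `ψ ↦ ∫_{-π}^{π} g ψ` given by a smooth periodic function `g`. -/
def ofPer (g : SmoothPer) : PerDist :=
  ⟨{ toFun := fun ψ => ∫ x in (-π)..π, g.1 x * ψ.1 x
     map_add' := fun ψ χ => by
      have c : ∀ θ : SmoothPer, IntervalIntegrable (fun x => g.1 x * θ.1 x) volume (-π) π :=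
        fun θ => ((continuous_per g).mul (continuous_per θ)).intervalIntegrable _ _
      rw [← intervalIntegral.integral_add (c ψ) (c χ)]
      simp [mul_add]
     map_smul' := fun c ψ => by
      simp only [Submodule.coe_smul, Pi.smul_apply, smul_eq_mul, mul_left_comm _ c,
        intervalIntegral.integral_const_mul, RingHom.id_apply] }, by
    obtain ⟨B, hB⟩ := exists_bound_per g
    refine ⟨0, B * |π - -π|, fun ψ M hM => ?_⟩
    have h := intervalIntegral.norm_integral_le_of_norm_le_const (a := -π) (b := π)
      (f := fun x => g.1 x * ψ.1 x) (C := B * M) fun x _ => by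
        rw [norm_mul]
        have := hM 0 le_rfl x
        rw [iteratedDeriv_zero] at this
        exact mul_le_mul (hB x) this (norm_nonneg _) ((norm_nonneg _).trans (hB x))
    simp only [LinearMap.coe_mk, AddHom.coe_mk]
    calc _ ≤ _ := h
      _ = _ := by ring⟩

/-! ### Sobolev spaces -/

/-- The `H^s(𝕋)` norm `(2π)^{1/2} ‖(1 + k²)^{s/2} f̂(k)‖_{ℓ²(ℤ)}`, with values in `[0, ∞]`. -/
def eSobNorm (s : ℝ) (f : PerDist) : ℝ≥0∞ :=
  ENNReal.ofReal √(2 * π) *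
    eLpNorm (fun k : ℤ => (((1 + (k : ℝ) ^ 2) ^ (s / 2) : ℝ) : ℂ) * coeff f k) 2 Measure.count

lemma coeff_add (f g : PerDist) (k : ℤ) : coeff (f + g) k = coeff f k + coeff g k := by
  simp [coeff, pair, mul_add]

lemma coeff_smul (c : ℂ) (f : PerDist) (k : ℤ) : coeff (c • f) k = c * coeff f k := by
  simp [coeff, pair, mul_left_comm]

lemma eSobNorm_add (s : ℝ) (f g : PerDist) :
    eSobNorm s (f + g) ≤ eSobNorm s f + eSobNorm s g := by
  unfold eSobNorm
  rw [← mul_add]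
  refine mul_le_mul_right ?_ _
  simp only [coeff_add, mul_add]
  exact eLpNorm_add_le (measurable_of_countable _).aestronglyMeasurable
    (measurable_of_countable _).aestronglyMeasurable (by norm_num)

lemma eSobNorm_smul (s : ℝ) (c : ℂ) (f : PerDist) :
    eSobNorm s (c • f) = ‖c‖ₑ * eSobNorm s f := by
  unfold eSobNorm
  rw [mul_left_comm, ← eLpNorm_const_smul]
  congr 2
  funext k
  simp only [coeff_smul, Pi.smul_apply, smul_eq_mul]
  ring

lemma eSobNorm_zero (s : ℝ) : eSobNorm s 0 = 0 := by
  simpa using eSobNorm_smul s 0 0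

lemma eq_zero_of_eSobNorm {s : ℝ} {f : PerDist} (h : eSobNorm s f = 0) : f = 0 := by
  refine ext_coeff fun k => ?_
  unfold eSobNorm at h
  rw [mul_eq_zero] at h
  have h1 : ENNReal.ofReal √(2 * π) ≠ 0 := by
    simpa using Real.sqrt_pos.2 Real.two_pi_pos
  have h2 := (eLpNorm_eq_zero_iff (measurable_of_countable _).aestronglyMeasurable
    (by norm_num)).1 (h.resolve_left h1)
  have h3 := Measure.ae_count_iff.1 h2 k
  simp only [Pi.zero_apply, mul_eq_zero] at h3
  refine h3.resolve_left ?_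
  exact_mod_cast (Real.rpow_pos_of_pos (by positivity) _).ne'

/-- A definite extended norm on a complex vector space that is finite everywhere is a norm. -/
lemma core_of_enorm {E : Type*} [AddCommGroup E] [Module ℂ E] [Norm E] (n : E → ℝ≥0∞)
    (hn : ∀ x, ‖x‖ = (n x).toReal) (hfin : ∀ x, n x < ⊤)
    (hadd : ∀ x y, n (x + y) ≤ n x + n y) (hsmul : ∀ (c : ℂ) x, n (c • x) = ‖c‖ₑ * n x)
    (hdef : ∀ x, n x = 0 → x = 0) : NormedSpace.Core ℂ E where
  norm_nonneg x := by rw [hn]; exact ENNReal.toReal_nonneg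
  norm_smul c x := by rw [hn, hn, hsmul, ENNReal.toReal_mul]; simp
  norm_triangle x y := by
    rw [hn, hn, hn, ← ENNReal.toReal_add (hfin x).ne (hfin y).ne]
    exact ENNReal.toReal_mono (ENNReal.add_lt_top.2 ⟨hfin x, hfin y⟩).ne (hadd x y)
  norm_eq_zero_iff x := by
    rw [hn, ENNReal.toReal_eq_zero_iff, or_iff_left (hfin x).ne]
    refine ⟨hdef x, ?_⟩
    rintro rfl
    simpa using hsmul 0 0

/-- `H^s(𝕋)` as a space of periodic distributions. -/
def sobSubmodule (s : ℝ) : Submodule ℂ PerDist where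
  carrier := {f | eSobNorm s f < ⊤}
  add_mem' := fun {f g} hf hg =>
    (eSobNorm_add s f g).trans_lt (ENNReal.add_lt_top.2 ⟨hf, hg⟩)
  zero_mem' := by simp [eSobNorm_zero]
  smul_mem' := fun c f hf => by
    change eSobNorm s (c • f) < ⊤
    rw [eSobNorm_smul]
    exact ENNReal.mul_lt_top (by simp) hf

/-- The Sobolev space `H^s(𝕋)`. -/
def Sob (s : ℝ) : Type := sobSubmodule s

instance (s : ℝ) : AddCommGroup (Sob s) := inferInstanceAs (AddCommGroup (sobSubmodule s))

instance (s : ℝ) : Module ℂ (Sob s) := inferInstanceAs (Module ℂ (sobSubmodule s))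

/-- An element of `H^s(𝕋)` as a periodic distribution. -/
def Sob.dist {s : ℝ} (f : Sob s) : PerDist := f.1

instance (s : ℝ) : Norm (Sob s) := ⟨fun f => (eSobNorm s f.dist).toReal⟩

lemma sob_core (s : ℝ) : NormedSpace.Core ℂ (Sob s) :=
  core_of_enorm (fun f => eSobNorm s f.dist) (fun _ => rfl) (fun f => f.2)
    (fun f g => eSobNorm_add s f.dist g.dist) (fun c f => eSobNorm_smul s c f.dist)
    (fun _ h => Subtype.ext (eq_zero_of_eSobNorm h))

instance (s : ℝ) : NormedAddCommGroup (Sob s) := NormedAddCommGroup.ofCore (sob_core s)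

instance (s : ℝ) : NormedSpace ℂ (Sob s) := NormedSpace.ofCore (sob_core s)

/-! ### Spaces of time dependent functions -/

/-- The Banach space `C([a, b]; H^s(𝕋))` with the supremum norm. -/
abbrev CSob (a b s : ℝ) : Type := C(Icc a b, Sob s)

/-- A curve in `C([0, T]; H^s(𝕋))` as a curve of distributions (only its values at times in
`[0, T]` are relevant; outside it is extended by constants). -/
def curve {s : ℝ} {T : Ioc (0 : ℝ) 1} (u : CSob 0 T s) : ℝ → PerDist :=
  IccExtend T.2.1.le fun t => (u t).dist

/-- `u ∈ C(I; H^∞(𝕋))`, where `H^∞` is the intersection of all `H^r` with the projective limit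
topology. -/
def ContHInf (I : Set ℝ) (u : ℝ → PerDist) : Prop :=
  ∀ r : ℝ, ∃ v : ℝ → Sob r, ContinuousOn v I ∧ ∀ t ∈ I, (v t).dist = u t

/-- The norm `sup_{0 < t ≤ T} (‖u(t)‖_{H^s} + t^{|s|/2} ‖u(t)‖_{L²})`, with values in `[0, ∞]`. -/
def eXNorm {s : ℝ} {T : Ioc (0 : ℝ) 1} (u : CSob 0 T s) : ℝ≥0∞ :=
  ⨆ t ∈ Ioc (0 : ℝ) T,
    (eSobNorm s (curve u t) + ENNReal.ofReal (t ^ (|s| / 2)) * eSobNorm 0 (curve u t))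

lemma curve_add {s : ℝ} {T : Ioc (0 : ℝ) 1} (u v : CSob 0 T s) (t : ℝ) :
    curve (u + v) t = curve u t + curve v t := rfl

lemma curve_smul {s : ℝ} {T : Ioc (0 : ℝ) 1} (c : ℂ) (u : CSob 0 T s) (t : ℝ) :
    curve (c • u) t = c • curve u t := rfl

lemma eXNorm_add {s : ℝ} {T : Ioc (0 : ℝ) 1} (u v : CSob 0 T s) :
    eXNorm (u + v) ≤ eXNorm u + eXNorm v := by
  refine iSup₂_le fun t ht => ?_
  have hu := le_iSup₂ (f := fun (t : ℝ) (_ : t ∈ Ioc (0 : ℝ) T) =>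
    eSobNorm s (curve u t) + ENNReal.ofReal (t ^ (|s| / 2)) * eSobNorm 0 (curve u t)) t ht
  have hv := le_iSup₂ (f := fun (t : ℝ) (_ : t ∈ Ioc (0 : ℝ) T) =>
    eSobNorm s (curve v t) + ENNReal.ofReal (t ^ (|s| / 2)) * eSobNorm 0 (curve v t)) t ht
  refine le_trans ?_ (add_le_add hu hv)
  rw [curve_add, add_add_add_comm, ← mul_add]
  exact add_le_add (eSobNorm_add _ _ _) (mul_le_mul_right (eSobNorm_add _ _ _) _)

lemma eXNorm_smul {s : ℝ} {T : Ioc (0 : ℝ) 1} (c : ℂ) (u : CSob 0 T s) :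
    eXNorm (c • u) = ‖c‖ₑ * eXNorm u := by
  unfold eXNorm
  simp only [ENNReal.mul_iSup, curve_smul, eSobNorm_smul, mul_add, mul_left_comm _ ‖c‖ₑ]

lemma eq_zero_of_eXNorm {s : ℝ} {T : Ioc (0 : ℝ) 1} (u : CSob 0 T s) (h : eXNorm u = 0) :
    u = 0 := by
  have h1 : ∀ t : Icc (0 : ℝ) T, 0 < (t : ℝ) → u t = 0 := by
    intro t ht
    have h2 := le_iSup₂ (f := fun (t : ℝ) (_ : t ∈ Ioc (0 : ℝ) T) =>
      eSobNorm s (curve u t) + ENNReal.ofReal (t ^ (|s| / 2)) * eSobNorm 0 (curve u t))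
      (t : ℝ) ⟨ht, t.2.2⟩
    rw [show (⨆ t ∈ Ioc (0 : ℝ) T, (eSobNorm s (curve u t)
      + ENNReal.ofReal (t ^ (|s| / 2)) * eSobNorm 0 (curve u t))) = 0 from h] at h2
    have h3 := eq_zero_of_eSobNorm (add_eq_zero.1 (le_antisymm h2 zero_le)).1
    refine Subtype.ext ?_
    rw [curve, IccExtend_of_mem _ _ t.2] at h3
    exact h3
  ext1 t
  have hd : Dense {t : Icc (0 : ℝ) T | 0 < (t : ℝ)} := by
    have hT : (0 : ℝ) < T := T.2.1
    refine fun t => Metric.mem_closure_iff.2 fun ε hε => ?_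
    rcases t.2.1.lt_or_eq with ht | ht
    · exact ⟨t, ht, by simpa using hε⟩
    · have hm : 0 < min (ε / 2) (T : ℝ) := lt_min (by linarith) hT
      refine ⟨⟨min (ε / 2) T, hm.le, min_le_right _ _⟩, hm, ?_⟩
      rw [Subtype.dist_eq, ← ht, Real.dist_eq, zero_sub, abs_neg, abs_of_pos hm]
      exact (min_le_left _ _).trans_lt (by linarith)
  have he := Continuous.ext_on hd u.continuous (continuous_const (y := (0 : Sob s)))
    fun t ht => h1 t ht
  exact congrFun he t

/-- The weighted space `X_T^s`: all `u ∈ C([0, T]; H^s(𝕋))` with finite norm. -/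
def xSubmodule (s : ℝ) (T : Ioc (0 : ℝ) 1) : Submodule ℂ (CSob 0 T s) where
  carrier := {u | eXNorm u < ⊤}
  add_mem' := fun {u v} hu hv => (eXNorm_add u v).trans_lt (ENNReal.add_lt_top.2 ⟨hu, hv⟩)
  zero_mem' := by
    have := eXNorm_smul (s := s) (T := T) 0 0
    rw [zero_smul, enorm_zero, zero_mul] at this
    simp [this]
  smul_mem' := fun c u hu => by
    change eXNorm (c • u) < ⊤
    rw [eXNorm_smul]
    exact ENNReal.mul_lt_top (by simp) hu

/-- The weighted space `X_T^s`. -/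
def XSpace (s : ℝ) (T : Ioc (0 : ℝ) 1) : Type := xSubmodule s T

instance (s : ℝ) (T : Ioc (0 : ℝ) 1) : AddCommGroup (XSpace s T) :=
  inferInstanceAs (AddCommGroup (xSubmodule s T))

instance (s : ℝ) (T : Ioc (0 : ℝ) 1) : Module ℂ (XSpace s T) :=
  inferInstanceAs (Module ℂ (xSubmodule s T))

/-- An element of `X_T^s` as an element of `C([0, T]; H^s(𝕋))`. -/
def XSpace.toC {s : ℝ} {T : Ioc (0 : ℝ) 1} (u : XSpace s T) : CSob 0 T s := u.1

instance (s : ℝ) (T : Ioc (0 : ℝ) 1) : Norm (XSpace s T) := ⟨fun u => (eXNorm u.toC).toReal⟩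

lemma x_core (s : ℝ) (T : Ioc (0 : ℝ) 1) : NormedSpace.Core ℂ (XSpace s T) :=
  core_of_enorm (fun u => eXNorm u.toC) (fun _ => rfl) (fun u => u.2)
    (fun u v => eXNorm_add u.toC v.toC) (fun c u => eXNorm_smul c u.toC)
    (fun u h => Subtype.ext (eq_zero_of_eXNorm u.toC h))

instance (s : ℝ) (T : Ioc (0 : ℝ) 1) : NormedAddCommGroup (XSpace s T) :=
  NormedAddCommGroup.ofCore (x_core s T)

instance (s : ℝ) (T : Ioc (0 : ℝ) 1) : NormedSpace ℂ (XSpace s T) :=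
  NormedSpace.ofCore (x_core s T)

/-! ### The Chen-Lee equation -/

/-- The semigroup `S(t) f = (exp (i q(k) t - p(k) t) f̂)^∨`, `t ≥ 0`, with `q(k) = β k |k|` and
`p(k) = η (k² - |k|)`. -/
def semigroup (β η t : ℝ) (f : PerDist) : PerDist :=
  ofCoeff fun k => Complex.exp
    (Complex.I * ((β * (k * |(k : ℝ)|) : ℝ) : ℂ) * t - ((η * ((k : ℝ) ^ 2 - |(k : ℝ)|) : ℝ) : ℂ) * t)
      * coeff f k

/-- The nonlinearity `u uₓ` for a distribution `u` that is given by a smooth function, that is,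
for `u ∈ H^∞(𝕋)`. -/
def nonlin (u : PerDist) : PerDist :=
  open Classical in
  if h : ∃ g : SmoothPer, ofPer g = u then ofPer (mulPer h.choose (derivPer h.choose)) else 0

/-- `u ∈ C([0, T]; H^s) ∩ C((0, T); H^∞)` solves the integral equation
`u(t) = S(t) φ - ∫₀ᵗ S(t - t') [u(t') uₓ(t')] dt'` for all `t ∈ [0, T]`. Both sides are periodic
distributions, and so is the integral: it is tested against the smooth periodic functions. -/
def IsSolution (β η : ℝ) {s : ℝ} (T : Ioc (0 : ℝ) 1) (φ : Sob s) (u : CSob 0 T s) : Prop :=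
  ContHInf (Ioo 0 T) (curve u) ∧
  ∀ t ∈ Icc (0 : ℝ) T, ∀ ψ : SmoothPer,
    IntervalIntegrable (fun t' => pair (semigroup β η (t - t') (nonlin (curve u t'))) ψ)
      volume 0 t ∧
    pair (curve u t) ψ = pair (semigroup β η t φ.dist) ψ
      - ∫ t' in (0 : ℝ)..t, pair (semigroup β η (t - t') (nonlin (curve u t'))) ψ

end ChenLee
end

/-!
The equation is solved on the Fourier side, where every estimate becomes a bound for one Fourier
coefficient at a time, followed by domination by a fixed `ℓ²` sequence.

**The working space.** Put `α = max (-s) 0 / 2`, which is less than `1/4` because `s > -1/2`, and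
`ρ = max s 0 = s + 2α ≥ 0`. A curve `u` is encoded by `U` with
`Û_k(t) = t^α exp (√t |k|) û_k(t)`, and the fixed point problem is solved for `U` in the Banach
space `C([0, T]; H^ρ)`. Since `√t - √t' ≤ √(t - t')`, the Gevrey weight `exp (√t |k|)` passes
through the Duhamel integral at the cost of a bounded factor (`exists_sym_bound`,
`exists_duh_bound`). For `t > 0` it dominates every power of `⟨k⟩`, so one fixed point argument
gives the smoothing and the smoothness into all the spaces `C([τ, T]; H^r)` (`exists_smoothing`).

**The bilinear estimate.** The weights of `H^ρ`, `ρ ≥ 0`, are submultiplicative up to a constant,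
so by the Cauchy-Schwarz inequality the product of two elements of `H^ρ` has Fourier coefficients
of size `O(⟨k⟩^{-ρ})` (`conv_bound`). The bound `‖Ŝ(t)_k‖ ≤ C (t ⟨k⟩²)^{-m}` for a suitable
`m < 1` makes the Fourier coefficients of the Duhamel integral of the product square summable with
the weight of the target space, and gains the factor `T^θ` with
`θ = (1/4 - α)/2 > 0` (`exists_duhamel`).

**Existence and smooth dependence.** The integral equation reads `U + D(U, U) = L φ` with `L`
bounded linear and `D` bounded bilinear of norm `O(T^θ)`. The map `U ↦ U + D(U, U)` is a smooth
diffeomorphism near the origin, on a ball as large as needed if `T` is small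
(`exists_quadratic_inverse`). Applying linear and bilinear operators with values in the other
spaces of the theorem to `φ` and `U` gives the smoothness of the flow map into these spaces
(`exists_flow`).

**Uniqueness.** A solution in the sense of the theorem need not have a finite weighted norm a
priori. It is smooth at every `t₀ ∈ (0, T)`, and restarted at `t₀` it obeys
`t^α ‖u(t₀ + t)‖_{H^ρ} ≤ K` on a time interval independent of `t₀`, by the continuity method
(`exists_apriori`). Letting `t₀ → 0` bounds the weighted norm of `u` itself
(`IsSolution.exists_bound`). Two solutions with bounded weighted norms agree on short time intervals
by contraction, hence on `[0, T]` (`exists_local_uniqueness`, `IsSolution.unique`).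
-/

noncomputable section

namespace ChenLee

open scoped NNReal

/-! ### Sobolev norms on the Fourier side -/

/-- The Japanese bracket squared, `⟨k⟩² = 1 + k²`. -/
def jb (k : ℤ) : ℝ := 1 + (k : ℝ) ^ 2

lemma one_le_jb (k : ℤ) : 1 ≤ jb k := by unfold jb; nlinarith [sq_nonneg (k : ℝ)]

lemma jb_pos (k : ℤ) : 0 < jb k := zero_lt_one.trans_le (one_le_jb k)

lemma jb_rpow_half_sq (r : ℝ) (k : ℤ) : (jb k ^ (r / 2)) ^ 2 = jb k ^ r := by
  rw [← Real.rpow_natCast, ← Real.rpow_mul (jb_pos k).le]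
  congr 1
  push_cast
  ring

lemma eSobNorm_sq (s : ℝ) (f : PerDist) :
    eSobNorm s f ^ 2
      = ENNReal.ofReal (2 * π) * ∑' k : ℤ, ENNReal.ofReal (jb k ^ s * ‖coeff f k‖ ^ 2) := by
  unfold eSobNorm
  rw [mul_pow, ← ENNReal.ofReal_pow (Real.sqrt_nonneg _), Real.sq_sqrt Real.two_pi_pos.le]
  congr 1
  rw [eLpNorm_eq_lintegral_rpow_enorm_toReal (by norm_num) (by norm_num), lintegral_count]
  simp only [ENNReal.toReal_ofNat]
  rw [← ENNReal.rpow_natCast, ← ENNReal.rpow_mul]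
  norm_num
  refine tsum_congr fun k => ?_
  rw [← jb_rpow_half_sq, ← mul_pow, ENNReal.ofReal_pow (by have := jb_pos k; positivity),
    ENNReal.ofReal_mul (Real.rpow_nonneg (jb_pos k).le _), ofReal_norm]
  congr 2
  rw [← ofReal_norm, Complex.norm_real, Real.norm_of_nonneg]
  · rfl
  · exact Real.rpow_nonneg (jb_pos k).le _

lemma eSobNorm_lt_top_iff (s : ℝ) (f : PerDist) :
    eSobNorm s f < ⊤ ↔ Summable fun k : ℤ => jb k ^ s * ‖coeff f k‖ ^ 2 := by
  have hn : ∀ k : ℤ, 0 ≤ jb k ^ s * ‖coeff f k‖ ^ 2 := fun k => by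
    have := jb_pos k; positivity
  have h2 : ENNReal.ofReal (2 * π) ≠ 0 := by simpa using Real.two_pi_pos
  have : eSobNorm s f < ⊤ ↔ eSobNorm s f ^ 2 < ⊤ := by simp
  rw [this, eSobNorm_sq]
  constructor
  · intro h
    have h1 : ∑' k : ℤ, ENNReal.ofReal (jb k ^ s * ‖coeff f k‖ ^ 2) ≠ ⊤ := by
      intro h3
      rw [h3, ENNReal.mul_top h2] at h
      exact lt_irrefl _ h
    have := ENNReal.summable_toReal h1
    simpa only [ENNReal.toReal_ofReal (hn _)] using this
  · intro h
    exact ENNReal.mul_lt_top ENNReal.ofReal_lt_top h.tsum_ofReal_lt_top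

lemma sob_summable {s : ℝ} (f : Sob s) : Summable fun k : ℤ => jb k ^ s * ‖coeff f.dist k‖ ^ 2 :=
  (eSobNorm_lt_top_iff s f.dist).1 f.2

lemma sob_norm_sq {s : ℝ} (f : Sob s) :
    ‖f‖ ^ 2 = 2 * π * ∑' k : ℤ, jb k ^ s * ‖coeff f.dist k‖ ^ 2 := by
  have hn : ∀ k : ℤ, 0 ≤ jb k ^ s * ‖coeff f.dist k‖ ^ 2 := fun k => by
    have := jb_pos k; positivity
  have h : ‖f‖ = (eSobNorm s f.dist).toReal := rfl
  rw [h, ← ENNReal.toReal_pow, eSobNorm_sq, ENNReal.toReal_mul,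
    ENNReal.toReal_ofReal Real.two_pi_pos.le, ← ENNReal.ofReal_tsum_of_nonneg hn (sob_summable f),
    ENNReal.toReal_ofReal (tsum_nonneg hn)]

/-- Sequences with finite weighted `ℓ²` norm have polynomial growth. -/
lemma growth_of_summable {r : ℝ} {a : ℤ → ℂ} (h : Summable fun k : ℤ => jb k ^ r * ‖a k‖ ^ 2) :
    ∃ (N : ℕ) (C : ℝ), ∀ k : ℤ, ‖a k‖ ≤ C * (1 + |(k : ℝ)|) ^ N := by
  obtain ⟨N, hN⟩ := exists_nat_ge (|r|)
  refine ⟨N, 1 + ∑' k : ℤ, jb k ^ r * ‖a k‖ ^ 2, fun k => ?_⟩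
  set S := ∑' k : ℤ, jb k ^ r * ‖a k‖ ^ 2
  have hk := jb_pos k
  have hS : jb k ^ r * ‖a k‖ ^ 2 ≤ S :=
    h.le_tsum k fun j _ => by have := jb_pos j; positivity
  have hS0 : 0 ≤ S := le_trans (by positivity) hS
  have h1 : ‖a k‖ ^ 2 ≤ S * jb k ^ N := by
    have e : ‖a k‖ ^ 2 = jb k ^ (-r) * (jb k ^ r * ‖a k‖ ^ 2) := by
      rw [← mul_assoc, ← Real.rpow_add hk]; simp
    rw [e, mul_comm, ← Real.rpow_natCast (jb k)]
    exact mul_le_mul hS (Real.rpow_le_rpow_of_exponent_le (one_le_jb k)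
      ((neg_le_abs r).trans hN)) (by positivity) hS0
  have h2 : jb k ≤ (1 + |(k : ℝ)|) ^ 2 := by
    unfold jb; rw [← sq_abs (k : ℝ)]; nlinarith [abs_nonneg (k : ℝ)]
  refine abs_le_of_sq_le_sq' (a := ‖a k‖) ?_ (by positivity) |>.2
  calc ‖a k‖ ^ 2 ≤ S * jb k ^ N := h1
    _ ≤ (1 + S) ^ 2 * ((1 + |(k : ℝ)|) ^ 2) ^ N := by
      gcongr
      nlinarith
    _ = _ := by rw [mul_pow, ← pow_mul, ← pow_mul, mul_comm N 2]

lemma ofCoeff_mem {r : ℝ} {a : ℤ → ℂ} (h : Summable fun k : ℤ => jb k ^ r * ‖a k‖ ^ 2) :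
    ofCoeff a ∈ sobSubmodule r :=
  (eSobNorm_lt_top_iff r _).2 (by simpa only [coeff_ofCoeff (growth_of_summable h)] using h)

/-- The element of `H^r` with Fourier coefficients `a` (zero if there is none). -/
def sobOf (r : ℝ) (a : ℤ → ℂ) : Sob r :=
  open Classical in
  if h : Summable fun k : ℤ => jb k ^ r * ‖a k‖ ^ 2 then
    (⟨ofCoeff a, ofCoeff_mem h⟩ : sobSubmodule r)
  else 0

lemma coeff_sobOf {r : ℝ} {a : ℤ → ℂ} (h : Summable fun k : ℤ => jb k ^ r * ‖a k‖ ^ 2) (k : ℤ) :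
    coeff (sobOf r a).dist k = a k := by
  have e : (sobOf r a).dist = ofCoeff a := by
    have : sobOf r a = (⟨ofCoeff a, ofCoeff_mem h⟩ : sobSubmodule r) := dif_pos h
    rw [this]
    rfl
  rw [e]
  exact coeff_ofCoeff (growth_of_summable h) k

lemma coeff_dist_add {r : ℝ} (f g : Sob r) (k : ℤ) :
    coeff (f + g).dist k = coeff f.dist k + coeff g.dist k := coeff_add _ _ k

lemma coeff_dist_smul {r : ℝ} (c : ℂ) (f : Sob r) (k : ℤ) :
    coeff (c • f).dist k = c * coeff f.dist k := coeff_smul _ _ k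

lemma coeff_dist_sub {r : ℝ} (f g : Sob r) (k : ℤ) :
    coeff (f - g).dist k = coeff f.dist k - coeff g.dist k := by
  have : f - g = f + (-1 : ℂ) • g := by rw [neg_one_smul, sub_eq_add_neg]
  rw [this, coeff_dist_add, coeff_dist_smul]
  ring

lemma coeff_dist_zero {r : ℝ} (k : ℤ) : coeff (0 : Sob r).dist k = 0 := by
  have := coeff_dist_smul 0 (0 : Sob r) k
  rwa [zero_smul, zero_mul] at this

lemma perDist_ext {f g : PerDist} (h : ∀ k, coeff f k = coeff g k) : f = g := by
  have : f - g = 0 := ext_coeff fun k => by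
    have e : f - g = f + (-1 : ℂ) • g := by module
    rw [e, coeff_add, coeff_smul, h k]
    ring
  exact sub_eq_zero.1 this

lemma sob_ext {r : ℝ} {f g : Sob r} (h : ∀ k, coeff f.dist k = coeff g.dist k) : f = g :=
  Subtype.ext (perDist_ext h)

lemma weighted_sq (r : ℝ) (a : ℤ → ℂ) (k : ℤ) :
    (jb k ^ (r / 2) * ‖a k‖) ^ 2 = jb k ^ r * ‖a k‖ ^ 2 := by
  rw [mul_pow, jb_rpow_half_sq]

lemma summable_of_dominated {r : ℝ} {a : ℤ → ℂ} {b : ℤ → ℝ}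
    (hb : Summable fun k => b k ^ 2) (h : ∀ k, jb k ^ (r / 2) * ‖a k‖ ≤ b k) :
    Summable fun k : ℤ => jb k ^ r * ‖a k‖ ^ 2 := by
  refine Summable.of_nonneg_of_le (fun k => ?_) (fun k => ?_) hb
  · have := jb_pos k; positivity
  · rw [← weighted_sq]
    exact pow_le_pow_left₀ (by have := jb_pos k; positivity) (h k) 2

lemma sob_norm_le_of_dominated {r : ℝ} {f : Sob r} {b : ℤ → ℝ}
    (hb : Summable fun k => b k ^ 2) (h : ∀ k, jb k ^ (r / 2) * ‖coeff f.dist k‖ ≤ b k) :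
    ‖f‖ ≤ √(2 * π * ∑' k, b k ^ 2) := by
  refine Real.le_sqrt_of_sq_le ?_
  rw [sob_norm_sq]
  refine mul_le_mul_of_nonneg_left ?_ Real.two_pi_pos.le
  refine (sob_summable f).tsum_le_tsum (fun k => ?_) hb
  rw [← weighted_sq]
  exact pow_le_pow_left₀ (by have := jb_pos k; positivity) (h k) 2

/-- Comparison of Sobolev norms through the Fourier coefficients. -/
lemma sob_norm_le_mul {r r' : ℝ} {f : Sob r} {g : Sob r'} {C : ℝ} (hC : 0 ≤ C)
    (h : ∀ k, jb k ^ (r / 2) * ‖coeff f.dist k‖ ≤ C * (jb k ^ (r' / 2) * ‖coeff g.dist k‖)) :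
    ‖f‖ ≤ C * ‖g‖ := by
  have e : ∀ k, (C * (jb k ^ (r' / 2) * ‖coeff g.dist k‖)) ^ 2
      = C ^ 2 * (jb k ^ r' * ‖coeff g.dist k‖ ^ 2) := fun k => by
    rw [mul_pow, weighted_sq]
  have h1 := sob_norm_le_of_dominated (by simpa only [e] using (sob_summable g).mul_left (C ^ 2)) h
  refine h1.trans (le_of_eq ?_)
  simp only [e, tsum_mul_left]
  rw [mul_left_comm, ← sob_norm_sq, ← mul_pow, Real.sqrt_sq (by positivity)]

lemma coeff_le_norm {r : ℝ} (f : Sob r) (k : ℤ) : jb k ^ (r / 2) * ‖coeff f.dist k‖ ≤ ‖f‖ := by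
  refine abs_le_of_sq_le_sq' ?_ (norm_nonneg f) |>.2
  rw [weighted_sq, sob_norm_sq]
  have h := (sob_summable f).le_tsum k fun j _ => by have := jb_pos j; positivity
  have hk : 0 ≤ jb k ^ r * ‖coeff f.dist k‖ ^ 2 := by have := jb_pos k; positivity
  have := Real.pi_gt_three
  nlinarith

lemma norm_coeff_le {r : ℝ} (f : Sob r) (k : ℤ) :
    ‖coeff f.dist k‖ ≤ jb k ^ (-(r / 2)) * ‖f‖ := by
  have h := coeff_le_norm f k
  have hk := jb_pos k
  calc ‖coeff f.dist k‖ = jb k ^ (-(r / 2)) * (jb k ^ (r / 2) * ‖coeff f.dist k‖) := by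
        rw [← mul_assoc, ← Real.rpow_add hk]; simp
    _ ≤ _ := by gcongr

lemma continuous_coeff {r : ℝ} (k : ℤ) : Continuous fun f : Sob r => coeff f.dist k := by
  let L : Sob r →ₗ[ℂ] ℂ :=
    { toFun := fun f => coeff f.dist k
      map_add' := fun f g => coeff_dist_add f g k
      map_smul' := fun c f => coeff_dist_smul c f k }
  exact (L.mkContinuous (jb k ^ (-(r / 2))) fun f => norm_coeff_le f k).continuous

/-- Dominated convergence in `H^r`: a family whose Fourier coefficients are continuous and dominated
by a fixed `ℓ²` sequence is continuous in `H^r`. -/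
lemma continuousWithinAt_sob {X : Type*} [TopologicalSpace X] {r : ℝ} {v : X → Sob r} {S : Set X}
    {x : X} {b : ℤ → ℝ} (hb : Summable fun k => b k ^ 2) (hx : x ∈ S)
    (hc : ∀ k, ContinuousWithinAt (fun y => coeff (v y).dist k) S x)
    (h : ∀ y ∈ S, ∀ k, jb k ^ (r / 2) * ‖coeff (v y).dist k‖ ≤ b k) :
    ContinuousWithinAt v S x := by
  unfold ContinuousWithinAt
  rw [tendsto_iff_norm_sub_tendsto_zero]
  have h1 : Filter.Tendsto (fun y => ∑' k, jb k ^ r * ‖coeff (v y - v x).dist k‖ ^ 2)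
      (nhdsWithin x S) (nhds (∑' _ : ℤ, (0 : ℝ))) := by
    refine tendsto_tsum_of_dominated_convergence (bound := fun k => 4 * b k ^ 2)
      (hb.mul_left 4) (fun k => ?_) ?_
    · have h2 : Filter.Tendsto (fun y => jb k ^ r * ‖coeff (v y).dist k - coeff (v x).dist k‖ ^ 2)
          (nhdsWithin x S) (nhds (jb k ^ r * ‖coeff (v x).dist k - coeff (v x).dist k‖ ^ 2)) :=
        (((hc k).sub continuousWithinAt_const).norm.pow 2).const_mul _
      simpa only [coeff_dist_sub, sub_self, norm_zero, ne_eq, OfNat.ofNat_ne_zero,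
        not_false_eq_true, zero_pow, mul_zero] using h2
    · filter_upwards [self_mem_nhdsWithin] with y hy k
      have hk := jb_pos k
      rw [Real.norm_of_nonneg (by positivity), coeff_dist_sub,
        ← weighted_sq r (fun k => coeff (v y).dist k - coeff (v x).dist k)]
      have h3 : jb k ^ (r / 2) * ‖coeff (v y).dist k - coeff (v x).dist k‖ ≤ 2 * b k := by
        calc _ ≤ jb k ^ (r / 2) * (‖coeff (v y).dist k‖ + ‖coeff (v x).dist k‖) := by
              gcongr; exact norm_sub_le _ _
          _ ≤ _ := by rw [mul_add]; linarith [h y hy k, h x hx k]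
      calc _ ≤ (2 * b k) ^ 2 := pow_le_pow_left₀ (by positivity) h3 2
        _ = _ := by ring
  rw [tsum_zero] at h1
  have h2 := (h1.const_mul (2 * π)).sqrt
  simpa only [← sob_norm_sq, Real.sqrt_sq (norm_nonneg _), mul_zero, Real.sqrt_zero] using h2

/-- The weighted Fourier coefficients, normalised so that their `ℓ²` norm is the `H^r` norm. -/
def l2Coeff {r : ℝ} (f : Sob r) (k : ℤ) : ℂ :=
  ((√(2 * π) * jb k ^ (r / 2) : ℝ) : ℂ) * coeff f.dist k

lemma norm_l2Coeff_sq {r : ℝ} (f : Sob r) (k : ℤ) :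
    ‖l2Coeff f k‖ ^ 2 = 2 * π * (jb k ^ r * ‖coeff f.dist k‖ ^ 2) := by
  have hk := jb_pos k
  have hp := Real.pi_pos
  rw [l2Coeff, norm_mul, Complex.norm_real, Real.norm_of_nonneg (by positivity), mul_pow, mul_pow,
    jb_rpow_half_sq, Real.sq_sqrt (by positivity), mul_assoc]

lemma memℓp_l2Coeff {r : ℝ} (f : Sob r) : Memℓp (l2Coeff f) 2 := by
  refine memℓp_gen ?_
  simp only [ENNReal.toReal_ofNat, Real.rpow_ofNat, norm_l2Coeff_sq]
  exact (sob_summable f).mul_left (2 * π)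

/-- `H^r` is isometric to `ℓ²(ℤ)` by the weighted Fourier coefficients. -/
def toL2 (r : ℝ) : Sob r →ₗᵢ[ℂ] lp (fun _ : ℤ => ℂ) 2 where
  toFun f := ⟨l2Coeff f, memℓp_l2Coeff f⟩
  map_add' f g := by
    ext k
    change l2Coeff (f + g) k = l2Coeff f k + l2Coeff g k
    rw [l2Coeff, coeff_dist_add, mul_add]
    rfl
  map_smul' c f := by
    ext k
    change l2Coeff (c • f) k = c * l2Coeff f k
    rw [l2Coeff, coeff_dist_smul, mul_left_comm]
    rfl
  norm_map' f := by
    refine (sq_eq_sq₀ (norm_nonneg _) (norm_nonneg _)).1 ?_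
    have h := lp.norm_rpow_eq_tsum (p := 2) (by simp)
      (⟨l2Coeff f, memℓp_l2Coeff f⟩ : lp (fun _ : ℤ => ℂ) 2)
    simp only [ENNReal.toReal_ofNat, Real.rpow_ofNat, norm_l2Coeff_sq] at h
    rw [sob_norm_sq, ← tsum_mul_left]
    exact h

lemma toL2_surjective (r : ℝ) : Function.Surjective (toL2 r) := by
  intro a
  have hp := Real.pi_pos
  have hs : Summable fun k : ℤ =>
      jb k ^ r * ‖(((√(2 * π) * jb k ^ (r / 2))⁻¹ : ℝ) : ℂ) * a k‖ ^ 2 := by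
    have h := (lp.memℓp a).summable (by simp)
    simp only [ENNReal.toReal_ofNat, Real.rpow_ofNat] at h
    refine (h.mul_left (2 * π)⁻¹).congr fun k => ?_
    have hk := jb_pos k
    rw [norm_mul, Complex.norm_real, Real.norm_of_nonneg (by positivity), mul_pow, inv_pow, mul_pow,
      jb_rpow_half_sq, Real.sq_sqrt (by positivity)]
    have := Real.rpow_pos_of_pos hk r
    field_simp
  refine ⟨sobOf r fun k => (((√(2 * π) * jb k ^ (r / 2))⁻¹ : ℝ) : ℂ) * a k, ?_⟩
  ext k
  change l2Coeff _ k = a k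
  have := Real.rpow_pos_of_pos (jb_pos k) (r / 2)
  rw [l2Coeff, coeff_sobOf hs, ← mul_assoc, ← Complex.ofReal_mul, mul_inv_cancel₀ (by positivity),
    Complex.ofReal_one, one_mul]

instance (r : ℝ) : CompleteSpace (Sob r) :=
  ((toL2 r).isometry.isUniformInducing.completeSpace_congr (toL2_surjective r)).2 inferInstance

/-- The powers of `⟨k⟩²` that are summable over `ℤ`. -/
lemma summable_jb_rpow {p : ℝ} (hp : p < -(1 / 2)) : Summable fun k : ℤ => jb k ^ p := by
  have h : Summable fun k : ℤ => |(k : ℝ)| ^ (2 * p) := by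
    have := Real.summable_abs_int_rpow (b := -(2 * p)) (by linarith)
    simpa using this
  have h2 := (hasSum_ite_eq (0 : ℤ) (1 : ℝ)).summable.add h
  refine Summable.of_nonneg_of_le (fun k => Real.rpow_nonneg (jb_pos k).le _) (fun k => ?_) h2
  by_cases hk : k = 0
  · simp only [hk, if_true, jb]
    norm_num
    exact Real.rpow_nonneg (by norm_num) _
  · have hk' : 0 < |(k : ℝ)| := abs_pos.2 (by exact_mod_cast hk)
    simp only [hk, if_false, zero_add]
    rw [Real.rpow_mul hk'.le]
    refine Real.rpow_le_rpow_of_nonpos (by positivity) ?_ (by linarith)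
    simp [jb]

lemma summable_jb_rpow_sq {p : ℝ} (hp : p < -(1 / 4)) : Summable fun k : ℤ => (jb k ^ p) ^ 2 := by
  have : ∀ k : ℤ, (jb k ^ p) ^ 2 = jb k ^ (2 * p) := fun k => by
    rw [mul_comm, Real.rpow_mul (jb_pos k).le, Real.rpow_ofNat]
  simp only [this]
  exact summable_jb_rpow (by linarith)

lemma abs_le_jb_rpow_half (k : ℤ) : |(k : ℝ)| ≤ jb k ^ (1 / 2 : ℝ) := by
  rw [← Real.sqrt_eq_rpow]
  refine Real.le_sqrt_of_sq_le ?_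
  rw [sq_abs, jb]
  linarith

lemma norm_half_deriv_symbol_le (k : ℤ) : ‖Complex.I * (k : ℂ) / 2‖ ≤ jb k ^ (1 / 2 : ℝ) := by
  rw [norm_div, norm_mul, Complex.norm_I, one_mul, Complex.norm_intCast, Complex.norm_ofNat]
  linarith [abs_nonneg (k : ℝ), abs_le_jb_rpow_half k]

/-! ### Convolutions -/

/-- The convolution of two sequences, that is, the Fourier coefficients of a product. -/
def conv (a b : ℤ → ℂ) (k : ℤ) : ℂ := ∑' j : ℤ, a j * b (k - j)

lemma jb_le_mul (j k : ℤ) : jb k ≤ 2 * (jb j * jb (k - j)) := by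
  unfold jb
  push_cast
  nlinarith [sq_nonneg ((j : ℝ) - (k - j)), sq_nonneg ((j : ℝ) * (k - j))]

/-- The Cauchy-Schwarz inequality for the convolution of two `ℓ²` sequences. -/
lemma summable_conv_sob {ρ : ℝ} (f g : Sob ρ) (k : ℤ) :
    Summable (fun j => (jb j ^ (ρ / 2) * ‖coeff f.dist j‖)
        * (jb (k - j) ^ (ρ / 2) * ‖coeff g.dist (k - j)‖)) ∧
      ∑' j, (jb j ^ (ρ / 2) * ‖coeff f.dist j‖)
        * (jb (k - j) ^ (ρ / 2) * ‖coeff g.dist (k - j)‖) ≤ ‖f‖ * ‖g‖ := by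
  have hx : ∀ (h : Sob ρ) (j : ℤ), 0 ≤ jb j ^ (ρ / 2) * ‖coeff h.dist j‖ := fun h j => by
    have := jb_pos j; positivity
  have hs : ∀ h : Sob ρ, Summable fun j => (jb j ^ (ρ / 2) * ‖coeff h.dist j‖) ^ (2 : ℝ) := by
    intro h
    simp only [Real.rpow_ofNat, weighted_sq ρ (coeff h.dist)]
    exact sob_summable h
  have hle : ∀ h : Sob ρ,
      (∑' j, (jb j ^ (ρ / 2) * ‖coeff h.dist j‖) ^ (2 : ℝ)) ^ (1 / (2 : ℝ)) ≤ ‖h‖ := by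
    intro h
    rw [← Real.sqrt_eq_rpow]
    refine Real.sqrt_le_iff.2 ⟨norm_nonneg _, ?_⟩
    simp only [Real.rpow_ofNat, weighted_sq ρ (coeff h.dist)]
    rw [sob_norm_sq]
    have h0 : 0 ≤ ∑' j, jb j ^ ρ * ‖coeff h.dist j‖ ^ 2 :=
      tsum_nonneg fun j => by have := jb_pos j; positivity
    nlinarith [Real.pi_gt_three]
  have hs' := (Equiv.subLeft k).summable_iff.2 (hs g)
  have H := Real.summable_and_inner_le_Lp_mul_Lq_tsum_of_nonneg Real.HolderConjugate.two_two
    (hx f) (fun j => hx g (k - j)) (hs f) hs'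
  refine ⟨H.1, H.2.trans ?_⟩
  have e : ∑' j, (jb (k - j) ^ (ρ / 2) * ‖coeff g.dist (k - j)‖) ^ (2 : ℝ)
      = ∑' j, (jb j ^ (ρ / 2) * ‖coeff g.dist j‖) ^ (2 : ℝ) :=
    (Equiv.subLeft k).tsum_eq fun j => (jb j ^ (ρ / 2) * ‖coeff g.dist j‖) ^ (2 : ℝ)
  rw [e]
  exact mul_le_mul (hle f) (hle g) (by
    refine Real.rpow_nonneg (tsum_nonneg fun j => Real.rpow_nonneg (hx g j) _) _) (norm_nonneg _)

/-- The product estimate: both the Sobolev weight (for `ρ ≥ 0`) and the Gevrey weight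
`exp (κ |k|)` are submultiplicative, so that the convolution of weighted `ℓ²` sequences is a
weighted bounded sequence. -/
lemma conv_bound {ρ : ℝ} (hρ : 0 ≤ ρ) {κ : ℝ} (hκ : 0 ≤ κ) (f g : Sob ρ) {a b : ℤ → ℂ} {A B : ℝ}
    (hA : 0 ≤ A) (hB : 0 ≤ B)
    (ha : ∀ j, ‖a j‖ ≤ A * Real.exp (-(κ * |(j : ℝ)|)) * ‖coeff f.dist j‖)
    (hb : ∀ j, ‖b j‖ ≤ B * Real.exp (-(κ * |(j : ℝ)|)) * ‖coeff g.dist j‖) (k : ℤ) :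
    Summable (fun j => ‖a j * b (k - j)‖) ∧
      ‖conv a b k‖ ≤ A * B * 2 ^ (ρ / 2) * (‖f‖ * ‖g‖)
        * (jb k ^ (-(ρ / 2)) * Real.exp (-(κ * |(k : ℝ)|))) := by
  obtain ⟨h1, h2⟩ := summable_conv_sob f g k
  set D := A * B * 2 ^ (ρ / 2) * (jb k ^ (-(ρ / 2)) * Real.exp (-(κ * |(k : ℝ)|))) with hD
  have hk := jb_pos k
  have hD0 : 0 ≤ D := by positivity
  have key : ∀ j, ‖a j * b (k - j)‖ ≤ D * ((jb j ^ (ρ / 2) * ‖coeff f.dist j‖)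
      * (jb (k - j) ^ (ρ / 2) * ‖coeff g.dist (k - j)‖)) := by
    intro j
    have hj := jb_pos j
    have hkj := jb_pos (k - j)
    have e1 : Real.exp (-(κ * |(j : ℝ)|)) * Real.exp (-(κ * |((k - j : ℤ) : ℝ)|))
        ≤ Real.exp (-(κ * |(k : ℝ)|)) := by
      rw [← Real.exp_add, Real.exp_le_exp]
      have : |(k : ℝ)| ≤ |(j : ℝ)| + |((k - j : ℤ) : ℝ)| := by
        have := abs_add_le (j : ℝ) ((k - j : ℤ) : ℝ)
        push_cast at this ⊢
        simpa using this
      nlinarith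
    have e2 : 1 ≤ 2 ^ (ρ / 2) * (jb j ^ (ρ / 2) * jb (k - j) ^ (ρ / 2)) * jb k ^ (-(ρ / 2)) := by
      rw [← Real.mul_rpow hj.le hkj.le, ← Real.mul_rpow zero_le_two (by positivity),
        Real.rpow_neg hk.le, ← div_eq_mul_inv, one_le_div (by positivity)]
      exact Real.rpow_le_rpow hk.le (jb_le_mul j k) (by positivity)
    rw [norm_mul]
    calc ‖a j‖ * ‖b (k - j)‖
        ≤ (A * Real.exp (-(κ * |(j : ℝ)|)) * ‖coeff f.dist j‖)
          * (B * Real.exp (-(κ * |((k - j : ℤ) : ℝ)|)) * ‖coeff g.dist (k - j)‖) :=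
        mul_le_mul (ha j) (hb _) (norm_nonneg _) (by positivity)
      _ = A * B * (‖coeff f.dist j‖ * ‖coeff g.dist (k - j)‖)
          * (Real.exp (-(κ * |(j : ℝ)|)) * Real.exp (-(κ * |((k - j : ℤ) : ℝ)|))) * 1 := by ring
      _ ≤ A * B * (‖coeff f.dist j‖ * ‖coeff g.dist (k - j)‖) * Real.exp (-(κ * |(k : ℝ)|))
          * (2 ^ (ρ / 2) * (jb j ^ (ρ / 2) * jb (k - j) ^ (ρ / 2)) * jb k ^ (-(ρ / 2))) := by
        gcongr
      _ = _ := by rw [hD]; ring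
  have hs : Summable (fun j => ‖a j * b (k - j)‖) :=
    Summable.of_nonneg_of_le (fun j => norm_nonneg _) key (h1.mul_left D)
  refine ⟨hs, (norm_tsum_le_tsum_norm hs).trans ?_⟩
  refine (hs.tsum_le_tsum key (h1.mul_left D)).trans ?_
  rw [tsum_mul_left]
  calc _ ≤ D * (‖f‖ * ‖g‖) := mul_le_mul_of_nonneg_left h2 hD0
    _ = _ := by rw [hD]; ring

/-! ### The kernel of the semigroup -/

/-- The symbol of `S(t)`. -/
def sym (β η t : ℝ) (k : ℤ) : ℂ :=
  Complex.exp (Complex.I * ((β * (k * |(k : ℝ)|) : ℝ) : ℂ) * t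
    - ((η * ((k : ℝ) ^ 2 - |(k : ℝ)|) : ℝ) : ℂ) * t)

lemma sym_add (β η t t' : ℝ) (k : ℤ) : sym β η (t + t') k = sym β η t k * sym β η t' k := by
  unfold sym
  rw [← Complex.exp_add]
  congr 1
  push_cast
  ring

lemma sym_zero (β η : ℝ) (k : ℤ) : sym β η 0 k = 1 := by simp [sym]

lemma sym_sub (β η t t' : ℝ) (k : ℤ) :
    sym β η (t - t') k = sym β η t k * sym β η (-t') k := by
  rw [sub_eq_add_neg, sym_add]

lemma continuous_sym (β η : ℝ) (k : ℤ) : Continuous fun t => sym β η t k := by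
  unfold sym
  fun_prop

lemma norm_sym (β η t : ℝ) (k : ℤ) :
    ‖sym β η t k‖ = Real.exp (-(η * ((k : ℝ) ^ 2 - |(k : ℝ)|) * t)) := by
  unfold sym
  rw [Complex.norm_exp]
  congr 1
  have : Complex.I * ((β * (k * |(k : ℝ)|) : ℝ) : ℂ) * t
    - ((η * ((k : ℝ) ^ 2 - |(k : ℝ)|) : ℝ) : ℂ) * t
    = ((-(η * ((k : ℝ) ^ 2 - |(k : ℝ)|) * t) : ℝ) : ℂ)
      + ((β * (k * |(k : ℝ)|) * t : ℝ) : ℂ) * Complex.I := by push_cast; ring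
  rw [this, Complex.add_re, Complex.ofReal_re, Complex.re_ofReal_mul, Complex.I_re]
  ring

lemma abs_le_sq_int (k : ℤ) : |(k : ℝ)| ≤ (k : ℝ) ^ 2 := by
  rw [← sq_abs]
  rcases eq_or_ne k 0 with rfl | hk
  · simp
  · have : 1 ≤ |(k : ℝ)| := by exact_mod_cast Int.one_le_abs hk
    nlinarith

lemma norm_sym_le_one (β : ℝ) {η t : ℝ} (hη : 0 < η) (ht : 0 ≤ t) (k : ℤ) :
    ‖sym β η t k‖ ≤ 1 := by
  rw [norm_sym, Real.exp_le_one_iff, neg_nonpos]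
  have := abs_le_sq_int k
  have h : 0 ≤ (k : ℝ) ^ 2 - |(k : ℝ)| := by linarith
  positivity

lemma exists_rpow_le_exp {m c : ℝ} (hm : 0 ≤ m) (hc : 0 < c) :
    ∃ C > 0, ∀ y ≥ 0, (1 + y) ^ m ≤ C * Real.exp (c * y) := by
  set d := max 1 (m / c) with hd
  have hd1 : 1 ≤ d := le_max_left _ _
  have hd2 : m / d ≤ c := by
    rw [div_le_iff₀ (by linarith), mul_comm, ← div_le_iff₀ hc]
    exact le_max_right _ _
  refine ⟨d ^ m, by positivity, fun y hy => ?_⟩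
  have h1 : 1 + y ≤ d * Real.exp (y / d) := by
    have := Real.add_one_le_exp (y / d)
    calc 1 + y ≤ d * (y / d + 1) := by
          rw [mul_add, mul_div_cancel₀ _ (by linarith : d ≠ 0)]; linarith
      _ ≤ _ := by gcongr
  calc (1 + y) ^ m ≤ (d * Real.exp (y / d)) ^ m := Real.rpow_le_rpow (by linarith) h1 hm
    _ = d ^ m * Real.exp (m / d * y) := by
      rw [Real.mul_rpow (by linarith) (Real.exp_pos _).le, ← Real.exp_mul]
      congr 2
      ring
    _ ≤ _ := by gcongr

/-- The smoothing estimate of the semigroup, with the Gevrey weight `exp (√t |k|)`. -/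
lemma exists_sym_bound (β : ℝ) {η m : ℝ} (hη : 0 < η) (hm : 0 ≤ m) :
    ∃ C > 0, ∀ t ∈ Icc (0 : ℝ) 1, ∀ k : ℤ,
      (t * jb k) ^ m * (Real.exp (√t * |(k : ℝ)|) * ‖sym β η t k‖) ≤ C := by
  obtain ⟨C, hC, h⟩ := exists_rpow_le_exp hm (half_pos hη)
  refine ⟨C * Real.exp ((η + 1) ^ 2 / (2 * η)), by positivity, fun t ht k => ?_⟩
  -- In terms of `x = √t |k|`, and for `t ≤ 1`, the exponent is at most `-η x² + (η + 1) x`, and the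
  -- square of `x` absorbs both the linear term and the power of `t ⟨k⟩² ≤ 1 + x²`.
  set x := √t * |(k : ℝ)| with hx
  have hx0 : 0 ≤ x := by positivity
  have hs1 : √t ≤ 1 := Real.sqrt_le_one.2 ht.2
  have hs := Real.sq_sqrt ht.1
  have hx2 : x ^ 2 = t * (k : ℝ) ^ 2 := by rw [hx, mul_pow, hs, sq_abs]
  have h1 : t * jb k ≤ 1 + x ^ 2 := by
    rw [hx2, jb]; linarith [ht.2]
  have h2 : t * |(k : ℝ)| ≤ x := by
    rw [hx]
    refine mul_le_mul_of_nonneg_right ?_ (abs_nonneg _)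
    nlinarith [Real.sqrt_nonneg t]
  calc (t * jb k) ^ m * (Real.exp x * ‖sym β η t k‖)
      ≤ (C * Real.exp (η / 2 * x ^ 2)) * Real.exp (x - η * x ^ 2 + η * x) := by
        refine mul_le_mul ?_ ?_ (by positivity) (by positivity)
        · have := jb_pos k
          exact (Real.rpow_le_rpow (mul_nonneg ht.1 this.le) h1 hm).trans (h _ (sq_nonneg x))
        · rw [norm_sym, ← Real.exp_add, Real.exp_le_exp, hx2]
          nlinarith
    _ = C * Real.exp (η / 2 * x ^ 2 + (x - η * x ^ 2 + η * x)) := by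
        rw [mul_assoc, ← Real.exp_add]
    _ ≤ _ := by
        refine mul_le_mul_of_nonneg_left (Real.exp_le_exp.2 ?_) hC.le
        rw [le_div_iff₀ (by positivity)]
        nlinarith [sq_nonneg (η * x - (η + 1))]

/-! ### The Duhamel integral -/

/-- Convergence and size of the Beta integral `∫₀ᵗ (t - t')^{-m} t'^{-p} dt'`. -/
lemma exists_beta_bound {m p : ℝ} (hm : 0 ≤ m) (hm1 : m < 1) (hp : 0 ≤ p) (hp1 : p < 1) :
    ∃ C > 0, ∀ t > 0, ∃ h : ℝ → ℝ, IntervalIntegrable h volume 0 t ∧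
      (∀ t' ∈ Ioc 0 t, (t - t') ^ (-m) * t' ^ (-p) ≤ h t') ∧
      ∫ t' in (0 : ℝ)..t, h t' ≤ C * t ^ (1 - m - p) := by
  -- On each half of `[0, t]` one of the two factors is at most its value at `t / 2`.
  refine ⟨2 ^ m / (1 - p) + 2 ^ p / (1 - m),
    add_pos (div_pos (by positivity) (by linarith)) (div_pos (by positivity) (by linarith)),
    fun t ht => ?_⟩
  have ip : IntervalIntegrable (fun t' : ℝ => t' ^ (-p)) volume 0 t :=
    intervalIntegral.intervalIntegrable_rpow' (by linarith)
  have im : IntervalIntegrable (fun t' : ℝ => (t - t') ^ (-m)) volume 0 t := by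
    have := (intervalIntegral.intervalIntegrable_rpow' (a := 0) (b := t)
      (by linarith : -1 < -m)).comp_sub_left t
    simpa using this.symm
  refine ⟨fun t' => (t / 2) ^ (-m) * t' ^ (-p) + (t / 2) ^ (-p) * (t - t') ^ (-m),
    (ip.const_mul _).add (im.const_mul _), fun t' ht' => ?_, ?_⟩
  · have h0 : 0 ≤ (t - t') ^ (-m) := Real.rpow_nonneg (by linarith [ht'.2]) _
    have h1 : 0 ≤ t' ^ (-p) := Real.rpow_nonneg ht'.1.le _
    rcases le_total t' (t / 2) with h | h
    · have : (t - t') ^ (-m) ≤ (t / 2) ^ (-m) :=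
        Real.rpow_le_rpow_of_nonpos (by linarith) (by linarith) (by linarith)
      have h3 : 0 ≤ (t / 2) ^ (-p) * (t - t') ^ (-m) := by positivity
      nlinarith
    · have : t' ^ (-p) ≤ (t / 2) ^ (-p) :=
        Real.rpow_le_rpow_of_nonpos (by linarith) (by linarith) (by linarith)
      have h3 : 0 ≤ (t / 2) ^ (-m) * t' ^ (-p) := by positivity
      nlinarith
  · rw [intervalIntegral.integral_add (ip.const_mul _) (im.const_mul _),
      intervalIntegral.integral_const_mul, intervalIntegral.integral_const_mul,
      integral_rpow (Or.inl (by linarith)), intervalIntegral.integral_comp_sub_left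
        (fun x => x ^ (-m)) t, sub_self, sub_zero, integral_rpow (Or.inl (by linarith)),
      Real.zero_rpow (by linarith), Real.zero_rpow (by linarith), sub_zero, sub_zero]
    have e1 : (t / 2) ^ (-m) * (t ^ (-p + 1) / (-p + 1)) = 2 ^ m / (1 - p) * t ^ (1 - m - p) := by
      rw [Real.div_rpow ht.le zero_le_two, Real.rpow_neg zero_le_two,
        show 1 - m - p = -m + (-p + 1) by ring, Real.rpow_add ht (-m) (-p + 1), show 1 - p = -p + 1 by ring]
      field_simp
    have e2 : (t / 2) ^ (-p) * (t ^ (-m + 1) / (-m + 1)) = 2 ^ p / (1 - m) * t ^ (1 - m - p) := by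
      rw [Real.div_rpow ht.le zero_le_two, Real.rpow_neg zero_le_two,
        show 1 - m - p = -p + (-m + 1) by ring, Real.rpow_add ht (-p) (-m + 1), show 1 - m = -m + 1 by ring]
      field_simp
    rw [e1, e2]
    exact le_of_eq (by ring)

/-- The Fourier coefficients of the Duhamel integral `∫₀ᵗ S(t - t') ½∂ₓf(t') dt'`. -/
def duh (β η : ℝ) (f : ℝ → ℤ → ℂ) (t : ℝ) (k : ℤ) : ℂ :=
  ∫ t' in (0 : ℝ)..t, sym β η (t - t') k * (Complex.I * k / 2 * f t' k)

/-- The Duhamel estimate, for each Fourier coefficient. The Gevrey weight passes through because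
`√t - √t' ≤ √(t - t')`. -/
lemma exists_duh_bound (β : ℝ) {η m p : ℝ} (hη : 0 < η) (hm : 0 ≤ m) (hm1 : m < 1) (hp : 0 ≤ p)
    (hp1 : p < 1) :
    ∃ C > 0, ∀ (q A μ t : ℝ) (k : ℤ) (f : ℝ → ℤ → ℂ), 0 ≤ A → 0 ≤ μ → μ ≤ 1 → 0 < t → t ≤ 1 →
      (∀ t' ∈ Ioo 0 t, ‖f t' k‖
        ≤ A * t' ^ (-p) * (jb k ^ (-q) * Real.exp (-(μ * √t' * |(k : ℝ)|)))) →
      ‖duh β η f t k‖ ≤ C * A * t ^ (1 - m - p)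
        * (jb k ^ (1 / 2 - m - q) * Real.exp (-(μ * √t * |(k : ℝ)|))) := by
  obtain ⟨C₁, hC₁, h₁⟩ := exists_sym_bound β hη hm
  obtain ⟨C₂, hC₂, h₂⟩ := exists_beta_bound hm hm1 hp hp1
  refine ⟨C₁ * C₂, by positivity, fun q A μ t k f hA hμ hμ1 ht ht1 hf => ?_⟩
  obtain ⟨h, hi, hb, hint⟩ := h₂ t ht
  have hk := jb_pos k
  set D := C₁ * A * (jb k ^ (1 / 2 - m - q) * Real.exp (-(μ * √t * |(k : ℝ)|))) with hD
  have hD0 : 0 ≤ D := by positivity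
  have key : ∀ t' ∈ Ioc 0 t, t' ≠ t →
      ‖sym β η (t - t') k * (Complex.I * k / 2 * f t' k)‖ ≤ D * h t' := by
    intro t' ht' hne
    have hlt : 0 < t - t' := sub_pos.2 (lt_of_le_of_ne ht'.2 hne)
    have a1 := h₁ (t - t') ⟨hlt.le, by linarith [ht'.1]⟩ k
    have a3 : √t ≤ √t' + √(t - t') := by
      refine Real.sqrt_le_iff.2 ⟨by positivity, ?_⟩
      nlinarith [Real.sq_sqrt ht'.1.le, Real.sq_sqrt hlt.le, Real.sqrt_nonneg t',
        Real.sqrt_nonneg (t - t'), mul_nonneg (Real.sqrt_nonneg t') (Real.sqrt_nonneg (t - t'))]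
    have a4 : Real.exp (-(μ * √t' * |(k : ℝ)|))
        ≤ Real.exp (-(μ * √t * |(k : ℝ)|)) * Real.exp (√(t - t') * |(k : ℝ)|) := by
      rw [← Real.exp_add, Real.exp_le_exp]
      have : μ * √t * |(k : ℝ)| ≤ (μ * √t' + √(t - t')) * |(k : ℝ)| := by
        refine mul_le_mul_of_nonneg_right ?_ (abs_nonneg _)
        nlinarith [Real.sqrt_nonneg (t - t')]
      linarith
    have a5 : Real.exp (√(t - t') * |(k : ℝ)|) * ‖sym β η (t - t') k‖
        ≤ C₁ * ((t - t') ^ (-m) * jb k ^ (-m)) := by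
      rw [← Real.mul_rpow hlt.le hk.le, Real.rpow_neg (by positivity), ← div_eq_mul_inv,
        le_div_iff₀ (by positivity), mul_comm]
      exact a1
    have a6 : jb k ^ (1 / 2 - m - q) = jb k ^ (1 / 2 : ℝ) * jb k ^ (-m) * jb k ^ (-q) := by
      rw [← Real.rpow_add hk, ← Real.rpow_add hk]; congr 1
    have a7 := hb t' ht'
    have hr : 0 ≤ t' ^ (-p) := Real.rpow_nonneg ht'.1.le _
    have a8 := norm_half_deriv_symbol_le k
    rw [norm_mul, norm_mul]
    calc ‖sym β η (t - t') k‖ * (‖Complex.I * (k : ℂ) / 2‖ * ‖f t' k‖)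
        ≤ ‖sym β η (t - t') k‖ * (jb k ^ (1 / 2 : ℝ)
          * (A * t' ^ (-p) * (jb k ^ (-q) * (Real.exp (-(μ * √t * |(k : ℝ)|))
            * Real.exp (√(t - t') * |(k : ℝ)|))))) := by
          gcongr
          refine (hf t' ⟨ht'.1, sub_pos.1 hlt⟩).trans ?_
          gcongr
      _ = A * Real.exp (-(μ * √t * |(k : ℝ)|)) * jb k ^ (1 / 2 : ℝ) * jb k ^ (-q) * t' ^ (-p)
          * (Real.exp (√(t - t') * |(k : ℝ)|) * ‖sym β η (t - t') k‖) := by ring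
      _ ≤ A * Real.exp (-(μ * √t * |(k : ℝ)|)) * jb k ^ (1 / 2 : ℝ) * jb k ^ (-q) * t' ^ (-p)
          * (C₁ * ((t - t') ^ (-m) * jb k ^ (-m))) := by gcongr
      _ = D * ((t - t') ^ (-m) * t' ^ (-p)) := by rw [hD, a6]; ring
      _ ≤ D * h t' := by gcongr
  have hae : ∀ᵐ t' ∂volume, t' ∈ Ioc 0 t →
      ‖sym β η (t - t') k * (Complex.I * k / 2 * f t' k)‖ ≤ D * h t' := by
    filter_upwards [Measure.ae_ne volume t] with t' hne ht'
    exact key t' ht' hne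
  have := intervalIntegral.norm_integral_le_of_norm_le ht.le hae (hi.const_mul D)
  rw [intervalIntegral.integral_const_mul] at this
  calc ‖duh β η f t k‖ ≤ D * ∫ t' in (0 : ℝ)..t, h t' := this
    _ ≤ D * (C₂ * t ^ (1 - m - p)) := by gcongr
    _ = _ := by rw [hD]; ring

lemma duh_eq (β η : ℝ) (f : ℝ → ℤ → ℂ) (t : ℝ) (k : ℤ) :
    duh β η f t k = sym β η t k
      * ∫ t' in (0 : ℝ)..t, sym β η (-t') k * (Complex.I * k / 2 * f t' k) := by
  unfold duh
  rw [← intervalIntegral.integral_const_mul]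
  refine intervalIntegral.integral_congr fun t' _ => ?_
  rw [sym_sub, mul_assoc]

lemma continuousOn_duh {β η T : ℝ} (hT : 0 ≤ T) {f : ℝ → ℤ → ℂ} {k : ℤ}
    (hf : IntervalIntegrable (fun t => f t k) volume 0 T) :
    ContinuousOn (fun t => duh β η f t k) (Icc 0 T) := by
  simp only [duh_eq]
  refine (continuous_sym β η k).continuousOn.mul ?_
  have h : IntervalIntegrable (fun t' => sym β η (-t') k * (Complex.I * k / 2 * f t' k))
      volume 0 T :=
    (hf.const_mul (Complex.I * k / 2)).continuousOn_mul
      ((continuous_sym β η k).comp continuous_neg).continuousOn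
  have := intervalIntegral.continuousOn_primitive_interval' h left_mem_uIcc
  rwa [uIcc_of_le hT] at this

lemma duh_add {β η t : ℝ} {f g : ℝ → ℤ → ℂ} {k : ℤ}
    (hf : IntervalIntegrable (fun t => f t k) volume 0 t)
    (hg : IntervalIntegrable (fun t => g t k) volume 0 t) :
    duh β η (fun t' k => f t' k + g t' k) t k = duh β η f t k + duh β η g t k := by
  have h : ∀ f : ℝ → ℤ → ℂ, IntervalIntegrable (fun t => f t k) volume 0 t →
      IntervalIntegrable (fun t' => sym β η (t - t') k * (Complex.I * k / 2 * f t' k))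
      volume 0 t := fun f hf =>
    (hf.const_mul (Complex.I * k / 2)).continuousOn_mul
      ((continuous_sym β η k).comp (continuous_const.sub continuous_id)).continuousOn
  unfold duh
  rw [← intervalIntegral.integral_add (h f hf) (h g hg)]
  simp only [mul_add]

lemma duh_smul (β η t : ℝ) (c : ℂ) (f : ℝ → ℤ → ℂ) (k : ℤ) :
    duh β η (fun t' k => c * f t' k) t k = c * duh β η f t k := by
  unfold duh
  rw [← intervalIntegral.integral_const_mul]
  refine intervalIntegral.integral_congr fun t' _ => ?_
  beta_reduce
  ring

/-! ### Linear and bilinear operators into spaces of curves -/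

lemma csob_ext {a b r : ℝ} {u v : CSob a b r}
    (h : ∀ t k, coeff (u t).dist k = coeff (v t).dist k) : u = v :=
  ContinuousMap.ext fun t => sob_ext (h t)

/-- Curves in `H^r` from dominated continuous Fourier coefficients. -/
lemma exists_csob {a b r : ℝ} {c : ℝ → ℤ → ℂ} {bd : ℤ → ℝ} (hb : Summable fun k => bd k ^ 2)
    (hc : ∀ k, ContinuousOn (fun t => c t k) (Icc a b))
    (h : ∀ t ∈ Icc a b, ∀ k, jb k ^ (r / 2) * ‖c t k‖ ≤ bd k) :
    ∃ u : CSob a b r, ∀ t : Icc a b, ∀ k, coeff (u t).dist k = c t k := by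
  have hs : ∀ t ∈ Icc a b, ∀ k, coeff (sobOf r (c t)).dist k = c t k := fun t ht k =>
    coeff_sobOf (summable_of_dominated hb (h t ht)) k
  have hcont : ContinuousOn (fun t => sobOf r (c t)) (Icc a b) := fun t ht =>
    continuousWithinAt_sob hb ht
      (fun k => ((hc k) t ht).congr (fun y hy => hs y hy k) (hs t ht k))
      (fun y hy k => by rw [hs y hy]; exact h y hy k)
  exact ⟨⟨fun t => sobOf r (c t), hcont.domRestrict⟩, fun t k => hs t t.2 k⟩

/-- Continuous linear maps into spaces of curves, given on the Fourier side. -/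
lemma exists_clm {F : Type*} [NormedAddCommGroup F] [NormedSpace ℂ F] {a b r C : ℝ}
    (c : F → ℝ → ℤ → ℂ) (hadd : ∀ x y, ∀ t ∈ Icc a b, ∀ k, c (x + y) t k = c x t k + c y t k)
    (hsmul : ∀ (z : ℂ) x, ∀ t ∈ Icc a b, ∀ k, c (z • x) t k = z * c x t k)
    (h : ∀ x, ∃ u : CSob a b r, (∀ (t : Icc a b) k, coeff (u t).dist k = c x t k)
      ∧ ‖u‖ ≤ C * ‖x‖) :
    ∃ L : F →L[ℂ] CSob a b r, (∀ x (t : Icc a b) k, coeff (L x t).dist k = c x t k)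
      ∧ ∀ x, ‖L x‖ ≤ C * ‖x‖ := by
  choose u hu hn using h
  let L : F →ₗ[ℂ] CSob a b r :=
    { toFun := u
      map_add' := fun x y => csob_ext fun t k => by
        rw [hu, hadd x y t t.2, ContinuousMap.add_apply, coeff_dist_add, hu, hu]
      map_smul' := fun z x => csob_ext fun t k => by
        rw [hu, hsmul z x t t.2, RingHom.id_apply, ContinuousMap.smul_apply, coeff_dist_smul, hu] }
  exact ⟨L.mkContinuous C hn, hu, hn⟩

/-- Continuous bilinear maps into spaces of curves, given on the Fourier side. -/
lemma exists_clm₂ {F : Type*} [NormedAddCommGroup F] [NormedSpace ℂ F] {a b r C : ℝ}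
    (c : F → F → ℝ → ℤ → ℂ)
    (hadd₁ : ∀ x y z, ∀ t ∈ Icc a b, ∀ k, c (x + y) z t k = c x z t k + c y z t k)
    (hadd₂ : ∀ x y z, ∀ t ∈ Icc a b, ∀ k, c x (y + z) t k = c x y t k + c x z t k)
    (hsmul₁ : ∀ (l : ℂ) x y, ∀ t ∈ Icc a b, ∀ k, c (l • x) y t k = l * c x y t k)
    (hsmul₂ : ∀ (l : ℂ) x y, ∀ t ∈ Icc a b, ∀ k, c x (l • y) t k = l * c x y t k)
    (h : ∀ x y, ∃ u : CSob a b r, (∀ (t : Icc a b) k, coeff (u t).dist k = c x y t k)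
      ∧ ‖u‖ ≤ C * ‖x‖ * ‖y‖) :
    ∃ B : F →L[ℂ] F →L[ℂ] CSob a b r,
      (∀ x y (t : Icc a b) k, coeff (B x y t).dist k = c x y t k)
      ∧ ∀ x y, ‖B x y‖ ≤ C * ‖x‖ * ‖y‖ := by
  choose u hu hn using h
  let B : F →ₗ[ℂ] F →ₗ[ℂ] CSob a b r := LinearMap.mk₂ ℂ u
    (fun x y z => csob_ext fun t k => by
      rw [hu, hadd₁ x y z t t.2, ContinuousMap.add_apply, coeff_dist_add, hu, hu])
    (fun l x y => csob_ext fun t k => by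
      rw [hu, hsmul₁ l x y t t.2, ContinuousMap.smul_apply, coeff_dist_smul, hu])
    (fun x y z => csob_ext fun t k => by
      rw [hu, hadd₂ x y z t t.2, ContinuousMap.add_apply, coeff_dist_add, hu, hu])
    (fun l x y => csob_ext fun t k => by
      rw [hu, hsmul₂ l x y t t.2, ContinuousMap.smul_apply, coeff_dist_smul, hu])
  exact ⟨B.mkContinuous₂ C hn, hu, hn⟩

/-! ### The free evolution -/

/-- The weight `t^γ exp (μ √t |k|)`. -/
def wgt (γ μ t : ℝ) (k : ℤ) : ℝ := t ^ γ * Real.exp (μ * √t * |(k : ℝ)|)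

lemma continuous_wgt {γ : ℝ} (hγ : 0 ≤ γ) (μ : ℝ) (k : ℤ) : Continuous fun t => wgt γ μ t k := by
  unfold wgt
  exact (Real.continuous_rpow_const hγ).mul (by fun_prop)

lemma wgt_nonneg {γ μ t : ℝ} (ht : 0 ≤ t) (k : ℤ) : 0 ≤ wgt γ μ t k := by
  unfold wgt; positivity

lemma wgt_zero_zero (t : ℝ) (k : ℤ) : wgt 0 0 t k = 1 := by simp [wgt]

/-- The free evolution with the weight `t^γ exp (μ √t |k|)` maps `H^s` to curves in
`H^{s + 2γ}`. -/
lemma exists_free (β : ℝ) {η γ : ℝ} (hη : 0 < η) (hγ : 0 ≤ γ) :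
    ∃ C > 0, ∀ (s r μ : ℝ) (T : Ioc (0 : ℝ) 1), r = s + 2 * γ → 0 ≤ μ → μ ≤ 1 →
      ∃ L : Sob s →L[ℂ] CSob 0 T r,
        (∀ φ (t : Icc (0 : ℝ) T) k,
          coeff (L φ t).dist k = wgt γ μ t k * (sym β η t k * coeff φ.dist k)) ∧
        ∀ φ, ‖L φ‖ ≤ C * ‖φ‖ := by
  obtain ⟨C, hC, h⟩ := exists_sym_bound β hη hγ
  refine ⟨C, hC, fun s r μ T hr hμ hμ1 => ?_⟩
  refine exists_clm (F := Sob s) (fun φ t k => wgt γ μ t k * (sym β η t k * coeff φ.dist k))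
    (fun φ χ t _ k => ?_) (fun z φ t _ k => ?_) fun φ => ?_
  · rw [coeff_dist_add]; ring
  · rw [coeff_dist_smul]; ring
  have key : ∀ t ∈ Icc (0 : ℝ) T, ∀ k : ℤ,
      jb k ^ (r / 2) * ‖wgt γ μ t k * (sym β η t k * coeff φ.dist k)‖
        ≤ C * (jb k ^ (s / 2) * ‖coeff φ.dist k‖) := by
    intro t ht k
    have hk := jb_pos k
    have h1 := h t ⟨ht.1, ht.2.trans T.2.2⟩ k
    have h2 : Real.exp (μ * √t * |(k : ℝ)|) ≤ Real.exp (√t * |(k : ℝ)|) := by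
      rw [Real.exp_le_exp, mul_assoc]
      exact mul_le_of_le_one_left (by positivity) hμ1
    have e : jb k ^ (r / 2) = jb k ^ (s / 2) * jb k ^ γ := by
      rw [← Real.rpow_add hk, hr]; congr 1; ring
    rw [norm_mul, norm_mul, Complex.norm_real, Real.norm_of_nonneg (wgt_nonneg ht.1 k), wgt, e]
    have ht0 := ht.1
    calc jb k ^ (s / 2) * jb k ^ γ * (t ^ γ * Real.exp (μ * √t * |(k : ℝ)|)
          * (‖sym β η t k‖ * ‖coeff φ.dist k‖))
        ≤ jb k ^ (s / 2) * jb k ^ γ * (t ^ γ * Real.exp (√t * |(k : ℝ)|)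
          * (‖sym β η t k‖ * ‖coeff φ.dist k‖)) := by gcongr
      _ = ((t * jb k) ^ γ * (Real.exp (√t * |(k : ℝ)|) * ‖sym β η t k‖))
          * (jb k ^ (s / 2) * ‖coeff φ.dist k‖) := by
          rw [Real.mul_rpow ht.1 hk.le]; ring
      _ ≤ _ := mul_le_mul_of_nonneg_right h1 (by positivity)
  have hb : Summable fun k => (C * (jb k ^ (s / 2) * ‖coeff φ.dist k‖)) ^ 2 := by
    simp only [mul_pow C, weighted_sq s (coeff φ.dist)]
    exact (sob_summable φ).mul_left _
  obtain ⟨u, hu⟩ := exists_csob hb (fun k => by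
    refine Continuous.continuousOn ?_
    exact (Complex.continuous_ofReal.comp (continuous_wgt hγ μ k)).mul
      ((continuous_sym β η k).mul continuous_const)) key
  refine ⟨u, hu, (ContinuousMap.norm_le _ (by positivity)).2 fun t => ?_⟩
  exact sob_norm_le_mul hC.le fun k => by rw [hu]; exact key t t.2 k

/-! ### The Duhamel operator -/

/-- The Fourier coefficients of the curve `u` encoded by `U`, where
`Û_k(t) = t^α exp (√t |k|) û_k(t)`. -/
def unwgt (α : ℝ) {ρ : ℝ} {T : Ioc (0 : ℝ) 1} (U : CSob 0 T ρ) (t : ℝ) (k : ℤ) : ℂ :=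
  ((t ^ (-α) * Real.exp (-(√t * |(k : ℝ)|)) : ℝ) : ℂ) * coeff (curve U t) k

lemma curve_eq {r : ℝ} {T : Ioc (0 : ℝ) 1} (U : CSob 0 T r) {t : ℝ} (ht : t ∈ Icc (0 : ℝ) T) :
    curve U t = (U ⟨t, ht⟩).dist := by
  unfold curve
  rw [IccExtend_of_mem _ _ ht]

lemma continuous_coeff_curve {r : ℝ} {T : Ioc (0 : ℝ) 1} (U : CSob 0 T r) (k : ℤ) :
    Continuous fun t => coeff (curve U t) k :=
  (continuous_coeff k).comp (U.continuous.comp continuous_projIcc)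

lemma unwgt_add (α : ℝ) {ρ : ℝ} {T : Ioc (0 : ℝ) 1} (U V : CSob 0 T ρ) (t : ℝ) (k : ℤ) :
    unwgt α (U + V) t k = unwgt α U t k + unwgt α V t k := by
  unfold unwgt
  rw [curve_add, coeff_add, mul_add]

lemma unwgt_smul (α : ℝ) {ρ : ℝ} {T : Ioc (0 : ℝ) 1} (z : ℂ) (U : CSob 0 T ρ) (t : ℝ) (k : ℤ) :
    unwgt α (z • U) t k = z * unwgt α U t k := by
  unfold unwgt
  rw [curve_smul, coeff_smul, mul_left_comm]

lemma continuousOn_unwgt (α : ℝ) {ρ : ℝ} {T : Ioc (0 : ℝ) 1} (U : CSob 0 T ρ) (k : ℤ) :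
    ContinuousOn (fun t => unwgt α U t k) (Ioi 0) := by
  refine ContinuousOn.mul ?_ (continuous_coeff_curve U k).continuousOn
  refine Complex.continuous_ofReal.comp_continuousOn (ContinuousOn.mul ?_ ?_)
  · exact fun t ht => (Real.continuousAt_rpow_const t (-α) (Or.inl (ne_of_gt ht))).continuousWithinAt
  · exact Continuous.continuousOn (by fun_prop)

lemma norm_unwgt (α : ℝ) {ρ : ℝ} {T : Ioc (0 : ℝ) 1} (U : CSob 0 T ρ) {t : ℝ}
    (ht : t ∈ Ioc (0 : ℝ) T) (k : ℤ) :
    ‖unwgt α U t k‖ = t ^ (-α) * Real.exp (-(√t * |(k : ℝ)|))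
      * ‖coeff (U ⟨t, ht.1.le, ht.2⟩).dist k‖ := by
  have := ht.1
  rw [unwgt, norm_mul, Complex.norm_real, Real.norm_of_nonneg (by positivity), curve_eq U ⟨ht.1.le, ht.2⟩]

lemma conv_unwgt {α ρ : ℝ} (hρ : 0 ≤ ρ) {T : Ioc (0 : ℝ) 1} (U V : CSob 0 T ρ) {t : ℝ}
    (ht : t ∈ Ioc (0 : ℝ) T) (k : ℤ) :
    Summable (fun j => ‖unwgt α U t j * unwgt α V t (k - j)‖) ∧
      ‖conv (unwgt α U t) (unwgt α V t) k‖ ≤ (2 ^ (ρ / 2) * (‖U‖ * ‖V‖)) * t ^ (-(2 * α))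
        * (jb k ^ (-(ρ / 2)) * Real.exp (-(1 * √t * |(k : ℝ)|))) := by
  have ht0 := ht.1
  obtain ⟨h1, h2⟩ := conv_bound hρ (Real.sqrt_nonneg t) (U ⟨t, ht.1.le, ht.2⟩)
    (V ⟨t, ht.1.le, ht.2⟩) (Real.rpow_nonneg ht.1.le (-α)) (Real.rpow_nonneg ht.1.le (-α))
    (fun j => (norm_unwgt α U ht j).le) (fun j => (norm_unwgt α V ht j).le) k
  refine ⟨h1, h2.trans ?_⟩
  have e : t ^ (-(2 * α)) = t ^ (-α) * t ^ (-α) := by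
    rw [← Real.rpow_add ht.1]; congr 1; ring
  have hk := jb_pos k
  rw [e, one_mul, mul_comm (2 ^ (ρ / 2)), mul_right_comm _ (2 ^ (ρ / 2)),
    mul_comm (‖U‖ * ‖V‖ * 2 ^ (ρ / 2))]
  rw [mul_assoc (t ^ (-α) * t ^ (-α))]
  gcongr
  · exact ContinuousMap.norm_coe_le_norm U _
  · exact ContinuousMap.norm_coe_le_norm V _

/-- The product estimate with the Sobolev and Gevrey weights dropped. -/
lemma norm_conv_unwgt_le {α ρ : ℝ} (hρ : 0 ≤ ρ) {T : Ioc (0 : ℝ) 1} (U V : CSob 0 T ρ) {t : ℝ}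
    (ht : t ∈ Ioc (0 : ℝ) T) (k : ℤ) :
    ‖conv (unwgt α U t) (unwgt α V t) k‖ ≤ (2 ^ (ρ / 2) * (‖U‖ * ‖V‖)) * t ^ (-(2 * α)) := by
  have h0 := Real.rpow_nonneg ht.1.le (-(2 * α))
  refine (conv_unwgt hρ U V ht k).2.trans (mul_le_of_le_one_right (by positivity)
    (mul_le_one₀ ?_ (Real.exp_pos _).le ?_))
  · exact Real.rpow_le_one_of_one_le_of_nonpos (one_le_jb k) (by linarith)
  · rw [Real.exp_le_one_iff]
    have : 0 ≤ √t * |(k : ℝ)| := by positivity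
    linarith

lemma intervalIntegrable_conv {α ρ : ℝ} (hρ : 0 ≤ ρ) (hα : α < 1 / 4) {T : Ioc (0 : ℝ) 1}
    (U V : CSob 0 T ρ) {t : ℝ} (ht : t ∈ Icc (0 : ℝ) T) (k : ℤ) :
    IntervalIntegrable (fun t' => conv (unwgt α U t') (unwgt α V t') k) volume 0 t := by
  have hb : IntervalIntegrable (fun t' : ℝ => (2 ^ (ρ / 2) * (‖U‖ * ‖V‖)) * t' ^ (-(2 * α)))
      volume 0 t :=
    (intervalIntegral.intervalIntegrable_rpow' (by linarith)).const_mul _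
  have hm : AEStronglyMeasurable (fun t' => conv (unwgt α U t') (unwgt α V t') k)
      (volume.restrict (Ioc 0 t)) := by
    refine aestronglyMeasurable_of_tendsto_ae (Filter.atTop : Filter (Finset ℤ))
      (f := fun S t' => ∑ j ∈ S, unwgt α U t' j * unwgt α V t' (k - j)) (fun S => ?_) ?_
    · refine ContinuousOn.aestronglyMeasurable ?_ measurableSet_Ioc
      refine (continuousOn_finsetSum S fun j _ =>
        (continuousOn_unwgt α U j).mul (continuousOn_unwgt α V (k - j))).mono fun x hx => hx.1
    · refine (ae_restrict_iff' measurableSet_Ioc).2 (Filter.Eventually.of_forall fun t' ht' => ?_)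
      exact (conv_unwgt hρ U V ⟨ht'.1, ht'.2.trans ht.2⟩ k).1.of_norm.hasSum
  rw [intervalIntegrable_iff_integrableOn_Ioc_of_le ht.1] at hb ⊢
  refine Integrable.mono' hb hm ((ae_restrict_iff' measurableSet_Ioc).2
    (Filter.Eventually.of_forall fun t' ht' => ?_))
  exact norm_conv_unwgt_le hρ U V ⟨ht'.1, ht'.2.trans ht.2⟩ k

lemma conv_add_left {a b c : ℤ → ℂ} {k : ℤ} (h₁ : Summable fun j => ‖a j * c (k - j)‖)
    (h₂ : Summable fun j => ‖b j * c (k - j)‖) :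
    conv (fun j => a j + b j) c k = conv a c k + conv b c k := by
  unfold conv
  rw [← h₁.of_norm.tsum_add h₂.of_norm]
  simp only [add_mul]

lemma conv_add_right {a b c : ℤ → ℂ} {k : ℤ} (h₁ : Summable fun j => ‖a j * b (k - j)‖)
    (h₂ : Summable fun j => ‖a j * c (k - j)‖) :
    conv a (fun j => b j + c j) k = conv a b k + conv a c k := by
  unfold conv
  rw [← h₁.of_norm.tsum_add h₂.of_norm]
  simp only [mul_add]

lemma conv_smul_left (z : ℂ) (a b : ℤ → ℂ) (k : ℤ) :
    conv (fun j => z * a j) b k = z * conv a b k := by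
  unfold conv
  simp only [mul_assoc, tsum_mul_left]

lemma conv_smul_right (z : ℂ) (a b : ℤ → ℂ) (k : ℤ) :
    conv a (fun j => z * b j) k = z * conv a b k := by
  unfold conv
  simp only [mul_left_comm _ z, tsum_mul_left]

lemma duh_congr {β η t : ℝ} {f g : ℝ → ℤ → ℂ} {k : ℤ} (ht : 0 ≤ t)
    (h : ∀ t' ∈ Ioc 0 t, f t' k = g t' k) : duh β η f t k = duh β η g t k := by
  unfold duh
  refine intervalIntegral.integral_congr_ae (Filter.Eventually.of_forall fun t' ht' => ?_)
  rw [uIoc_of_le ht] at ht'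
  rw [h t' ht']

/-- The weighted Duhamel operator, a bilinear operator from the weighted curves in `H^ρ`,
`ρ = s + 2α`, to curves in `H^{s + 2γ}`. Its norm is small on short time intervals, since
`s > -1/2` means `α < 1/4`. -/
lemma exists_duhamel (β : ℝ) {η α γ : ℝ} (hη : 0 < η) (hα : 0 ≤ α) (hα' : α < 1 / 4)
    (hγ : 0 ≤ γ) (hγα : γ ≤ α) :
    ∃ C > 0, ∀ (s ρ r μ : ℝ) (T : Ioc (0 : ℝ) 1), 0 ≤ ρ → ρ = s + 2 * α → r = s + 2 * γ →
      0 ≤ μ → μ ≤ 1 →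
      ∃ D : CSob 0 T ρ →L[ℂ] CSob 0 T ρ →L[ℂ] CSob 0 T r,
        (∀ U V (t : Icc (0 : ℝ) T) k, coeff (D U V t).dist k
          = wgt γ μ t k * duh β η (fun t' => conv (unwgt α U t') (unwgt α V t')) t k) ∧
        ∀ U V, ‖D U V‖ ≤ C * 2 ^ (ρ / 2) * (T : ℝ) ^ ((1 / 4 - α) / 2) * ‖U‖ * ‖V‖ := by
  set θ := (1 / 4 - α) / 2 with hθ
  have hθ0 : 0 < θ := by rw [hθ]; linarith
  -- With this `m < 1`, the power of `t` left over is exactly `θ`, and the power of `⟨k⟩²` left over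
  -- is `-1/4 - θ`, which is just square summable.
  obtain ⟨C, hC, h⟩ := exists_duh_bound β (m := 3 / 4 - α + γ + θ) (p := 2 * α) hη
    (by linarith) (by linarith) (by linarith) (by linarith)
  have hsum : Summable fun k => (jb k ^ (-(1 / 4) - θ)) ^ 2 := summable_jb_rpow_sq (by linarith)
  set K := √(2 * π * ∑' k, (jb k ^ (-(1 / 4) - θ)) ^ 2) with hK
  refine ⟨C * (K + 1), by positivity, fun s ρ r μ T hρ hρs hr hμ hμ1 => ?_⟩
  have hint := fun (U V : CSob 0 T ρ) (t : ℝ) (ht : t ∈ Icc (0 : ℝ) T) (k : ℤ) =>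
    intervalIntegrable_conv hρ hα' U V ht k
  refine exists_clm₂ (fun U V t k => wgt γ μ t k
    * duh β η (fun t' => conv (unwgt α U t') (unwgt α V t')) t k)
    (fun x y z t ht k => ?_) (fun x y z t ht k => ?_) (fun l x y t ht k => ?_)
    (fun l x y t ht k => ?_) fun U V => ?_
  · rw [← mul_add, ← duh_add (hint x z t ht k) (hint y z t ht k)]
    congr 1
    refine duh_congr ht.1 fun t' ht' => ?_
    have ht'' : t' ∈ Ioc (0 : ℝ) T := ⟨ht'.1, ht'.2.trans ht.2⟩
    rw [← conv_add_left (conv_unwgt hρ x z ht'' k).1 (conv_unwgt hρ y z ht'' k).1]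
    simp only [← unwgt_add]
  · rw [← mul_add, ← duh_add (hint x y t ht k) (hint x z t ht k)]
    congr 1
    refine duh_congr ht.1 fun t' ht' => ?_
    have ht'' : t' ∈ Ioc (0 : ℝ) T := ⟨ht'.1, ht'.2.trans ht.2⟩
    rw [← conv_add_right (conv_unwgt hρ x y ht'' k).1 (conv_unwgt hρ x z ht'' k).1]
    simp only [← unwgt_add]
  · rw [mul_left_comm, ← duh_smul β η t l]
    congr 1
    refine duh_congr ht.1 fun t' ht' => ?_
    rw [← conv_smul_left]
    simp only [← unwgt_smul]
  · rw [mul_left_comm, ← duh_smul β η t l]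
    congr 1
    refine duh_congr ht.1 fun t' ht' => ?_
    rw [← conv_smul_right]
    simp only [← unwgt_smul]
  · set A := 2 ^ (ρ / 2) * (‖U‖ * ‖V‖) with hA
    have hA0 : 0 ≤ A := by positivity
    have key : ∀ t ∈ Icc (0 : ℝ) T, ∀ k : ℤ, jb k ^ (r / 2)
        * ‖wgt γ μ t k * duh β η (fun t' => conv (unwgt α U t') (unwgt α V t')) t k‖
        ≤ C * A * (T : ℝ) ^ θ * jb k ^ (-(1 / 4) - θ) := by
      intro t ht k
      have hk := jb_pos k
      have hT : (0 : ℝ) < T := T.2.1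
      rcases ht.1.eq_or_lt with h0 | h0
      · have : duh β η (fun t' => conv (unwgt α U t') (unwgt α V t')) t k = 0 := by
          rw [← h0, duh, intervalIntegral.integral_same]
        rw [this, mul_zero, norm_zero, mul_zero]
        positivity
      · have h1 := h (ρ / 2) A 1 t k (fun t' => conv (unwgt α U t') (unwgt α V t')) hA0 zero_le_one
          le_rfl h0 (ht.2.trans T.2.2) fun t' ht' =>
            (conv_unwgt hρ U V ⟨ht'.1, ht'.2.le.trans ht.2⟩ k).2
        have h2 : Real.exp (μ * √t * |(k : ℝ)|) * Real.exp (-(1 * √t * |(k : ℝ)|)) ≤ 1 := by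
          rw [← Real.exp_add, Real.exp_le_one_iff, mul_assoc, mul_assoc, one_mul]
          have : 0 ≤ √t * |(k : ℝ)| := by positivity
          nlinarith
        have e1 : t ^ γ * t ^ (1 - (3 / 4 - α + γ + θ) - 2 * α) = t ^ θ := by
          rw [← Real.rpow_add h0]; congr 1; rw [hθ]; ring
        have e2 : jb k ^ (r / 2) * jb k ^ (1 / 2 - (3 / 4 - α + γ + θ) - ρ / 2)
            = jb k ^ (-(1 / 4) - θ) := by
          rw [← Real.rpow_add hk]; congr 1; rw [hr, hρs]; ring
        rw [norm_mul, Complex.norm_real, Real.norm_of_nonneg (wgt_nonneg ht.1 k), wgt]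
        calc _ ≤ jb k ^ (r / 2) * (t ^ γ * Real.exp (μ * √t * |(k : ℝ)|)
              * (C * A * t ^ (1 - (3 / 4 - α + γ + θ) - 2 * α)
                * (jb k ^ (1 / 2 - (3 / 4 - α + γ + θ) - ρ / 2)
                  * Real.exp (-(1 * √t * |(k : ℝ)|))))) := by gcongr
          _ = C * A * (t ^ γ * t ^ (1 - (3 / 4 - α + γ + θ) - 2 * α))
              * (jb k ^ (r / 2) * jb k ^ (1 / 2 - (3 / 4 - α + γ + θ) - ρ / 2))
              * (Real.exp (μ * √t * |(k : ℝ)|) * Real.exp (-(1 * √t * |(k : ℝ)|))) := by ring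
          _ ≤ C * A * t ^ θ * jb k ^ (-(1 / 4) - θ) * 1 := by
            rw [e1, e2]; gcongr
          _ ≤ _ := by
            rw [mul_one]
            gcongr
            exact ht.2
    have hb : Summable fun k => (C * A * (T : ℝ) ^ θ * jb k ^ (-(1 / 4) - θ)) ^ 2 := by
      simp only [mul_pow (C * A * (T : ℝ) ^ θ)]
      exact hsum.mul_left _
    obtain ⟨u, hu⟩ := exists_csob hb (fun k => by
      refine (Complex.continuous_ofReal.comp (continuous_wgt hγ μ k)).continuousOn.mul ?_
      exact continuousOn_duh T.2.1.le (hint U V T ⟨T.2.1.le, le_rfl⟩ k)) key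
    have hT : (0 : ℝ) < T := T.2.1
    refine ⟨u, hu, (ContinuousMap.norm_le _ (by positivity)).2 fun t => ?_⟩
    refine (sob_norm_le_of_dominated hb fun k => by rw [hu]; exact key t t.2 k).trans ?_
    simp only [mul_pow (C * A * (T : ℝ) ^ θ), tsum_mul_left]
    rw [mul_left_comm, Real.sqrt_mul (by positivity), Real.sqrt_sq (by positivity), ← hK, hA]
    have : C * (2 ^ (ρ / 2) * (‖U‖ * ‖V‖)) * (T : ℝ) ^ θ * K
        ≤ C * (2 ^ (ρ / 2) * (‖U‖ * ‖V‖)) * (T : ℝ) ^ θ * (K + 1) := by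
      gcongr; linarith
    calc _ ≤ _ := this
      _ = _ := by ring

/-! ### Smoothing -/

lemma exists_exp_bound {κ : ℝ} (hκ : 0 < κ) (p : ℝ) :
    ∃ C > 0, ∀ k : ℤ, jb k ^ p * Real.exp (-(κ * |(k : ℝ)|)) ≤ C * jb k ^ (-1 : ℝ) := by
  set p' := max 0 (p + 1) with hp'
  obtain ⟨C, hC, h⟩ := exists_rpow_le_exp (m := 2 * p') (by positivity) hκ
  refine ⟨C, hC, fun k => ?_⟩
  have hk := jb_pos k
  have h1 : jb k ≤ (1 + |(k : ℝ)|) ^ (2 : ℝ) := by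
    rw [Real.rpow_ofNat]
    unfold jb; rw [← sq_abs (k : ℝ)]; nlinarith [abs_nonneg (k : ℝ)]
  have h2 : jb k ^ (p + 1) ≤ C * Real.exp (κ * |(k : ℝ)|) := by
    calc jb k ^ (p + 1) ≤ jb k ^ p' :=
          Real.rpow_le_rpow_of_exponent_le (one_le_jb k) (le_max_right _ _)
      _ ≤ ((1 + |(k : ℝ)|) ^ (2 : ℝ)) ^ p' := Real.rpow_le_rpow hk.le h1 (le_max_left _ _)
      _ = (1 + |(k : ℝ)|) ^ (2 * p') := by rw [← Real.rpow_mul (by positivity)]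
      _ ≤ _ := h _ (abs_nonneg _)
  have e : jb k ^ p = jb k ^ (p + 1) * jb k ^ (-1 : ℝ) := by
    rw [← Real.rpow_add hk]; congr 1; ring
  calc jb k ^ p * Real.exp (-(κ * |(k : ℝ)|))
      ≤ (C * Real.exp (κ * |(k : ℝ)|)) * jb k ^ (-1 : ℝ) * Real.exp (-(κ * |(k : ℝ)|)) := by
        rw [e]; gcongr
    _ = C * jb k ^ (-1 : ℝ) * (Real.exp (κ * |(k : ℝ)|) * Real.exp (-(κ * |(k : ℝ)|))) := by ring
    _ = _ := by rw [← Real.exp_add, add_neg_cancel, Real.exp_zero, mul_one]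

/-- Away from `t = 0` the Gevrey weight controls every Sobolev norm. -/
lemma exists_smoothing {α ρ : ℝ} (hα : 0 ≤ α) {T : Ioc (0 : ℝ) 1} {τ : ℝ} (hτ : 0 < τ) (r : ℝ) :
    ∃ L : CSob 0 T ρ →L[ℂ] CSob τ T r, ∀ U (t : Icc τ (T : ℝ)) k,
      coeff (L U t).dist k = unwgt α U t k := by
  obtain ⟨C, hC, h⟩ := exists_exp_bound (Real.sqrt_pos.2 hτ) (r / 2 - ρ / 2)
  have hsum : Summable fun k => (jb k ^ (-1 : ℝ)) ^ 2 := summable_jb_rpow_sq (by norm_num)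
  set K := √(2 * π * ∑' k, (jb k ^ (-1 : ℝ)) ^ 2) with hK
  obtain ⟨L, hL, -⟩ := exists_clm (F := CSob 0 T ρ) (a := τ) (b := T) (r := r)
    (C := τ ^ (-α) * C * K) (fun U t k => unwgt α U t k)
    (fun U V t _ k => unwgt_add α U V t k) (fun z U t _ k => unwgt_smul α z U t k) fun U => by
      have key : ∀ t ∈ Icc τ (T : ℝ), ∀ k : ℤ,
          jb k ^ (r / 2) * ‖unwgt α U t k‖ ≤ τ ^ (-α) * C * ‖U‖ * jb k ^ (-1 : ℝ) := by
        intro t ht k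
        have hk := jb_pos k
        have ht0 : 0 < t := hτ.trans_le ht.1
        rw [norm_unwgt α U ⟨ht0, ht.2⟩]
        have h1 : t ^ (-α) ≤ τ ^ (-α) := Real.rpow_le_rpow_of_nonpos hτ ht.1 (by linarith)
        have h2 : Real.exp (-(√t * |(k : ℝ)|)) ≤ Real.exp (-(√τ * |(k : ℝ)|)) := by
          rw [Real.exp_le_exp, neg_le_neg_iff]
          exact mul_le_mul_of_nonneg_right (Real.sqrt_le_sqrt ht.1) (abs_nonneg _)
        have h3 : ‖coeff (U ⟨t, ht0.le, ht.2⟩).dist k‖ ≤ jb k ^ (-(ρ / 2)) * ‖U‖ :=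
          (norm_coeff_le _ k).trans (by gcongr; exact ContinuousMap.norm_coe_le_norm U _)
        calc _ ≤ jb k ^ (r / 2) * (τ ^ (-α) * Real.exp (-(√τ * |(k : ℝ)|))
              * (jb k ^ (-(ρ / 2)) * ‖U‖)) := by gcongr
          _ = τ ^ (-α) * ‖U‖ * (jb k ^ (r / 2 - ρ / 2) * Real.exp (-(√τ * |(k : ℝ)|))) := by
            rw [sub_eq_add_neg, Real.rpow_add hk]; ring
          _ ≤ τ ^ (-α) * ‖U‖ * (C * jb k ^ (-1 : ℝ)) :=
            mul_le_mul_of_nonneg_left (h k) (by positivity)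
          _ = _ := by ring
      have hb : Summable fun k => (τ ^ (-α) * C * ‖U‖ * jb k ^ (-1 : ℝ)) ^ 2 := by
        simp only [mul_pow (τ ^ (-α) * C * ‖U‖)]
        exact hsum.mul_left _
      obtain ⟨u, hu⟩ := exists_csob hb (fun k => (continuousOn_unwgt α U k).mono fun t ht =>
        hτ.trans_le ht.1) key
      refine ⟨u, hu, (ContinuousMap.norm_le _ (by positivity)).2 fun t => ?_⟩
      refine (sob_norm_le_of_dominated hb fun k => by rw [hu]; exact key t t.2 k).trans ?_
      simp only [mul_pow (τ ^ (-α) * C * ‖U‖), tsum_mul_left]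
      rw [mul_left_comm, Real.sqrt_mul (by positivity), Real.sqrt_sq (by positivity), ← hK]
      exact le_of_eq (by ring)
  exact ⟨L, hL⟩

/-! ### Quadratic equations in Banach spaces -/

/-- The map `x ↦ x + B(x, x)` is close to the identity near the origin. -/
lemma approximatesLinearOn_quadratic {E : Type*} [NormedAddCommGroup E] [NormedSpace ℂ E]
    (B : E →L[ℂ] E →L[ℂ] E) {b R : ℝ} (hb : 0 ≤ b) (hB : ∀ x y, ‖B x y‖ ≤ b * ‖x‖ * ‖y‖)
    (hbR : 4 * b * R ≤ 1) :
    ApproximatesLinearOn (fun x => x + B x x)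
      ((ContinuousLinearEquiv.refl ℂ E : E ≃L[ℂ] E) : E →L[ℂ] E) (Metric.ball 0 R) (1 / 2) := by
  intro x hx y hy
  rw [mem_ball_zero_iff] at hx hy
  have e : x + B x x - (y + B y y) - ((ContinuousLinearEquiv.refl ℂ E : E ≃L[ℂ] E) : E →L[ℂ] E)
      (x - y) = B (x - y) x + B y (x - y) := by
    simp only [ContinuousLinearEquiv.coe_refl, ContinuousLinearMap.coe_id', id_eq, map_sub,
      sub_apply]
    abel
  rw [e]
  have h1 : b * ‖x - y‖ * ‖x‖ ≤ b * ‖x - y‖ * R := by gcongr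
  have h2 : b * ‖y‖ * ‖x - y‖ ≤ b * R * ‖x - y‖ := by gcongr
  have h3 : (4 * b * R) * ‖x - y‖ ≤ 1 * ‖x - y‖ := by gcongr
  calc ‖B (x - y) x + B y (x - y)‖ ≤ ‖B (x - y) x‖ + ‖B y (x - y)‖ := norm_add_le _ _
    _ ≤ b * ‖x - y‖ * ‖x‖ + b * ‖y‖ * ‖x - y‖ := add_le_add (hB _ _) (hB _ _)
    _ ≤ _ := by push_cast; linarith

/-- The equation `x + B(x, x) = y` has a solution depending smoothly on `y` near the origin. -/
lemma exists_quadratic_inverse {E : Type*} [NormedAddCommGroup E] [NormedSpace ℂ E]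
    [CompleteSpace E] (B : E →L[ℂ] E →L[ℂ] E) {b R : ℝ} (hb : 0 ≤ b)
    (hB : ∀ x y, ‖B x y‖ ≤ b * ‖x‖ * ‖y‖) (hbR : 8 * b * R ≤ 1) :
    ∃ G : E → E, (∀ y ∈ Metric.ball (0 : E) R, G y + B (G y) (G y) = y) ∧
      ContDiffOn ℂ ∞ G (Metric.ball 0 R) := by
  rcases le_or_gt R 0 with hR | hR
  · rw [Metric.ball_eq_empty.2 hR]
    exact ⟨fun _ => 0, by simp, contDiffOn_empty⟩
  rcases subsingleton_or_nontrivial E with hE | hE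
  · exact ⟨fun _ => 0, fun y _ => Subsingleton.elim _ _, contDiffOn_const⟩
  have hap := approximatesLinearOn_quadratic B hb hB (R := 2 * R) (by linarith)
  have hinv : ‖(((ContinuousLinearEquiv.refl ℂ E).symm : E ≃L[ℂ] E) : E →L[ℂ] E)‖₊⁻¹ = 1 := by
    simp [ContinuousLinearEquiv.refl_symm]
  have hc : Subsingleton E ∨
      (1 / 2 : ℝ≥0) < ‖(((ContinuousLinearEquiv.refl ℂ E).symm : E ≃L[ℂ] E) : E →L[ℂ] E)‖₊⁻¹ := by
    right
    rw [hinv]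
    exact NNReal.half_lt_self one_ne_zero
  let e := hap.toOpenPartialHomeomorph _ _ hc Metric.isOpen_ball
  have htarget : ∀ y ∈ Metric.ball (0 : E) R, y ∈ e.target := by
    intro y hy
    rw [mem_ball_zero_iff] at hy
    have hsub : Metric.closedBall (0 : E) (2 * ‖y‖) ⊆ Metric.ball 0 (2 * R) :=
      Metric.closedBall_subset_ball (by linarith)
    have := hap.closedBall_subset_target hc Metric.isOpen_ball (b := 0)
      (by positivity : 0 ≤ 2 * ‖y‖) hsub
    refine this ?_
    rw [hinv, mem_closedBall_iff_norm]
    simp only [map_zero, add_zero, sub_zero]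
    push_cast
    linarith
  refine ⟨e.symm, fun y hy => e.right_inv (htarget y hy), fun y hy => ?_⟩
  refine ContDiffAt.contDiffWithinAt ?_
  set x := e.symm y with hx
  have hxs : x ∈ Metric.ball (0 : E) (2 * R) := e.map_target (htarget y hy)
  rw [mem_ball_zero_iff] at hxs
  have hlt : ‖-(B x + B.flip x)‖ < 1 := by
    rw [norm_neg]
    have h1 : ‖B x‖ ≤ b * ‖x‖ := ContinuousLinearMap.opNorm_le_bound _ (by positivity) (hB x)
    have h2 : ‖B.flip x‖ ≤ b * ‖x‖ :=
      ContinuousLinearMap.opNorm_le_bound _ (by positivity) fun z => by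
        rw [ContinuousLinearMap.flip_apply]
        exact (hB z x).trans (le_of_eq (by ring))
    have h3 : b * ‖x‖ ≤ b * (2 * R) := by gcongr
    calc _ ≤ _ := norm_add_le _ _
      _ < 1 := by linarith
  let u := Units.oneSub (-(B x + B.flip x)) hlt
  have hd : HasFDerivAt e ((ContinuousLinearEquiv.ofUnit u : E ≃L[ℂ] E) : E →L[ℂ] E) x := by
    have h1 : HasFDerivAt (fun x => B x x) (B x + B.flip x) x := by
      have := B.hasFDerivAt_of_bilinear (hasFDerivAt_id x) (hasFDerivAt_id x)
      refine this.congr_fderiv ?_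
      ext z
      simp
    have h2 := (hasFDerivAt_id x).add h1
    refine h2.congr_fderiv ?_
    ext z
    change z + (B x z + B z x) = (1 - -(B x + B.flip x)) z
    simp
    abel
  have hs : ContDiff ℂ ∞ fun x : E => x + B x x :=
    contDiff_id.add (B.isBoundedBilinearMap.contDiff.comp (contDiff_id.prodMk contDiff_id))
  exact e.contDiffAt_symm (htarget y hy) hd hs.contDiffAt

/-! ### The equation on the Fourier side -/

/-- The pairing of a distribution with a test function in terms of Fourier coefficients. -/
lemma hasSum_pair (f : PerDist) (ψ : SmoothPer) :
    HasSum (fun k : ℤ => 2 * π * (coeff f k * coeffPer ψ (-k))) (pair f ψ) := by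
  have h := coeff_growth f
  have e : f = ofCoeff (coeff f) := perDist_ext fun k => (coeff_ofCoeff h k).symm
  have e2 : pair f ψ = 2 * π * ∑' k : ℤ, coeff f k * coeffPer ψ (-k) := by
    conv_lhs => rw [e]
    unfold pair ofCoeff
    rw [dif_pos h]
    rfl
  rw [e2]
  exact (series_summable h ψ).hasSum.mul_left _

lemma pair_expPer (f : PerDist) (k : ℤ) : pair f (expPer (-k)) = 2 * π * coeff f k := by
  have hpi : (π : ℂ) ≠ 0 := by exact_mod_cast Real.pi_ne_zero
  unfold coeff
  field_simp

lemma coeff_semigroup (β : ℝ) {η t : ℝ} (hη : 0 < η) (ht : 0 ≤ t) (f : PerDist) (k : ℤ) :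
    coeff (semigroup β η t f) k = sym β η t k * coeff f k := by
  obtain ⟨N, C, hC⟩ := coeff_growth f
  refine coeff_ofCoeff ⟨N, C, fun k => ?_⟩ k
  rw [norm_mul]
  exact (mul_le_of_le_one_left (norm_nonneg _) (norm_sym_le_one β hη ht k)).trans (hC k)

lemma coeff_ofPer (g : SmoothPer) (k : ℤ) : coeff (ofPer g) k = coeffPer g k := by
  unfold coeff coeffPer pair ofPer
  congr 1
  refine intervalIntegral.integral_congr fun x _ => ?_
  simp only [expPer]
  rw [mul_comm]
  congr 2
  push_cast
  ring

/-- Fourier coefficients of the product of an absolutely convergent Fourier series with a smooth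
periodic function. -/
lemma coeff_mul_of_hasSum {c : ℤ → ℂ} (hc : Summable fun j => ‖c j‖) {f : ℝ → ℂ}
    (hf : ∀ x, HasSum (fun j => c j * (expPer j).1 x) (f x)) (g : SmoothPer) (k : ℤ) :
    (2 * π : ℂ)⁻¹ * ∫ x in (-π)..π, Complex.exp (-(Complex.I * k * x)) * (f x * g.1 x)
      = ∑' j, c j * coeffPer g (k - j) := by
  obtain ⟨M, hM⟩ := exists_bound_per g
  have h := intervalIntegral.hasSum_integral_of_dominated_convergence (μ := volume)
    (a := -π) (b := π)
    (F := fun (j : ℤ) (x : ℝ) => c j * (Complex.exp (-(Complex.I * (k - j : ℤ) * x)) * g.1 x))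
    (f := fun x => Complex.exp (-(Complex.I * k * x)) * (f x * g.1 x))
    (fun j _ => ‖c j‖ * M) (fun j => ?_) (fun j => ?_) ?_ ?_ ?_
  · simp only [intervalIntegral.integral_const_mul] at h
    rw [← h.tsum_eq, ← tsum_mul_left]
    refine tsum_congr fun j => ?_
    rw [coeffPer]
    ring
  · refine Continuous.aestronglyMeasurable ?_
    exact continuous_const.mul (Continuous.mul (by fun_prop) (continuous_per g))
  · refine Filter.Eventually.of_forall fun x _ => ?_
    have : -(Complex.I * ((k - j : ℤ) : ℂ) * x) = ((-((k - j : ℤ) * x) : ℝ) : ℂ) * Complex.I := by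
      push_cast; ring
    rw [norm_mul, norm_mul, this, Complex.norm_exp_ofReal_mul_I, one_mul]
    exact mul_le_mul_of_nonneg_left (hM x) (norm_nonneg _)
  · exact Filter.Eventually.of_forall fun x _ => hc.mul_right M
  · exact intervalIntegrable_const
  · refine Filter.Eventually.of_forall fun x _ => ?_
    have := ((hf x).mul_right (g.1 x)).mul_left (Complex.exp (-(Complex.I * k * x)))
    refine this.congr_fun fun j => ?_
    have e : Complex.exp (-(Complex.I * ((k - j : ℤ) : ℂ) * x))
        = Complex.exp (-(Complex.I * k * x)) * (expPer j).1 x := by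
      simp only [expPer]
      rw [← Complex.exp_add]
      congr 1
      push_cast
      ring
    rw [e]
    ring

lemma coeffPer_mulPer (f g : SmoothPer) (k : ℤ) :
    coeffPer (mulPer f g) k = ∑' j, coeffPer f j * coeffPer g (k - j) :=
  coeff_mul_of_hasSum (by simpa using summable_decay f 0) (hasSum_coeffPer f) g k

/-- A rapidly decreasing sequence is the sequence of Fourier coefficients of a smooth periodic
function. -/
lemma exists_smoothPer {c : ℤ → ℂ} (hc : ∀ N : ℕ, Summable fun k : ℤ => |(k : ℝ)| ^ N * ‖c k‖) :
    ∃ g : SmoothPer, ∀ k, coeffPer g k = c k := by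
  have h0 : Summable fun k : ℤ => ‖c k‖ := by simpa using hc 0
  have hs : ∀ x, Summable fun j => c j * (expPer j).1 x := fun x => by
    refine Summable.of_norm ?_
    simpa only [norm_mul, norm_expPer, mul_one] using h0
  have hd : ContDiff ℝ ∞ fun x => ∑' j, c j * (expPer j).1 x := by
    refine contDiff_tsum (v := fun N (k : ℤ) => |(k : ℝ)| ^ N * ‖c k‖) (fun j => ?_)
      (fun N _ => hc N) fun N j x _ => ?_
    · exact contDiff_const.mul (expPer j).2.1
    · rw [norm_iteratedFDeriv_eq_norm_iteratedDeriv,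
        iteratedDeriv_const_mul_field (c j) (expPer j).1, iteratedDeriv_expPer, norm_mul, norm_mul,
        norm_expPer, norm_pow, norm_mul, Complex.norm_I, Complex.norm_intCast, one_mul, mul_one,
        mul_comm]
  let g : SmoothPer := ⟨fun x => ∑' j, c j * (expPer j).1 x, hd, fun x =>
    tsum_congr fun j => by rw [(expPer j).2.2 x]⟩
  refine ⟨g, fun k => ?_⟩
  have h := coeff_mul_of_hasSum h0 (fun x => (hs x).hasSum) (expPer 0) k
  have e : ∀ x : ℝ, (expPer 0).1 x = 1 := fun x => by simp [expPer]
  simp only [e, mul_one, coeffPer_expPer, sub_eq_zero, mul_ite, mul_zero] at h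
  rw [show coeffPer g k = (2 * π : ℂ)⁻¹ * ∫ x in (-π)..π,
    Complex.exp (-(Complex.I * k * x)) * ∑' j, c j * (expPer j).1 x from rfl, h]
  simp only [eq_comm (a := k), tsum_ite_eq]

/-- The Fourier coefficients of `u uₓ = ½ (u²)ₓ` for `u` in `H^∞`. -/
lemma coeff_nonlin {u : PerDist} (hu : ∀ r : ℝ, eSobNorm r u < ⊤) (k : ℤ) :
    coeff (nonlin u) k = Complex.I * k / 2 * conv (coeff u) (coeff u) k := by
  have hdecay : ∀ N : ℕ, Summable fun k : ℤ => |(k : ℝ)| ^ N * ‖coeff u k‖ := by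
    intro N
    let f : Sob (N + 2) := (⟨u, hu (N + 2)⟩ : sobSubmodule (N + 2))
    refine Summable.of_nonneg_of_le (fun k => by positivity) (fun k => ?_)
      ((summable_jb_rpow (p := -1) (by norm_num)).mul_right ‖f‖)
    have hk := jb_pos k
    have h1 : |(k : ℝ)| ^ N ≤ jb k ^ ((N : ℝ) / 2) := by
      calc |(k : ℝ)| ^ N ≤ (jb k ^ (1 / 2 : ℝ)) ^ N :=
            pow_le_pow_left₀ (abs_nonneg _) (abs_le_jb_rpow_half k) N
        _ = _ := by
          rw [← Real.rpow_natCast, ← Real.rpow_mul hk.le]; congr 1; ring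
    calc |(k : ℝ)| ^ N * ‖coeff u k‖
        ≤ jb k ^ ((N : ℝ) / 2) * (jb k ^ (-(((N : ℝ) + 2) / 2)) * ‖f‖) := by
          gcongr; exact norm_coeff_le f k
      _ = _ := by
          rw [← mul_assoc, ← Real.rpow_add hk]; congr 2; ring
  have hex : ∃ g : SmoothPer, ofPer g = u := by
    obtain ⟨g, hg⟩ := exists_smoothPer hdecay
    exact ⟨g, perDist_ext fun k => by rw [coeff_ofPer, hg]⟩
  have hg : ∀ k, coeffPer hex.choose k = coeff u k := fun k => by
    rw [← coeff_ofPer, hex.choose_spec]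
  unfold nonlin
  rw [dif_pos hex, coeff_ofPer, coeffPer_mulPer]
  simp only [coeffPer_deriv, hg]
  set a := coeff u with ha
  have hs : ∀ N : ℕ, Summable fun j : ℤ => a j * ((j : ℂ) ^ N * a (k - j)) := by
    intro N
    have hsum := hdecay 0
    simp only [pow_zero, one_mul] at hsum
    refine Summable.of_norm_bounded ((hdecay N).mul_right (∑' i, ‖a i‖)) fun j => ?_
    rw [norm_mul, norm_mul, norm_pow, Complex.norm_intCast]
    have : ‖a (k - j)‖ ≤ ∑' i, ‖a i‖ := hsum.le_tsum (k - j) fun i _ => norm_nonneg _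
    calc ‖a j‖ * (|(j : ℝ)| ^ N * ‖a (k - j)‖) = |(j : ℝ)| ^ N * ‖a j‖ * ‖a (k - j)‖ := by ring
      _ ≤ _ := by gcongr
  have h1 := hs 1
  have h0 := hs 0
  simp only [pow_one, pow_zero, one_mul] at h1 h0
  -- The reflection `j ↦ k - j` replaces the factor `k - j` of the derivative by `j`, so the sum is
  -- half of the sum with the factor `k`.
  have hflip : ∑' j : ℤ, a j * ((j : ℂ) * a (k - j))
      = ∑' j : ℤ, a (k - j) * (((k - j : ℤ) : ℂ) * a j) := by
    rw [← (Equiv.subLeft k).tsum_eq]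
    simp
  have hlhs : ∑' j : ℤ, a j * (Complex.I * ((k - j : ℤ) : ℂ) * a (k - j))
      = Complex.I * ∑' j : ℤ, a j * ((j : ℂ) * a (k - j)) := by
    rw [hflip, ← tsum_mul_left]
    exact tsum_congr fun j => by ring
  have hlhs2 : ∑' j : ℤ, a j * (Complex.I * ((k - j : ℤ) : ℂ) * a (k - j))
      = Complex.I * (k * conv a a k - ∑' j : ℤ, a j * ((j : ℂ) * a (k - j))) := by
    unfold conv
    rw [← tsum_mul_left, ← (h0.mul_left (k : ℂ)).tsum_sub h1, ← tsum_mul_left]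
    exact tsum_congr fun j => by push_cast; ring
  rw [hlhs] at hlhs2
  have := mul_left_cancel₀ Complex.I_ne_zero hlhs2
  rw [hlhs]
  linear_combination (Complex.I / 2) * this

lemma ContHInf.eSobNorm_lt_top {I : Set ℝ} {u : ℝ → PerDist} (h : ContHInf I u) {t : ℝ}
    (ht : t ∈ I) (r : ℝ) : eSobNorm r (u t) < ⊤ := by
  obtain ⟨v, -, hv⟩ := h r
  rw [← hv t ht]
  exact (v t).2

/-! ### Existence and smooth dependence -/

lemma contHInf_of_unwgt {α ρ s : ℝ} (hα : 0 ≤ α) {T : Ioc (0 : ℝ) 1} {u : CSob 0 T s}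
    {U : CSob 0 T ρ} (h : ∀ t ∈ Ioc (0 : ℝ) T, ∀ k, coeff (curve u t) k = unwgt α U t k) :
    ContHInf (Ioo 0 T) (curve u) := by
  intro r
  have hv : ∀ (t : ℝ) (ht : t ∈ Ioc (0 : ℝ) T), (sobOf r (unwgt α U t)).dist = curve u t ∧
      ∀ τ, 0 < τ → ∀ L : CSob 0 T ρ →L[ℂ] CSob τ T r, (∀ U (t : Icc τ (T : ℝ)) k,
      coeff (L U t).dist k = unwgt α U t k) → ∀ hτ : τ ≤ t,
        L U ⟨t, hτ, ht.2⟩ = sobOf r (unwgt α U t) := by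
    intro t ht
    obtain ⟨L, hL⟩ := exists_smoothing (ρ := ρ) hα (T := T) ht.1 r
    have hs : Summable fun k => jb k ^ r * ‖unwgt α U t k‖ ^ 2 := by
      have := sob_summable (L U ⟨t, le_rfl, ht.2⟩)
      simpa only [hL] using this
    refine ⟨perDist_ext fun k => by rw [coeff_sobOf hs, h t ht], fun τ hτ L' hL' hle => ?_⟩
    exact sob_ext fun k => by rw [coeff_sobOf hs, hL']
  refine ⟨fun t => sobOf r (unwgt α U t), fun t ht => ?_, fun t ht => (hv t ⟨ht.1, ht.2.le⟩).1⟩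
  have h2 : 0 < t / 2 := half_pos ht.1
  obtain ⟨L, hL⟩ := exists_smoothing (ρ := ρ) hα (T := T) h2 r
  have hc : ContinuousOn (fun t => sobOf r (unwgt α U t)) (Icc (t / 2) T) := by
    rw [continuousOn_iff_continuous_domRestrict]
    refine (L U).continuous.congr fun t' => ?_
    exact (hv t' ⟨h2.trans_le t'.2.1, t'.2.2⟩).2 _ h2 L hL t'.2.1
  refine (hc.continuousAt ?_).continuousWithinAt
  exact Icc_mem_nhds (half_lt_self ht.1) ht.2

lemma summable_half_weight (ψ : SmoothPer) :
    Summable fun k : ℤ => jb k ^ (1 / 2 : ℝ) * ‖coeffPer ψ (-k)‖ := by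
  have h := (Equiv.neg ℤ).summable_iff.2 (summable_decay ψ 1)
  refine Summable.of_nonneg_of_le (fun k => by have := jb_pos k; positivity) (fun k => ?_) h
  simp only [Function.comp_apply, Equiv.neg_apply, Int.cast_neg, abs_neg, pow_one]
  refine mul_le_mul_of_nonneg_right ?_ (norm_nonneg _)
  rw [← Real.sqrt_eq_rpow]
  refine Real.sqrt_le_iff.2 ⟨by positivity, ?_⟩
  rw [jb, ← sq_abs (k : ℝ)]
  nlinarith [abs_nonneg (k : ℝ)]

/-- A curve that satisfies the integral equation for each Fourier coefficient, and has the weighted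
bounds, is a solution. -/
lemma isSolution_of_coeff {β η α ρ s : ℝ} (hη : 0 < η) (hα : 0 ≤ α) (hα' : α < 1 / 4) (hρ : 0 ≤ ρ)
    {T : Ioc (0 : ℝ) 1} {φ : Sob s} {u : CSob 0 T s} {U : CSob 0 T ρ}
    (hU : ∀ t ∈ Ioc (0 : ℝ) T, ∀ k, coeff (curve u t) k = unwgt α U t k)
    (hu : ∀ t ∈ Icc (0 : ℝ) T, ∀ k, coeff (curve u t) k = sym β η t k * coeff φ.dist k
      - duh β η (fun t' => conv (unwgt α U t') (unwgt α U t')) t k) :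
    IsSolution β η T φ u := by
  have hH := contHInf_of_unwgt hα hU
  refine ⟨hH, fun t ht ψ => ?_⟩
  set F : ℤ → ℝ → ℂ := fun k t' => 2 * π * (sym β η (t - t') k * (Complex.I * k / 2
    * conv (unwgt α U t') (unwgt α U t') k) * coeffPer ψ (-k)) with hF
  set G : ℝ → ℂ := fun t' => pair (semigroup β η (t - t') (nonlin (curve u t'))) ψ with hG
  set A := 2 ^ (ρ / 2) * (‖U‖ * ‖U‖) with hA
  set bd : ℤ → ℝ → ℝ := fun k t' =>
    2 * π * (A * t' ^ (-(2 * α)) * (jb k ^ (1 / 2 : ℝ) * ‖coeffPer ψ (-k)‖)) with hbd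
  -- The endpoint `t' = t` is left out because `u` is only known to be smooth on the open interval.
  have hFs : ∀ t' ∈ Ioc 0 t, t' ≠ t → HasSum (fun k => F k t') (G t') := by
    intro t' ht' hne
    have hlt : t' < t := lt_of_le_of_ne ht'.2 hne
    have hm : t' ∈ Ioo (0 : ℝ) T := ⟨ht'.1, hlt.trans_le ht.2⟩
    refine (hasSum_pair _ ψ).congr_fun fun k => ?_
    rw [coeff_semigroup β hη (sub_nonneg.2 ht'.2), coeff_nonlin (hH.eSobNorm_lt_top hm),
      show coeff (curve u t') = unwgt α U t' from funext (hU t' ⟨hm.1, hm.2.le⟩)]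
  have hFb : ∀ k, ∀ t' ∈ Ioc 0 t, ‖F k t'‖ ≤ bd k t' := by
    intro k t' ht'
    have hk := jb_pos k
    have h0 := Real.rpow_nonneg ht'.1.le (-(2 * α))
    have h2 : ‖conv (unwgt α U t') (unwgt α U t') k‖ ≤ A * t' ^ (-(2 * α)) :=
      norm_conv_unwgt_le hρ U U ⟨ht'.1, ht'.2.trans ht.2⟩ k
    have h3 := norm_half_deriv_symbol_le k
    have h4 := norm_sym_le_one β hη (sub_nonneg.2 ht'.2) k
    have e : ‖(2 * π : ℂ)‖ = 2 * π := by
      rw [norm_mul, Complex.norm_real, Real.norm_of_nonneg Real.pi_pos.le]; simp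
    have hpi := Real.pi_pos
    simp only [hF, hbd, norm_mul, e]
    calc 2 * π * (‖sym β η (t - t') k‖ * (‖Complex.I * (k : ℂ) / 2‖
          * ‖conv (unwgt α U t') (unwgt α U t') k‖) * ‖coeffPer ψ (-k)‖)
        ≤ 2 * π * (1 * (jb k ^ (1 / 2 : ℝ) * (A * t' ^ (-(2 * α)))) * ‖coeffPer ψ (-k)‖) := by
          gcongr
      _ = _ := by ring
  have hcont : ∀ k, IntervalIntegrable (fun t' => sym β η (t - t') k * (Complex.I * k / 2
      * conv (unwgt α U t') (unwgt α U t') k)) volume 0 t := fun k =>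
    ((intervalIntegrable_conv hρ hα' U U ht k).const_mul (Complex.I * k / 2)).continuousOn_mul
      ((continuous_sym β η k).comp (continuous_const.sub continuous_id)).continuousOn
  have hFm : ∀ k, AEStronglyMeasurable (F k) (volume.restrict (uIoc 0 t)) := fun k =>
    (intervalIntegrable_iff.1
      (((hcont k).mul_const (coeffPer ψ (-k))).const_mul (2 * π : ℂ))).aestronglyMeasurable
  have hsum := summable_half_weight ψ
  have hrp : IntervalIntegrable (fun t' : ℝ => t' ^ (-(2 * α))) volume 0 t :=
    intervalIntegral.intervalIntegrable_rpow' (by linarith)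
  set K := ∑' k : ℤ, jb k ^ (1 / 2 : ℝ) * ‖coeffPer ψ (-k)‖ with hK
  have htb : ∀ t', HasSum (fun k => bd k t') (2 * π * (A * t' ^ (-(2 * α)) * K)) := fun t' =>
    (hsum.hasSum.mul_left _).mul_left _
  have hbi : IntervalIntegrable (fun t' => 2 * π * (A * t' ^ (-(2 * α)) * K)) volume 0 t :=
    ((hrp.const_mul A).mul_const K).const_mul (2 * π)
  have hae : ∀ᵐ t' ∂volume, t' ∈ uIoc 0 t → HasSum (fun k => F k t') (G t') := by
    filter_upwards [Measure.ae_ne volume t] with t' hne ht'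
    rw [uIoc_of_le ht.1] at ht'
    exact hFs t' ht' hne
  have hGi : IntervalIntegrable G volume 0 t := by
    rw [intervalIntegrable_iff] at hbi ⊢
    refine Integrable.mono' hbi ?_ ?_
    · refine aestronglyMeasurable_of_tendsto_ae (Filter.atTop : Filter (Finset ℤ))
        (f := fun S t' => ∑ k ∈ S, F k t') (fun S => ?_) ?_
      · exact Finset.aestronglyMeasurable_fun_sum S fun k _ => hFm k
      · exact (ae_restrict_iff' measurableSet_uIoc).2 hae
    · refine (ae_restrict_iff' measurableSet_uIoc).2 ?_
      filter_upwards [hae] with t' h1 ht'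
      have h2 := h1 ht'
      rw [uIoc_of_le ht.1] at ht'
      rw [← h2.tsum_eq]
      exact tsum_of_norm_bounded (htb t') fun k => hFb k t' ht'
  refine ⟨hGi, ?_⟩
  have hint := intervalIntegral.hasSum_integral_of_dominated_convergence (μ := volume) bd hFm
    (fun k => Filter.Eventually.of_forall fun t' ht' => by
      rw [uIoc_of_le ht.1] at ht'; exact hFb k t' ht')
    (Filter.Eventually.of_forall fun t' _ => (htb t').summable)
    (by simpa only [(htb _).tsum_eq] using hbi) hae
  have h1 := hasSum_pair (curve u t) ψ
  have h2 := hasSum_pair (semigroup β η t φ.dist) ψ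
  refine h1.unique ((h2.sub hint).congr_fun fun k => ?_)
  rw [hu t ht, coeff_semigroup β hη ht.1, hF]
  simp only [intervalIntegral.integral_const_mul, intervalIntegral.integral_mul_const]
  rw [duh]
  ring

/-! ### The weighted space -/

lemma eSobNorm_eq {s : ℝ} (f : Sob s) : eSobNorm s f.dist = ENNReal.ofReal ‖f‖ :=
  (ENNReal.ofReal_toReal (ne_of_lt f.2)).symm

lemma eXNorm_le {s : ℝ} {T : Ioc (0 : ℝ) 1} {u : CSob 0 T s} {U : CSob 0 T 0}
    (h : ∀ t ∈ Ioc (0 : ℝ) T, ∀ k,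
      t ^ (|s| / 2) * ‖coeff (curve u t) k‖ ≤ ‖coeff (curve U t) k‖) :
    eXNorm u ≤ ENNReal.ofReal (‖u‖ + ‖U‖) := by
  refine iSup₂_le fun t ht => ?_
  rw [ENNReal.ofReal_add (norm_nonneg _) (norm_nonneg _)]
  have ht' : t ∈ Icc (0 : ℝ) T := ⟨ht.1.le, ht.2⟩
  have hp : 0 < t ^ (|s| / 2) := Real.rpow_pos_of_pos ht.1 _
  have hle : ∀ k : ℤ, ‖coeff (curve u t) k‖ ≤ (t ^ (|s| / 2))⁻¹ * ‖coeff (curve U t) k‖ := fun k => by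
    rw [le_inv_mul_iff₀ hp]; exact h t ht k
  refine add_le_add ?_ ?_
  · rw [curve_eq u ht', eSobNorm_eq]
    exact ENNReal.ofReal_le_ofReal (ContinuousMap.norm_coe_le_norm u _)
  · have hb : Summable fun k : ℤ =>
        (jb k ^ ((0 : ℝ) / 2) * ‖(((t ^ (|s| / 2))⁻¹ : ℝ) : ℂ) * coeff (U ⟨t, ht'⟩).dist k‖) ^ 2 := by
      have := (sob_summable (U ⟨t, ht'⟩)).mul_left (((t ^ (|s| / 2))⁻¹) ^ 2)
      refine this.congr fun k => ?_
      rw [weighted_sq 0 (fun k => (((t ^ (|s| / 2))⁻¹ : ℝ) : ℂ) * coeff (U ⟨t, ht'⟩).dist k), norm_mul,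
        Complex.norm_real, Real.norm_of_nonneg (by positivity)]
      ring
    have hs : Summable fun k : ℤ => jb k ^ (0 : ℝ) * ‖coeff (curve u t) k‖ ^ 2 := by
      refine summable_of_dominated hb fun k => ?_
      have hk := jb_pos k
      rw [norm_mul, Complex.norm_real, Real.norm_of_nonneg (by positivity)]
      have := hle k
      rw [curve_eq U ht'] at this
      gcongr
    have hlt := (eSobNorm_lt_top_iff 0 (curve u t)).2 hs
    let f : Sob 0 := (⟨curve u t, hlt⟩ : sobSubmodule 0)
    have hf : f.dist = curve u t := rfl
    rw [← hf, eSobNorm_eq, ← ENNReal.ofReal_mul hp.le]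
    refine ENNReal.ofReal_le_ofReal ?_
    have h1 : ‖f‖ ≤ (t ^ (|s| / 2))⁻¹ * ‖U ⟨t, ht'⟩‖ := sob_norm_le_mul (by positivity) fun k => by
      have hk := jb_pos k
      have := hle k
      rw [curve_eq U ht'] at this
      rw [hf, mul_left_comm]
      gcongr
    rw [le_inv_mul_iff₀ hp] at h1
    exact h1.trans (ContinuousMap.norm_coe_le_norm U _)

lemma xspace_ext {s : ℝ} {T : Ioc (0 : ℝ) 1} {u v : XSpace s T} (h : u.toC = v.toC) : u = v :=
  Subtype.ext h

lemma exists_xspace {s : ℝ} {T : Ioc (0 : ℝ) 1} {u : CSob 0 T s} {U : CSob 0 T 0}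
    (h : ∀ t ∈ Ioc (0 : ℝ) T, ∀ k,
      t ^ (|s| / 2) * ‖coeff (curve u t) k‖ ≤ ‖coeff (curve U t) k‖) :
    ∃ x : XSpace s T, x.toC = u ∧ ‖x‖ ≤ ‖u‖ + ‖U‖ := by
  have h1 := eXNorm_le h
  refine ⟨(⟨u, h1.trans_lt ENNReal.ofReal_lt_top⟩ : xSubmodule s T), rfl, ?_⟩
  exact ENNReal.toReal_le_of_le_ofReal (by positivity) h1

/-- Continuous linear maps into the weighted space. -/
lemma exists_clm_xspace {F : Type*} [NormedAddCommGroup F] [NormedSpace ℂ F] {s : ℝ}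
    {T : Ioc (0 : ℝ) 1} (L : F →L[ℂ] CSob 0 T s) (L' : F →L[ℂ] CSob 0 T 0)
    (h : ∀ x, ∀ t ∈ Ioc (0 : ℝ) T, ∀ k,
      t ^ (|s| / 2) * ‖coeff (curve (L x) t) k‖ ≤ ‖coeff (curve (L' x) t) k‖) :
    ∃ M : F →L[ℂ] XSpace s T, ∀ x, (M x).toC = L x := by
  choose u hu hn using fun x => exists_xspace (h x)
  let M : F →ₗ[ℂ] XSpace s T :=
    { toFun := u
      map_add' := fun x y => xspace_ext <| by
        rw [hu, map_add]
        change _ = (u x).toC + (u y).toC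
        rw [hu, hu]
      map_smul' := fun z x => xspace_ext <| by
        rw [hu, map_smul]
        change _ = z • (u x).toC
        rw [hu] }
  refine ⟨M.mkContinuous (‖L‖ + ‖L'‖) fun x => (hn x).trans ?_, hu⟩
  rw [add_mul]
  exact add_le_add (L.le_opNorm x) (L'.le_opNorm x)

/-- Continuous bilinear maps into the weighted space. -/
lemma exists_clm₂_xspace {F : Type*} [NormedAddCommGroup F] [NormedSpace ℂ F] {s : ℝ}
    {T : Ioc (0 : ℝ) 1} {C C' : ℝ} (B : F →L[ℂ] F →L[ℂ] CSob 0 T s)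
    (B' : F →L[ℂ] F →L[ℂ] CSob 0 T 0) (hB : ∀ x y, ‖B x y‖ ≤ C * ‖x‖ * ‖y‖)
    (hB' : ∀ x y, ‖B' x y‖ ≤ C' * ‖x‖ * ‖y‖)
    (h : ∀ x y, ∀ t ∈ Ioc (0 : ℝ) T, ∀ k,
      t ^ (|s| / 2) * ‖coeff (curve (B x y) t) k‖ ≤ ‖coeff (curve (B' x y) t) k‖) :
    ∃ M : F →L[ℂ] F →L[ℂ] XSpace s T, ∀ x y, (M x y).toC = B x y := by
  choose u hu hn using fun x y => exists_xspace (h x y)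
  let M : F →ₗ[ℂ] F →ₗ[ℂ] XSpace s T := LinearMap.mk₂ ℂ u
    (fun x y z => xspace_ext <| by
      rw [hu, map_add]
      change _ = (u x z).toC + (u y z).toC
      rw [hu, hu]; rfl)
    (fun l x y => xspace_ext <| by
      rw [hu, map_smul]
      change _ = l • (u x y).toC
      rw [hu]; rfl)
    (fun x y z => xspace_ext <| by
      rw [hu, map_add]
      change _ = (u x y).toC + (u x z).toC
      rw [hu, hu])
    (fun l x y => xspace_ext <| by
      rw [hu, map_smul]
      change _ = l • (u x y).toC
      rw [hu])
  refine ⟨M.mkContinuous₂ (C + C') fun x y => (hn x y).trans ?_, hu⟩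
  rw [add_mul, add_mul]
  exact add_le_add (hB x y) (hB' x y)

lemma exists_small_time {θ K : ℝ} (hθ : 0 < θ) (hK : 0 < K) :
    ∃ T : Ioc (0 : ℝ) 1, (T : ℝ) ^ θ * K ≤ 1 := by
  have h0 : 0 < (K⁻¹) ^ (1 / θ) := by positivity
  refine ⟨⟨min 1 ((K⁻¹) ^ (1 / θ)), lt_min one_pos h0, min_le_left _ _⟩, ?_⟩
  have h1 : (min 1 ((K⁻¹) ^ (1 / θ))) ^ θ ≤ K⁻¹ := by
    calc _ ≤ ((K⁻¹) ^ (1 / θ)) ^ θ :=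
          Real.rpow_le_rpow (le_min zero_le_one h0.le) (min_le_right _ _) hθ.le
      _ = K⁻¹ := by
          rw [← Real.rpow_mul (by positivity), one_div_mul_cancel hθ.ne', Real.rpow_one]
  calc _ ≤ K⁻¹ * K := by gcongr
    _ = 1 := inv_mul_cancel₀ hK.ne'

/-- Existence and smooth dependence on a time interval depending only on the size of the data. -/
lemma exists_flow (β : ℝ) {η α ρ s : ℝ} (hη : 0 < η) (hα : 0 ≤ α) (hα' : α < 1 / 4) (hρ : 0 ≤ ρ)
    (hρs : ρ = s + 2 * α) (hX : s < 0 → |s| / 2 = α ∧ ρ = 0) {R : ℝ} (hR : 0 < R) :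
    ∃ (T : Ioc (0 : ℝ) 1) (U : Sob s → CSob 0 T ρ) (Φ : Sob s → CSob 0 T s),
      ContDiffOn ℂ ∞ U (Metric.ball 0 R) ∧ ContDiffOn ℂ ∞ Φ (Metric.ball 0 R) ∧
      (∀ φ ∈ Metric.ball 0 R, IsSolution β η T φ (Φ φ) ∧
        ∀ t ∈ Ioc (0 : ℝ) T, ∀ k, coeff (curve (Φ φ) t) k = unwgt α (U φ) t k) ∧
      (s < 0 → ∃ Ψ : Sob s → XSpace s T, (∀ φ, (Ψ φ).toC = Φ φ) ∧
        ContDiffOn ℂ ∞ Ψ (Metric.ball 0 R)) := by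
  obtain ⟨C₀, -, hL₀⟩ := exists_free β hη (le_refl (0 : ℝ))
  obtain ⟨C₁, hC₁, hL₁⟩ := exists_free β hη hα
  obtain ⟨C₂, -, hD₀⟩ := exists_duhamel β hη hα hα' (le_refl (0 : ℝ)) hα
  obtain ⟨C₃, hC₃, hD₁⟩ := exists_duhamel β hη hα hα' hα le_rfl
  have hθ : 0 < (1 / 4 - α) / 2 := by linarith
  obtain ⟨T, hT⟩ := exists_small_time hθ (K := 8 * (C₃ * 2 ^ (ρ / 2)) * (C₁ * R)) (by positivity)
  obtain ⟨L, hL, -⟩ := hL₀ s s 0 T (by ring) le_rfl zero_le_one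
  obtain ⟨L', hL', hLn⟩ := hL₁ s ρ 1 T hρs zero_le_one le_rfl
  obtain ⟨D, hD, hDn₀⟩ := hD₀ s ρ s 0 T hρ hρs (by ring) le_rfl zero_le_one
  obtain ⟨D', hD', hDn⟩ := hD₁ s ρ ρ 1 T hρ hρs hρs zero_le_one le_rfl
  have hT0 : (0 : ℝ) < T := T.2.1
  obtain ⟨G, hG, hGs⟩ := exists_quadratic_inverse D' (R := C₁ * R) (by positivity) hDn
    (by calc _ = (T : ℝ) ^ ((1 / 4 - α) / 2) * (8 * (C₃ * 2 ^ (ρ / 2)) * (C₁ * R)) := by ring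
          _ ≤ 1 := hT)
  have hmaps : ∀ φ ∈ Metric.ball (0 : Sob s) R, L' φ ∈ Metric.ball (0 : CSob 0 T ρ) (C₁ * R) := by
    intro φ hφ
    rw [mem_ball_zero_iff] at hφ ⊢
    exact (hLn φ).trans_lt (by gcongr)
  have hU : ContDiffOn ℂ ∞ (fun φ => G (L' φ)) (Metric.ball 0 R) :=
    hGs.comp L'.contDiff.contDiffOn hmaps
  have hweight : ∀ t : ℝ, 0 < t → ∀ k : ℤ,
      t ^ (-α) * Real.exp (-(√t * |(k : ℝ)|)) * wgt α 1 t k = 1 := by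
    intro t ht k
    rw [wgt, one_mul, mul_mul_mul_comm, ← Real.rpow_add ht, ← Real.exp_add]
    simp
  have hwgt : ∀ t : ℝ, 0 < t → ∀ k : ℤ, t ^ α ≤ wgt α 1 t k := fun t ht k => by
    rw [wgt, one_mul]
    exact le_mul_of_one_le_right (by positivity) (Real.one_le_exp (by positivity))
  have hΦ : ∀ φ, ∀ t ∈ Icc (0 : ℝ) T, ∀ k,
      coeff (curve (L φ - D (G (L' φ)) (G (L' φ))) t) k = sym β η t k * coeff φ.dist k
        - duh β η (fun t' => conv (unwgt α (G (L' φ)) t') (unwgt α (G (L' φ)) t')) t k := by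
    intro φ t ht k
    rw [curve_eq _ ht, ContinuousMap.sub_apply, coeff_dist_sub, hL, hD, wgt_zero_zero]
    simp
  have hbil : ∀ {H : Type} [NormedAddCommGroup H] [NormedSpace ℂ H]
      (M : CSob 0 T ρ →L[ℂ] CSob 0 T ρ →L[ℂ] H),
      ContDiffOn ℂ ∞ (fun φ => M (G (L' φ)) (G (L' φ))) (Metric.ball 0 R) := fun M =>
    M.isBoundedBilinearMap.contDiff.comp_contDiffOn (hU.prodMk hU)
  refine ⟨T, fun φ => G (L' φ), fun φ => L φ - D (G (L' φ)) (G (L' φ)), hU,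
    L.contDiff.contDiffOn.sub (hbil D), fun φ hφ => ?_, fun hs => ?_⟩
  · have hc : ∀ t ∈ Ioc (0 : ℝ) T, ∀ k,
        coeff (curve (L φ - D (G (L' φ)) (G (L' φ))) t) k = unwgt α (G (L' φ)) t k := by
      intro t ht k
      have ht' : t ∈ Icc (0 : ℝ) T := ⟨ht.1.le, ht.2⟩
      have h1 : G (L' φ) = L' φ - D' (G (L' φ)) (G (L' φ)) :=
        eq_sub_of_add_eq (hG _ (hmaps φ hφ))
      have h2 : coeff (curve (G (L' φ)) t) k = wgt α 1 t k * (sym β η t k * coeff φ.dist k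
          - duh β η (fun t' => conv (unwgt α (G (L' φ)) t') (unwgt α (G (L' φ)) t')) t k) := by
        conv_lhs => rw [h1]
        rw [curve_eq _ ht', ContinuousMap.sub_apply, coeff_dist_sub, hL', hD', mul_sub]
      rw [hΦ φ t ht', unwgt, h2, ← mul_assoc, ← Complex.ofReal_mul, hweight t ht.1,
        Complex.ofReal_one, one_mul]
    exact ⟨isSolution_of_coeff hη hα hα' hρ hc (hΦ φ), hc⟩
  · obtain ⟨hsα, hρ0⟩ := hX hs
    subst hρ0
    obtain ⟨M, hM⟩ := exists_clm_xspace L L' fun φ t ht k => by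
      have ht' : t ∈ Icc (0 : ℝ) T := ⟨ht.1.le, ht.2⟩
      rw [curve_eq _ ht', curve_eq _ ht', hL, hL', wgt_zero_zero, Complex.ofReal_one, one_mul,
        norm_mul (wgt α 1 t k : ℂ), Complex.norm_real, Real.norm_of_nonneg (wgt_nonneg ht.1.le k),
        hsα]
      exact mul_le_mul_of_nonneg_right (hwgt t ht.1 k) (norm_nonneg _)
    obtain ⟨N, hN⟩ := exists_clm₂_xspace D D' hDn₀ hDn fun x y t ht k => by
      have ht' : t ∈ Icc (0 : ℝ) T := ⟨ht.1.le, ht.2⟩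
      rw [curve_eq _ ht', curve_eq _ ht', hD, hD', wgt_zero_zero, Complex.ofReal_one, one_mul,
        norm_mul (wgt α 1 t k : ℂ), Complex.norm_real, Real.norm_of_nonneg (wgt_nonneg ht.1.le k),
        hsα]
      exact mul_le_mul_of_nonneg_right (hwgt t ht.1 k) (norm_nonneg _)
    refine ⟨fun φ => M φ - N (G (L' φ)) (G (L' φ)), fun φ => ?_,
      M.contDiff.contDiffOn.sub (hbil N)⟩
    change (M φ).toC - (N (G (L' φ)) (G (L' φ))).toC = _
    rw [hM, hN]

/-! ### Uniqueness -/

/-- The integral equation on `[0, τ]` for the Fourier coefficients `a`, with initial coefficients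
`c`. The factor `S(t)` is pulled out of the Duhamel integral, so that the integrand does not depend
on `t`. -/
def MildOn (β η τ : ℝ) (c : ℤ → ℂ) (a : ℝ → ℤ → ℂ) : Prop :=
  ∀ t ∈ Icc 0 τ, ∀ k,
    IntervalIntegrable (fun t' => sym β η (-t') k * (Complex.I * k / 2 * conv (a t') (a t') k))
      volume 0 t ∧
    a t k = sym β η t k * (c k
      - ∫ t' in (0 : ℝ)..t, sym β η (-t') k * (Complex.I * k / 2 * conv (a t') (a t') k))

lemma MildOn.eq_sub_duh {β η τ : ℝ} {c : ℤ → ℂ} {a : ℝ → ℤ → ℂ} (h : MildOn β η τ c a) {t : ℝ}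
    (ht : t ∈ Icc 0 τ) (k : ℤ) :
    a t k = sym β η t k * c k - duh β η (fun t' => conv (a t') (a t')) t k := by
  rw [(h t ht k).2, duh_eq, mul_sub]

lemma MildOn.initial {β η τ : ℝ} {c : ℤ → ℂ} {a : ℝ → ℤ → ℂ} (h : MildOn β η τ c a)
    (hτ : 0 ≤ τ) : a 0 = c := by
  funext k
  rw [(h 0 ⟨le_rfl, hτ⟩ k).2, sym_zero, intervalIntegral.integral_same, sub_zero, one_mul]

lemma MildOn.mono {β η τ τ' : ℝ} {c : ℤ → ℂ} {a : ℝ → ℤ → ℂ} (h : MildOn β η τ c a)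
    (hτ : τ' ≤ τ) : MildOn β η τ' c a :=
  fun t ht => h t ⟨ht.1, ht.2.trans hτ⟩

/-- A solution can be restarted at any time. -/
lemma MildOn.shift {β η τ t₀ : ℝ} {c : ℤ → ℂ} {a : ℝ → ℤ → ℂ} (h : MildOn β η τ c a)
    (ht₀ : t₀ ∈ Icc 0 τ) : MildOn β η (τ - t₀) (a t₀) fun t => a (t₀ + t) := by
  intro t ht k
  have hm : t₀ + t ∈ Icc 0 τ := ⟨add_nonneg ht₀.1 ht.1, by linarith [ht.2]⟩
  obtain ⟨i₀, e₀⟩ := h t₀ ht₀ k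
  obtain ⟨i₁, e₁⟩ := h (t₀ + t) hm k
  set g : ℝ → ℂ := fun t' => sym β η (-t') k * (Complex.I * k / 2 * conv (a t') (a t') k) with hg
  have i₂ : IntervalIntegrable g volume t₀ (t₀ + t) := i₀.symm.trans i₁
  have hshift : (fun t' => sym β η (-t') k
      * (Complex.I * k / 2 * conv (a (t₀ + t')) (a (t₀ + t')) k))
      = fun t' => sym β η t₀ k * g (t₀ + t') := by
    funext t'
    rw [hg]
    beta_reduce
    rw [← mul_assoc (sym β η t₀ k), ← sym_add]
    congr 2
    ring
  rw [hshift]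
  refine ⟨?_, ?_⟩
  · have := i₂.comp_add_left t₀
    simp only [sub_self, add_sub_cancel_left] at this
    exact this.const_mul _
  · change a (t₀ + t) k = _
    rw [e₁, intervalIntegral.integral_const_mul, intervalIntegral.integral_comp_add_left g t₀,
      add_zero, ← intervalIntegral.integral_interval_sub_left i₁ i₀, e₀, add_comm t₀ t, sym_add]
    ring

/-- Testing with exponentials gives the equation for each Fourier coefficient. -/
lemma IsSolution.mildOn {β η s : ℝ} (hη : 0 < η) {T : Ioc (0 : ℝ) 1} {φ : Sob s}
    {u : CSob 0 T s} (h : IsSolution β η T φ u) :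
    MildOn β η T (coeff φ.dist) fun t => coeff (curve u t) := by
  intro t ht k
  have hpi : (2 * π : ℂ) ≠ 0 := by exact_mod_cast Real.two_pi_pos.ne'
  obtain ⟨hi, he⟩ := h.2 t ht (expPer (-k))
  simp only [pair_expPer] at hi he
  set g : ℝ → ℂ := fun t' =>
    sym β η (-t') k * (Complex.I * k / 2 * conv (coeff (curve u t')) (coeff (curve u t')) k) with hg
  have hae : ∀ᵐ t' ∂volume, t' ∈ uIoc 0 t →
      2 * π * coeff (semigroup β η (t - t') (nonlin (curve u t'))) k
        = 2 * π * (sym β η t k * g t') := by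
    filter_upwards [Measure.ae_ne volume t] with t' hne ht'
    rw [uIoc_of_le ht.1] at ht'
    have hlt : t' < t := lt_of_le_of_ne ht'.2 hne
    rw [coeff_semigroup β hη (sub_nonneg.2 ht'.2),
      coeff_nonlin (h.1.eSobNorm_lt_top ⟨ht'.1, hlt.trans_le ht.2⟩), sym_sub,
      mul_assoc (sym β η t k)]
  rw [intervalIntegral.integral_congr_ae hae, intervalIntegral.integral_const_mul,
    intervalIntegral.integral_const_mul, coeff_semigroup β hη ht.1, ← mul_sub, ← mul_sub] at he
  refine ⟨?_, mul_left_cancel₀ hpi he⟩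
  have hi2 := hi.congr_ae ((ae_restrict_iff' measurableSet_uIoc).2 hae)
  have hs : sym β η t k ≠ 0 := Complex.exp_ne_zero _
  refine ((hi2.const_mul (2 * π : ℂ)⁻¹).const_mul (sym β η t k)⁻¹).congr_ae
    (Filter.Eventually.of_forall fun t' => ?_)
  simp only
  field_simp

lemma conv_sob_bound {ρ : ℝ} (hρ : 0 ≤ ρ) (f g : Sob ρ) (k : ℤ) :
    Summable (fun j => ‖coeff f.dist j * coeff g.dist (k - j)‖) ∧
      ‖conv (coeff f.dist) (coeff g.dist) k‖ ≤ 2 ^ (ρ / 2) * (‖f‖ * ‖g‖) * jb k ^ (-(ρ / 2)) := by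
  have := conv_bound hρ (le_refl (0 : ℝ)) f g zero_le_one zero_le_one (a := coeff f.dist)
    (b := coeff g.dist) (by simp) (by simp) k
  simpa using this

/-- The Duhamel estimate in `H^ρ` with the weight `t^α`. -/
lemma exists_duh_norm_bound (β : ℝ) {η α : ℝ} (hη : 0 < η) (hα : 0 ≤ α) (hα' : α < 1 / 4) :
    ∃ C > 0, ∀ (ρ A t : ℝ) (f : ℝ → ℤ → ℂ) (d : Sob ρ), 0 ≤ A → 0 < t → t ≤ 1 →
      (∀ t' ∈ Ioo 0 t, ∀ k, ‖f t' k‖ ≤ A * t' ^ (-(2 * α)) * jb k ^ (-(ρ / 2))) →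
      (∀ k, ‖coeff d.dist k‖ ≤ t ^ α * ‖duh β η f t k‖) →
      ‖d‖ ≤ C * A * t ^ ((1 / 4 - α) / 2) := by
  set θ := (1 / 4 - α) / 2 with hθ
  obtain ⟨C, hC, h⟩ := exists_duh_bound β (m := 3 / 4 + θ) (p := 2 * α) hη
    (by linarith) (by linarith) (by linarith) (by linarith)
  have hsum : Summable fun k => (jb k ^ (-(1 / 4) - θ)) ^ 2 := summable_jb_rpow_sq (by linarith)
  set K := √(2 * π * ∑' k, (jb k ^ (-(1 / 4) - θ)) ^ 2) with hK
  refine ⟨C * (K + 1), by positivity, fun ρ A t f d hA ht ht1 hf hd => ?_⟩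
  have hb : Summable fun k => (C * A * t ^ θ * jb k ^ (-(1 / 4) - θ)) ^ 2 := by
    simp only [mul_pow (C * A * t ^ θ)]
    exact hsum.mul_left _
  refine (sob_norm_le_of_dominated hb fun k => ?_).trans ?_
  · have hk := jb_pos k
    have h1 := h (ρ / 2) A 0 t k f hA le_rfl zero_le_one ht ht1 fun t' ht' => by
      simpa using hf t' ht' k
    simp only [zero_mul, neg_zero, Real.exp_zero, mul_one] at h1
    have e1 : t ^ α * t ^ (1 - (3 / 4 + θ) - 2 * α) = t ^ θ := by
      rw [← Real.rpow_add ht]; congr 1; rw [hθ]; ring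
    have e2 : jb k ^ (ρ / 2) * jb k ^ (1 / 2 - (3 / 4 + θ) - ρ / 2) = jb k ^ (-(1 / 4) - θ) := by
      rw [← Real.rpow_add hk]; congr 1; ring
    calc jb k ^ (ρ / 2) * ‖coeff d.dist k‖
        ≤ jb k ^ (ρ / 2) * (t ^ α * (C * A * t ^ (1 - (3 / 4 + θ) - 2 * α)
          * jb k ^ (1 / 2 - (3 / 4 + θ) - ρ / 2))) := by
          gcongr
          exact (hd k).trans (by gcongr)
      _ = C * A * (t ^ α * t ^ (1 - (3 / 4 + θ) - 2 * α))
          * (jb k ^ (ρ / 2) * jb k ^ (1 / 2 - (3 / 4 + θ) - ρ / 2)) := by ring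
      _ = _ := by rw [e1, e2]
  · simp only [mul_pow (C * A * t ^ θ), tsum_mul_left]
    rw [mul_left_comm, Real.sqrt_mul (by positivity), Real.sqrt_sq (by positivity), ← hK]
    have : C * A * t ^ θ * K ≤ C * A * t ^ θ * (K + 1) := by gcongr; linarith
    calc _ ≤ _ := this
      _ = _ := by ring

/-- The continuity method: a continuous function cannot cross a level `K` that it is unable to
reach. -/
lemma lt_of_bootstrap {g : ℝ → ℝ} {τ K : ℝ} (hg : ContinuousOn g (Icc 0 τ))
    (h : ∀ t ∈ Icc 0 τ, (∀ t' ∈ Ioo 0 t, g t' ≤ K) → g t < K) : ∀ t ∈ Icc 0 τ, g t < K := by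
  by_contra! hcon
  obtain ⟨t₁, ht₁, hK⟩ := hcon
  have hc : IsCompact {t ∈ Icc 0 τ | g t ∈ Ici K} :=
    isCompact_Icc.of_isClosed_subset (hg.preimage_isClosed_of_isClosed isClosed_Icc isClosed_Ici)
      fun t ht => ht.1
  obtain ⟨t₂, ht₂, hmin⟩ := hc.exists_isLeast ⟨t₁, ht₁, hK⟩
  refine absurd (h t₂ ht₂.1 fun t' ht' => ?_) (not_lt.2 ht₂.2)
  by_contra! hlt
  exact absurd (hmin ⟨⟨ht'.1.le, ht'.2.le.trans ht₂.1.2⟩, hlt.le⟩) (not_le.2 ht'.2)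

/-- A bound on the weighted norm, on a time interval that only depends on the `H^s` norm of the
data, for solutions that are continuous in `H^ρ` up to `t = 0`. -/
lemma exists_apriori (β : ℝ) {η α ρ s : ℝ} (hη : 0 < η) (hα : 0 ≤ α) (hα' : α < 1 / 4)
    (hρ : 0 ≤ ρ) (hρs : ρ = s + 2 * α) {R : ℝ} (hR : 0 < R) :
    ∃ K > 0, ∃ τ₀ > 0, ∀ (τ : ℝ) (φ : Sob s) (a : ℝ → ℤ → ℂ) (v : ℝ → Sob ρ), τ ≤ τ₀ →
      MildOn β η τ (coeff φ.dist) a → ‖φ‖ ≤ R → ContinuousOn v (Icc 0 τ) →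
      (∀ t ∈ Icc 0 τ, ∀ k, coeff (v t).dist k = a t k) → ∀ t ∈ Icc 0 τ, t ^ α * ‖v t‖ ≤ K := by
  obtain ⟨C₁, hC₁, hL⟩ := exists_free β hη hα
  obtain ⟨C₂, hC₂, hd⟩ := exists_duh_norm_bound β hη hα hα'
  have hθ : 0 < (1 / 4 - α) / 2 := by linarith
  -- The free evolution contributes at most `K / 2`, and the Duhamel integral at most `K / 4`.
  set K := 2 * C₁ * R with hK
  have hK0 : 0 < K := by positivity
  obtain ⟨τ₀, hτ₀⟩ := exists_small_time hθ (K := 4 * (C₂ * (2 ^ (ρ / 2) * K))) (by positivity)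
  obtain ⟨L, hLc, hLn⟩ := hL s ρ 0 ⟨1, one_pos, le_rfl⟩ hρs le_rfl zero_le_one
  refine ⟨K, hK0, τ₀, τ₀.2.1, fun τ φ a v hτ hm hφ hv hva => ?_⟩
  have hgc : ContinuousOn (fun t => t ^ α * ‖v t‖) (Icc 0 τ) :=
    (Real.continuous_rpow_const hα).continuousOn.mul hv.norm
  refine fun t ht => (lt_of_bootstrap (K := K) hgc (fun t ht hlt => ?_) t ht).le
  have ht1 : t ≤ 1 := ht.2.trans (hτ.trans τ₀.2.2)
  have ht01 : t ∈ Icc (0 : ℝ) ((⟨1, one_pos, le_rfl⟩ : Ioc (0 : ℝ) 1) : ℝ) := ⟨ht.1, ht1⟩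
  set d : Sob ρ := L φ ⟨t, ht01⟩ - ((t ^ α : ℝ) : ℂ) • v t with hdef
  have hdk : ∀ k, coeff d.dist k
      = ((t ^ α : ℝ) : ℂ) * duh β η (fun t' => conv (a t') (a t')) t k := by
    intro k
    rw [hdef, coeff_dist_sub, coeff_dist_smul, hLc, hva t ht, hm.eq_sub_duh ht]
    simp only [wgt, zero_mul, Real.exp_zero, mul_one]
    ring
  have hdn : ‖d‖ ≤ K / 4 := by
    rcases ht.1.eq_or_lt with h0 | h0
    · have : d = 0 := sob_ext fun k => by
        rw [hdk, ← h0, duh, intervalIntegral.integral_same, mul_zero, coeff_dist_zero]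
      rw [this, norm_zero]
      positivity
    · have hp : 0 < t ^ α := Real.rpow_pos_of_pos h0 α
      have h1 := hd ρ (2 ^ (ρ / 2) * (K * K)) t (fun t' => conv (a t') (a t')) d (by positivity) h0 ht1
        (fun t' ht' k => ?_) (fun k => ?_)
      · have h2 : t ^ ((1 / 4 - α) / 2) ≤ (τ₀ : ℝ) ^ ((1 / 4 - α) / 2) :=
          Real.rpow_le_rpow ht.1 (ht.2.trans hτ) hθ.le
        calc ‖d‖ ≤ _ := h1
          _ ≤ C₂ * (2 ^ (ρ / 2) * (K * K)) * (τ₀ : ℝ) ^ ((1 / 4 - α) / 2) := by gcongr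
          _ = (τ₀ : ℝ) ^ ((1 / 4 - α) / 2) * (4 * (C₂ * (2 ^ (ρ / 2) * K))) * (K / 4) := by ring
          _ ≤ 1 * (K / 4) := by gcongr
          _ = _ := one_mul _
      · have ht'm : t' ∈ Icc 0 τ := ⟨ht'.1.le, ht'.2.le.trans ht.2⟩
        have h2 := (conv_sob_bound hρ (v t') (v t') k).2
        rw [show coeff (v t').dist = a t' from funext (hva t' ht'm)] at h2
        refine h2.trans (mul_le_mul_of_nonneg_right ?_ (Real.rpow_nonneg (jb_pos k).le _))
        have hp' : 0 < t' ^ α := Real.rpow_pos_of_pos ht'.1 α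
        have h3 : ‖v t'‖ ≤ K * t' ^ (-α) := by
          rw [Real.rpow_neg ht'.1.le, ← div_eq_mul_inv, le_div_iff₀ hp', mul_comm]
          exact hlt t' ht'
        have e : t' ^ (-(2 * α)) = t' ^ (-α) * t' ^ (-α) := by
          rw [← Real.rpow_add ht'.1]; congr 1; ring
        rw [e]
        calc _ ≤ 2 ^ (ρ / 2) * (K * t' ^ (-α) * (K * t' ^ (-α))) := by
              have := Real.rpow_nonneg ht'.1.le (-α)
              gcongr
          _ = _ := by ring
      · rw [hdk, norm_mul, Complex.norm_real, Real.norm_of_nonneg hp.le]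
  have hLb : ‖L φ ⟨t, ht01⟩‖ ≤ K / 2 := by
    calc _ ≤ ‖L φ‖ := ContinuousMap.norm_coe_le_norm _ _
      _ ≤ C₁ * R := (hLn φ).trans (by gcongr)
      _ = _ := by rw [hK]; ring
  have he : ((t ^ α : ℝ) : ℂ) • v t = L φ ⟨t, ht01⟩ - d := by rw [hdef]; abel
  have hn : t ^ α * ‖v t‖ = ‖L φ ⟨t, ht01⟩ - d‖ := by
    rw [← he, norm_smul, Complex.norm_real, Real.norm_of_nonneg (Real.rpow_nonneg ht.1 α)]
  rw [hn]
  calc _ ≤ ‖L φ ⟨t, ht01⟩‖ + ‖d‖ := norm_sub_le _ _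
    _ < K := by linarith

/-- Two solutions with the same data and bounded weighted norms coincide for a short time that only
depends on the bound. -/
lemma exists_local_uniqueness (β : ℝ) {η α ρ : ℝ} (hη : 0 < η) (hα : 0 ≤ α) (hα' : α < 1 / 4)
    (hρ : 0 ≤ ρ) {A : ℝ} (hA : 0 < A) :
    ∃ h > 0, ∀ (τ : ℝ) (c : ℤ → ℂ) (a b : ℝ → ℤ → ℂ) (v w : ℝ → Sob ρ), τ ≤ h →
      MildOn β η τ c a → MildOn β η τ c b →
      (∀ t ∈ Ioc 0 τ, ∀ k, coeff (v t).dist k = a t k) →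
      (∀ t ∈ Ioc 0 τ, ∀ k, coeff (w t).dist k = b t k) →
      (∀ t ∈ Ioc 0 τ, t ^ α * ‖v t‖ ≤ A) → (∀ t ∈ Ioc 0 τ, t ^ α * ‖w t‖ ≤ A) →
      ∀ t ∈ Icc 0 τ, a t = b t := by
  obtain ⟨C, hC, hd⟩ := exists_duh_norm_bound β hη hα hα'
  have hθ : 0 < (1 / 4 - α) / 2 := by linarith
  obtain ⟨h, hh⟩ := exists_small_time hθ (K := 2 * (C * (2 ^ (ρ / 2) * (2 * A)))) (by positivity)
  refine ⟨h, h.2.1, fun τ c a b v w hτ ha hb hva hwb hvA hwA => ?_⟩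
  -- The Duhamel integral of `u² - u'² = (u - u') u + u' (u - u')` halves any bound for `u - u'`.
  have step : ∀ M ≥ 0, (∀ t ∈ Ioc 0 τ, t ^ α * ‖v t - w t‖ ≤ M) →
      ∀ t ∈ Ioc 0 τ, t ^ α * ‖v t - w t‖ ≤ M / 2 := by
    intro M hM0 hM t ht
    have hp : 0 < t ^ α := Real.rpow_pos_of_pos ht.1 α
    have htm : t ∈ Icc 0 τ := ⟨ht.1.le, ht.2⟩
    set d : Sob ρ := ((t ^ α : ℝ) : ℂ) • (v t - w t) with hdef
    have hdn : ‖d‖ = t ^ α * ‖v t - w t‖ := by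
      rw [hdef, norm_smul, Complex.norm_real, Real.norm_of_nonneg hp.le]
    set f : ℝ → ℤ → ℂ := fun t' k => conv (a t') (a t') k - conv (b t') (b t') k with hf
    have hdk : ∀ k, coeff d.dist k = ((t ^ α : ℝ) : ℂ) * -duh β η f t k := by
      intro k
      obtain ⟨i₁, e₁⟩ := ha t htm k
      obtain ⟨i₂, e₂⟩ := hb t htm k
      rw [hdef, coeff_dist_smul, coeff_dist_sub, hva t ht, hwb t ht, duh_eq, e₁, e₂]
      simp only [hf, mul_sub]
      rw [intervalIntegral.integral_sub i₁ i₂]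
      ring
    have h1 := hd ρ (2 ^ (ρ / 2) * (2 * A) * M) t f d (by positivity) ht.1
      (ht.2.trans (hτ.trans h.2.2)) (fun t' ht' k => ?_) (fun k => ?_)
    · rw [← hdn]
      have h2 : t ^ ((1 / 4 - α) / 2) ≤ (h : ℝ) ^ ((1 / 4 - α) / 2) :=
        Real.rpow_le_rpow ht.1.le (ht.2.trans hτ) hθ.le
      calc ‖d‖ ≤ _ := h1
        _ ≤ C * (2 ^ (ρ / 2) * (2 * A) * M) * (h : ℝ) ^ ((1 / 4 - α) / 2) := by gcongr
        _ = (h : ℝ) ^ ((1 / 4 - α) / 2) * (2 * (C * (2 ^ (ρ / 2) * (2 * A)))) * (M / 2) := by ring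
        _ ≤ 1 * (M / 2) := by gcongr
        _ = _ := one_mul _
    · have hm : t' ∈ Ioc 0 τ := ⟨ht'.1, ht'.2.le.trans ht.2⟩
      have hp' : 0 < t' ^ α := Real.rpow_pos_of_pos ht'.1 α
      have hdiv : ∀ {x y : ℝ}, t' ^ α * x ≤ y → x ≤ y * t' ^ (-α) := fun {x y} hxy => by
        rw [Real.rpow_neg ht'.1.le, ← div_eq_mul_inv, le_div_iff₀ hp', mul_comm]
        exact hxy
      have hv := hdiv (hvA t' hm)
      have hw := hdiv (hwA t' hm)
      have hvw := hdiv (hM t' hm)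
      have ev : (fun j => coeff (v t' - w t').dist j + coeff (w t').dist j)
          = coeff (v t').dist := funext fun j => by
        rw [coeff_dist_sub]; ring
      have e : f t' k = conv (coeff (v t' - w t').dist) (coeff (v t').dist) k
          + conv (coeff (w t').dist) (coeff (v t' - w t').dist) k := by
        have c1 := conv_add_left (conv_sob_bound hρ (v t' - w t') (v t') k).1
          (conv_sob_bound hρ (w t') (v t') k).1
        have c2 := conv_add_right (conv_sob_bound hρ (w t') (v t' - w t') k).1
          (conv_sob_bound hρ (w t') (w t') k).1
        rw [ev] at c1 c2
        rw [hf]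
        beta_reduce
        rw [← funext (hva t' hm), ← funext (hwb t' hm), c1, c2]
        ring
      have e2 : t' ^ (-(2 * α)) = t' ^ (-α) * t' ^ (-α) := by
        rw [← Real.rpow_add ht'.1]; congr 1; ring
      have hr := Real.rpow_nonneg ht'.1.le (-α)
      have hk := jb_pos k
      rw [e, e2]
      calc _ ≤ 2 ^ (ρ / 2) * (‖v t' - w t'‖ * ‖v t'‖) * jb k ^ (-(ρ / 2))
            + 2 ^ (ρ / 2) * (‖w t'‖ * ‖v t' - w t'‖) * jb k ^ (-(ρ / 2)) :=
            (norm_add_le _ _).trans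
              (add_le_add (conv_sob_bound hρ _ _ k).2 (conv_sob_bound hρ _ _ k).2)
        _ ≤ 2 ^ (ρ / 2) * (M * t' ^ (-α) * (A * t' ^ (-α))) * jb k ^ (-(ρ / 2))
            + 2 ^ (ρ / 2) * (A * t' ^ (-α) * (M * t' ^ (-α))) * jb k ^ (-(ρ / 2)) := by gcongr
        _ = _ := by ring
    · rw [hdk, norm_mul, Complex.norm_real, Real.norm_of_nonneg hp.le, norm_neg]
  have hiter : ∀ n : ℕ, ∀ t ∈ Ioc 0 τ, t ^ α * ‖v t - w t‖ ≤ 2 * A / 2 ^ n := by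
    intro n
    induction n with
    | zero =>
      intro t ht
      have hp : 0 ≤ t ^ α := Real.rpow_nonneg ht.1.le α
      have := mul_le_mul_of_nonneg_left (norm_sub_le (v t) (w t)) hp
      rw [pow_zero, div_one]
      linarith [hvA t ht, hwA t ht]
    | succ n ih =>
      intro t ht
      refine (step _ (by positivity) ih t ht).trans (le_of_eq ?_)
      rw [pow_succ, div_div]
  intro t ht
  rcases ht.1.eq_or_lt with h0 | h0
  · rw [← h0, ha.initial (ht.1.trans ht.2), hb.initial (ht.1.trans ht.2)]
  · have hm : t ∈ Ioc 0 τ := ⟨h0, ht.2⟩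
    have hlim : Filter.Tendsto (fun n : ℕ => 2 * A / 2 ^ n) Filter.atTop (nhds 0) :=
      tendsto_const_nhds.div_atTop (tendsto_pow_atTop_atTop_of_one_lt one_lt_two)
    have h1 := ge_of_tendsto' hlim fun n => hiter n t hm
    have hp : 0 < t ^ α := Real.rpow_pos_of_pos h0 α
    have h2 : ‖v t - w t‖ = 0 := le_antisymm (by nlinarith) (norm_nonneg _)
    have h3 : v t = w t := sub_eq_zero.1 (norm_eq_zero.1 h2)
    funext k
    rw [← hva t hm, ← hwb t hm, h3]

/-- Every solution has bounded weighted norms: restart it at `t₀ > 0`, where it is smooth, use the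
a priori bound, and let `t₀ → 0`. -/
lemma IsSolution.exists_bound {β η α ρ s : ℝ} (hη : 0 < η) (hα : 0 ≤ α) (hα' : α < 1 / 4)
    (hρ : 0 ≤ ρ) (hρs : ρ = s + 2 * α) {T : Ioc (0 : ℝ) 1} {φ : Sob s} {u : CSob 0 T s}
    (h : IsSolution β η T φ u) {v : ℝ → Sob ρ} (hv : ContinuousOn v (Ioo 0 T))
    (hvu : ∀ t ∈ Ioo (0 : ℝ) T, (v t).dist = curve u t) {t₁ : ℝ} (ht₁ : t₁ < T) :
    ∃ A > 0, ∀ t ∈ Ioc 0 t₁, t ^ α * ‖v t‖ ≤ A := by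
  obtain ⟨K, hK, τ₀, hτ₀, hap⟩ :=
    exists_apriori β hη hα hα' hρ hρs (R := ‖u‖ + 1) (by positivity)
  have hm := h.mildOn hη
  have hsmall : ∀ t ∈ Ioo (0 : ℝ) T, t ≤ τ₀ → t ^ α * ‖v t‖ ≤ K := by
    intro t ht hle
    have key : ∀ t₀ ∈ Ioo 0 t, (t - t₀) ^ α * ‖v t‖ ≤ K := by
      intro t₀ ht₀
      have hm₀ : t₀ ∈ Icc (0 : ℝ) T := ⟨ht₀.1.le, ht₀.2.le.trans ht.2.le⟩
      have hms := (hm.shift hm₀).mono (τ' := t - t₀) (by linarith [ht.2])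
      have hin : ∀ x ∈ Icc 0 (t - t₀), t₀ + x ∈ Ioo (0 : ℝ) T := fun x hx =>
        ⟨by linarith [ht₀.1, hx.1], by linarith [hx.2, ht.2]⟩
      rw [curve_eq u hm₀] at hms
      have := hap (t - t₀) (u ⟨t₀, hm₀⟩) _ (fun x => v (t₀ + x)) (by linarith [ht₀.1]) hms
        ((ContinuousMap.norm_coe_le_norm u _).trans (by linarith))
        (hv.comp (Continuous.continuousOn (by fun_prop)) hin)
        (fun x hx k => by rw [hvu _ (hin x hx)]) (t - t₀) ⟨by linarith [ht₀.2], le_rfl⟩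
      simpa using this
    have hlim : Filter.Tendsto (fun t₀ : ℝ => (t - t₀) ^ α * ‖v t‖) (nhdsWithin 0 (Ioi 0))
        (nhds ((t - 0) ^ α * ‖v t‖)) := by
      refine Filter.Tendsto.mono_left (Continuous.tendsto ?_ 0) nhdsWithin_le_nhds
      exact ((Real.continuous_rpow_const hα).comp (continuous_const.sub continuous_id)).mul
        continuous_const
    rw [sub_zero] at hlim
    refine le_of_tendsto hlim ?_
    filter_upwards [Ioo_mem_nhdsGT ht.1] with t₀ ht₀ using key t₀ ht₀
  have hsub : Icc τ₀ t₁ ⊆ Ioo 0 (T : ℝ) := fun x hx => ⟨hτ₀.trans_le hx.1, hx.2.trans_lt ht₁⟩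
  obtain ⟨M, hM⟩ := isCompact_Icc.exists_bound_of_continuousOn (hv.mono hsub)
  refine ⟨K + |M|, by positivity, fun t ht => ?_⟩
  rcases le_total t τ₀ with hle | hle
  · exact (hsmall t ⟨ht.1, ht.2.trans_lt ht₁⟩ hle).trans (by linarith [abs_nonneg M])
  · have h1 : t ^ α ≤ 1 :=
      Real.rpow_le_one ht.1.le (ht.2.trans (ht₁.le.trans T.2.2)) hα
    have h2 := hM t ⟨hle, ht.2⟩
    calc t ^ α * ‖v t‖ ≤ 1 * |M| :=
          mul_le_mul h1 (h2.trans (le_abs_self M)) (norm_nonneg _) zero_le_one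
      _ ≤ _ := by linarith

/-- Unconditional uniqueness: the step size of the local uniqueness is the same all over a compact
subinterval of `[0, T)`, and the endpoint `T` follows by continuity. -/
lemma IsSolution.unique {β η α ρ s : ℝ} (hη : 0 < η) (hα : 0 ≤ α) (hα' : α < 1 / 4)
    (hρ : 0 ≤ ρ) (hρs : ρ = s + 2 * α) {T : Ioc (0 : ℝ) 1} {φ : Sob s} {u u' : CSob 0 T s}
    (h : IsSolution β η T φ u) (h' : IsSolution β η T φ u') : u = u' := by
  obtain ⟨v, hv, hvu⟩ := h.1 ρ
  obtain ⟨w, hw, hwu⟩ := h'.1 ρ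
  have hm := h.mildOn hη
  have hm' := h'.mildOn hη
  have hlt : ∀ t₁ ∈ Ico (0 : ℝ) T, coeff (curve u t₁) = coeff (curve u' t₁) := by
    intro t₁ ht₁
    obtain ⟨A, hA, hvA⟩ := h.exists_bound hη hα hα' hρ hρs hv hvu ht₁.2
    obtain ⟨A', hA', hwA⟩ := h'.exists_bound hη hα hα' hρ hρs hw hwu ht₁.2
    obtain ⟨δ, hδ, hloc⟩ := exists_local_uniqueness β hη hα hα' hρ (A := A + A') (by positivity)
    have hstep : ∀ n : ℕ, ∀ t ∈ Icc 0 t₁, t ≤ n * δ →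
        coeff (curve u t) = coeff (curve u' t) := by
      intro n
      induction n with
      | zero =>
        intro t ht htn
        have h0 : t = 0 := le_antisymm (by simpa using htn) ht.1
        have e := hm.initial T.2.1.le
        have e' := hm'.initial T.2.1.le
        rw [h0]
        exact e.trans e'.symm
      | succ n ih =>
        intro t ht htn
        rcases le_total t (n * δ) with hle | hle
        · exact ih t ht hle
        set t₀ := n * δ with ht₀
        have hn0 : 0 ≤ t₀ := by positivity
        have hm₀ : t₀ ∈ Icc (0 : ℝ) T := ⟨hn0, hle.trans (ht.2.trans ht₁.2.le)⟩
        have htT : t < T := ht.2.trans_lt ht₁.2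
        have hms := (hm.shift hm₀).mono (τ' := t - t₀) (by linarith)
        have hms' := (hm'.shift hm₀).mono (τ' := t - t₀) (by linarith)
        rw [← ih t₀ ⟨hn0, hle.trans ht.2⟩ le_rfl] at hms'
        have hin : ∀ x ∈ Ioc 0 (t - t₀), t₀ + x ∈ Ioc 0 t₁ := fun x hx =>
          ⟨by linarith [hx.1], by linarith [hx.2, ht.2]⟩
        have hinT : ∀ x ∈ Ioc 0 (t - t₀), t₀ + x ∈ Ioo (0 : ℝ) T := fun x hx =>
          ⟨(hin x hx).1, (hin x hx).2.trans_lt ht₁.2⟩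
        have hmono : ∀ x ∈ Ioc 0 (t - t₀), x ^ α ≤ (t₀ + x) ^ α := fun x hx =>
          Real.rpow_le_rpow hx.1.le (by linarith) hα
        have := hloc (t - t₀) _ _ _ (fun x => v (t₀ + x)) (fun x => w (t₀ + x))
          (by push_cast at htn; linarith) hms hms'
          (fun x hx k => by rw [hvu _ (hinT x hx)]) (fun x hx k => by rw [hwu _ (hinT x hx)])
          (fun x hx => ((mul_le_mul_of_nonneg_right (hmono x hx) (norm_nonneg _)).trans
            (hvA _ (hin x hx))).trans (by linarith))
          (fun x hx => ((mul_le_mul_of_nonneg_right (hmono x hx) (norm_nonneg _)).trans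
            (hwA _ (hin x hx))).trans (by linarith))
          (t - t₀) ⟨by linarith, le_rfl⟩
        simpa using this
    obtain ⟨n, hn⟩ := exists_nat_ge (t₁ / δ)
    exact hstep n t₁ ⟨ht₁.1, le_rfl⟩ ((div_le_iff₀ hδ).1 hn)
  have hall : ∀ k, EqOn (fun t => coeff (curve u t) k) (fun t => coeff (curve u' t) k)
      (closure (Ico (0 : ℝ) T)) := fun k =>
    EqOn.closure (fun t ht => congrFun (hlt t ht) k) (continuous_coeff_curve u k)
      (continuous_coeff_curve u' k)
  rw [closure_Ico (ne_of_lt T.2.1)] at hall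
  refine csob_ext fun t k => ?_
  have := hall k t.2
  simp only at this
  rwa [curve_eq u t.2, curve_eq u' t.2] at this

end ChenLee

end

theorem theorem1 (β η s : ℝ) (hβ : 0 ≤ β) (hη : 0 < η) (hs : -(1 / 2) < s) :
    ∃ T : ℝ → Set.Ioc (0 : ℝ) 1, ∀ φ₀ : ChenLee.Sob s,
      -- existence and uniqueness on `[0, T(‖φ₀‖)]`
      (∃! u : ChenLee.CSob 0 (T ‖φ₀‖) s, ChenLee.IsSolution β η (T ‖φ₀‖) φ₀ u) ∧
      -- the flow map on the time interval `[0, T(‖φ₀‖)]`, near `φ₀`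
      ∃ ε > 0, ∃ Φ : ChenLee.Sob s → ChenLee.CSob 0 (T ‖φ₀‖) s,
        (∀ φ ∈ Metric.ball φ₀ ε, ChenLee.IsSolution β η (T ‖φ₀‖) φ (Φ φ) ∧
          ∀ v, ChenLee.IsSolution β η (T ‖φ₀‖) φ v → v = Φ φ) ∧
        -- smooth into `C([0, T]; H^s)`
        ContDiffOn ℂ ∞ Φ (Metric.ball φ₀ ε) ∧
        -- smooth into `C((0, T]; H^∞)`, the projective limit of the spaces `C([τ, T]; H^r)`
        (∀ r : ℝ, ∀ τ ∈ Set.Ioo (0 : ℝ) (T ‖φ₀‖),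
          ∃ Ψ : ChenLee.Sob s → ChenLee.CSob τ (T ‖φ₀‖) r,
            (∀ φ ∈ Metric.ball φ₀ ε, ∀ t : Set.Icc τ (T ‖φ₀‖ : ℝ),
              (Ψ φ t).dist = ChenLee.curve (Φ φ) t) ∧
            ContDiffOn ℂ ∞ Ψ (Metric.ball φ₀ ε)) ∧
        -- smooth into the weighted space `X_T^s` when `s < 0`
        (s < 0 → ∃ Ψ : ChenLee.Sob s → ChenLee.XSpace s (T ‖φ₀‖),
          (∀ φ ∈ Metric.ball φ₀ ε, (Ψ φ).toC = Φ φ) ∧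
          ContDiffOn ℂ ∞ Ψ (Metric.ball φ₀ ε)) := by
  set α := max (-s) 0 / 2 with hαd
  set ρ := max s 0 with hρd
  have hα : 0 ≤ α := by positivity
  have hα' : α < 1 / 4 := by
    rcases max_cases (-s) 0 with h | h <;> rw [hαd, h.1] <;> linarith
  have hρ : 0 ≤ ρ := le_max_right _ _
  have hρs : ρ = s + 2 * α := by
    rcases le_total s 0 with h | h
    · rw [hρd, hαd, max_eq_right h, max_eq_left (by linarith : 0 ≤ -s)]; ring
    · rw [hρd, hαd, max_eq_left h, max_eq_right (by linarith : -s ≤ 0)]; ring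
  have hX : s < 0 → |s| / 2 = α ∧ ρ = 0 := fun h => by
    rw [hαd, hρd, abs_of_neg h, max_eq_left (by linarith : 0 ≤ -s), max_eq_right h.le]
    exact ⟨rfl, rfl⟩
  choose T U Φ hU hΦ hsol hΨ using fun x : ℝ =>
    ChenLee.exists_flow β hη hα hα' hρ hρs hX (R := |x| + 1) (by positivity)
  refine ⟨T, fun φ₀ => ?_⟩
  have hball : Metric.ball φ₀ 1 ⊆ Metric.ball (0 : ChenLee.Sob s) (|‖φ₀‖| + 1) := by
    refine Metric.ball_subset_ball' ?_
    rw [dist_zero_right, abs_norm, add_comm]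
  have huniq : ∀ φ ∈ Metric.ball φ₀ 1, ∀ v, ChenLee.IsSolution β η (T ‖φ₀‖) φ v →
      v = Φ ‖φ₀‖ φ := fun φ hφ v hv =>
    hv.unique hη hα hα' hρ hρs (hsol ‖φ₀‖ φ (hball hφ)).1
  have hself := Metric.mem_ball_self (x := φ₀) (one_pos (α := ℝ))
  refine ⟨⟨Φ ‖φ₀‖ φ₀, (hsol ‖φ₀‖ φ₀ (hball hself)).1, huniq φ₀ hself⟩, 1, one_pos, Φ ‖φ₀‖,
    fun φ hφ => ⟨(hsol ‖φ₀‖ φ (hball hφ)).1, huniq φ hφ⟩, (hΦ ‖φ₀‖).mono hball,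
    fun r τ hτ => ?_, fun hs0 => ?_⟩
  · obtain ⟨L, hL⟩ := ChenLee.exists_smoothing (ρ := ρ) hα (T := T ‖φ₀‖) hτ.1 r
    refine ⟨fun φ => L (U ‖φ₀‖ φ), fun φ hφ t => ChenLee.perDist_ext fun k => ?_,
      L.contDiff.comp_contDiffOn ((hU ‖φ₀‖).mono hball)⟩
    rw [hL, (hsol ‖φ₀‖ φ (hball hφ)).2 t ⟨hτ.1.trans_le t.2.1, t.2.2⟩]
  · obtain ⟨Ψ, hΨ₁, hΨ₂⟩ := hΨ ‖φ₀‖ hs0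
    exact ⟨Ψ, fun φ _ => hΨ₁ φ, hΨ₂.mono hball⟩
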